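/- **Setting.** Let $n\in\{2,3\}$, let $\Omega\subset\mathbb R^n$ be a bounded domain with polygonal/polyhedral boundary $\Gamma$ and without cracks (that is, $\Omega$ is the interior of its closure), and let $\Gamma_D\subseteq\Gamma$ have positive surface measure. Norms of vectors and tensors are Euclidean (Frobenius), $\|\cdot\|_{0}$ is the $L^2(\Omega)$-norm, $\|v\|_1^2=\|v\|_0^2+|v|_1^2$ with $|v|_1=\|\nabla v\|_0$; $(\nabla v)_{ij}=\partial_j v_i$; $\mathbf e(v)$ and $\boldsymbol\omega(v)$ are the symmetric and skew-symmetric parts of $\nabla v$; $\mathbf{div}$ acts on rows; $\tau^{\rm d}=\tau-\frac1n(\mathrm{tr}\,\tau)I$; $(u\otimes w)_{ij}=u_iw_j$. Data: $\gamma>0$; $\alpha\in\mathbb R^2$; $g\in\mathbb R^n$; a function $\nu:\mathbb R^2\to\mathbb R$ with $\nu_1\le\nu\le\nu_2$ and $|\nu(a)-\nu(b)|\le L_\nu|a-b|$ on $\mathbb R^2$, where $\nu_1,\nu_2,L_\nu>0$; $\mathbb K=\mathrm{diag}(k_1,k_2)$ with $k_i\in L^\infty(\Omega)$ and $k_i\ge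 k_0>0$ a.e., $\|\mathbb K\|_\infty=\max_i\|k_i\|_{L^\infty}$; and $\varphi_D\in H^{1/2}(\Gamma_D)^2$, the space of traces on $\Gamma_D$ of functions of $H^1(\Omega)^2$, normed by $\|\varphi_D\|_{1/2,\Gamma_D}=\min\{\|\varphi\|_1:\varphi\in H^1(\Omega)^2,\ \varphi|_{\Gamma_D}=\varphi_D\}$. (The vector of temperature and concentration has two components for both values of $n$.) **Spaces.** $\mathbb L^2_{\rm tr}$ is the space of symmetric trace-free tensor fields in $L^2(\Omega)^{n\times n}$; $\mathbb H_0(\mathbf{div})=\{\tau\in L^2(\Omega)^{n\times n}:\mathbf{div}\,\tau\in L^2(\Omega)^n,\ \int_\Omega\mathrm{tr}\,\tau=0\}$ with $\|\tau\|_{\mathbf{div}}^2=\|\tau\|_0^2+\|\mathbf{div}\,\tau\|_0^2$; $\mathbb H=\mathbb L^2_{\rm tr}\times\mathbb H_0(\mathbf{div})\times H^1_0(\Omega)^n$ with $\|(r,\tau,v)\|_{\mathbb H}^2=\|r\|_0^2+\|\tau\|_{\mathbf{div}}^2+\|v\|_1^2$; $H^1_{\Gamma_D}=\{\psi\in H^1(\Omega)^2:\psi|_{\Gamma_D}=0\}$;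 and, for $r>0$, $W_r=\{(w,\phi)\in H^1_0(\Omega)^n\times H^1(\Omega)^2:\|w\|_1+\|\phi\|_1\le r\}$. **Problem.** For $\vec t=(t,\sigma,u)$ and $\vec r=(r,\tau,v)$ in $\mathbb H$ put $$\begin{aligned}A_\phi(\vec t,\vec r)={}&2\int_\Omega\nu(\phi)\,t:(r-\kappa_3\tau^{\rm d})+\int_\Omega t:(\tau^{\rm d}-\kappa_1\mathbf e(v))-\int_\Omega\sigma^{\rm d}:(r-\kappa_3\tau^{\rm d})+(1-\kappa_2\gamma)\int_\Omega u\cdot\mathbf{div}\,\tau-\int_\Omega v\cdot\mathbf{div}\,\sigma\\&+\int_\Omega\boldsymbol\omega(u):\tau-\int_\Omega\sigma:\boldsymbol\omega(v)+\gamma\int_\Omega u\cdot v+\kappa_2\int_\Omega\mathbf{div}\,\sigma\cdot\mathbf{div}\,\tau+\kappa_1\int_\Omega\mathbf e(u):\mathbf e(v),\end{aligned}$$ $B_w(\vec t,\vec r)=\int_\Omega(u\otimes w)^{\rm d}:(\kappa_3\tau^{\rm d}-r)$, $F_\phi(\vec r)=\int_\Omega(\alpha\cdot\phi)\,g\cdot(v-\kappa_2\mathbf{div}\,\tau)$,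 $C(\chi,\psi)=\int_\Omega\mathbb K\nabla\chi:\nabla\psi$, $G_{w,\phi}(\psi)=-\int_\Omega(\nabla\phi)w\cdot\psi$. The semi-augmented mixed-primal problem is: find $(\vec t,\varphi)\in\mathbb H\times H^1(\Omega)^2$, $\vec t=(t,\sigma,u)$, with $\varphi|_{\Gamma_D}=\varphi_D$ and $$A_\varphi(\vec t,\vec r)+B_u(\vec t,\vec r)=F_\varphi(\vec r)\ \ \forall\,\vec r\in\mathbb H,\qquad C(\varphi,\psi)=G_{u,\varphi}(\psi)\ \ \forall\,\psi\in H^1_{\Gamma_D}.\tag{P}$$ **Constants.** $c_1=\|i\|^2$ with $i:H^1(\Omega)^n\to L^4(\Omega)^n$ the injection; $c_2$ is the best constant in $c_2\|\tau\|_0^2\le\|\tau^{\rm d}\|_0^2+\|\mathbf{div}\,\tau\|_0^2$ on $\mathbb H_0(\mathbf{div})$; $c_{\rm gp}$ is the best constant in $\|\psi\|_1\le c_{\rm gp}|\psi|_1$ on $H^1_{\Gamma_D}$; for $\varepsilon\in(0,1)$, $C_\varepsilon$ and $\widetilde C_\varepsilon$ are the norms of the injections $H^\varepsilon(\Omega)^{n\times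 n}\to L^{2n/(n-2\varepsilon)}(\Omega)^{n\times n}$ and $H^1(\Omega)^2\to L^{n/\varepsilon}(\Omega)^2$, where $\|\cdot\|_\varepsilon$ is the Sobolev–Slobodeckij norm. With parameters $\delta_1,\delta_2,\delta_3$, $$\alpha(\Omega)=\min\Big\{2\nu_1-\tfrac{\kappa_3\nu_2}{\delta_1}-\tfrac{\kappa_1}{2\delta_3},\ c_2\min\big\{\kappa_3(1-\nu_2\delta_1),\tfrac{\kappa_2}2(1-\tfrac{\gamma\delta_2}2)\big\},\ \tfrac{\kappa_2}2(1-\tfrac{\gamma\delta_2}2),\ \gamma(1-\tfrac{\kappa_2}{2\delta_2}),\ \tfrac{\kappa_1}2(1-\delta_3)\Big\},$$ $r_0=\dfrac{\alpha(\Omega)}{2c_1(2+\kappa_3^2)^{1/2}}$, $C_{\mathcal A}=\dfrac{2\sqrt2(2+\kappa_2^2)^{1/2}}{\alpha(\Omega)}$, $\widetilde\alpha=k_0c_{\rm gp}^{-2}$, $C_{\mathcal B}=\max\{\widetilde\alpha^{-1}c_1,\ \widetilde\alpha^{-1}\|\mathbb K\|_\infty+1\}$, $L_{\mathcal B}=rc_1/\widetilde\alpha$,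 $$L_{\mathcal A}=\tfrac2{\alpha(\Omega)}\max\big\{c_1(2+\kappa_3^2)^{1/2},\ 2L_\nu(2+\kappa_3^2)^{1/2}C_\varepsilon,\ \sqrt2(2+\kappa_2^2)^{1/2}\big\}.$$ **Theorem.** Let $\delta_1\in(0,\frac1{\nu_2})$, $\delta_2\in(0,\frac2\gamma)$, $\delta_3\in(0,1)$, $\kappa_3\in(0,\frac{2\nu_1\delta_1}{\nu_2})$, $\kappa_2\in(0,2\delta_2)$, $\kappa_1\in\big(0,2\delta_3(2\nu_1-\frac{\kappa_3\nu_2}{\delta_1})\big)$ and $r\in(0,r_0)$. Assume the following regularity: for some $\varepsilon\in(0,1)$ if $n=2$, $\varepsilon\in[\frac12,1)$ if $n=3$, and some $\widehat C(r)>0$, whenever $(w,\phi)\in W_r$ and $\vec t=(t,\sigma,u)\in\mathbb H$ satisfies $A_\phi(\vec t,\vec r)+B_w(\vec t,\vec r)=F_\phi(\vec r)$ for all $\vec r\in\mathbb H$, then $t\in H^\varepsilon(\Omega)^{n\times n}$ and $\|t\|_\varepsilon\le\widehat C(r)|\alpha||g|\|\phi\|_0$. Assume further $$rC_{\mathcal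 A}(1+rC_{\mathcal B})|\alpha||g|+C_{\mathcal B}\|\varphi_D\|_{1/2,\Gamma_D}\le r$$ and $L_{\rm Lip}<1$, where $$L_{\rm Lip}=rC_{\mathcal A}(1+L_{\mathcal B})L_{\mathcal A}|\alpha||g|+(1+L_{\mathcal B})L_{\mathcal A}|\alpha||g|\,(r\widetilde C_\varepsilon\widehat C(r)+1)+L_{\mathcal B}.$$ Then problem (P) has a unique solution $(\vec t,\varphi)=((t,\sigma,u),\varphi)\in\mathbb H\times H^1(\Omega)^2$ with $(u,\varphi)\in W_r$, and $$\|\vec t\|_{\mathbb H}\le C_{\mathcal A}\,r\,|\alpha|\,|g|,\qquad\|\varphi\|_1\le C_{\mathcal B}\big(r\|u\|_1+\|\varphi_D\|_{1/2,\Gamma_D}\big).$$ -/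

import Mathlib

open MeasureTheory Filter
open scoped ENNReal Topology ContDiff

namespace DoubleDiffusive

noncomputable section

/-- Vectors of `ℝᵐ` with the Euclidean norm. -/
abbrev E (m : ℕ) := EuclideanSpace ℝ (Fin m)

/-- Real `m × n` tensors; the inner product is `τ : ζ = ∑ τᵢⱼ ζᵢⱼ`, the norm is the Frobenius norm. -/
abbrev T (m n : ℕ) := EuclideanSpace ℝ (Fin m × Fin n)

/-! ### Pointwise tensor operations -/

/-- The trace of a square tensor. -/
def tr {n : ℕ} (τ : T n n) : ℝ := ∑ i, τ (i, i)

/-- The deviatoric part `τ - (tr τ / n) I`. -/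
def dev {n : ℕ} (τ : T n n) : T n n :=
  WithLp.toLp 2 fun p => τ p - if p.1 = p.2 then tr τ / n else 0

/-- The symmetric part; `symPart (∇v) = e(v)`. -/
def symPart {n : ℕ} (τ : T n n) : T n n :=
  WithLp.toLp 2 fun p => (τ (p.1, p.2) + τ (p.2, p.1)) / 2

/-- The skew-symmetric part; `skewPart (∇v) = ω(v)`. -/
def skewPart {n : ℕ} (τ : T n n) : T n n :=
  WithLp.toLp 2 fun p => (τ (p.1, p.2) - τ (p.2, p.1)) / 2

/-- The dyadic product `(v ⊗ w)ᵢⱼ = vᵢ wⱼ`. -/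
def dyad {m n : ℕ} (v : E m) (w : E n) : T m n :=
  WithLp.toLp 2 fun p => v p.1 * w p.2

/-- The matrix-vector product `(τ w)ᵢ = ∑ⱼ τᵢⱼ wⱼ`. -/
def tmul {m n : ℕ} (τ : T m n) (w : E n) : E m :=
  WithLp.toLp 2 fun i => ∑ j, τ (i, j) * w j

/-- The product of the diagonal matrix `diag(d)` with a tensor. -/
def diagMul {m n : ℕ} (d : Fin m → ℝ) (τ : T m n) : T m n :=
  WithLp.toLp 2 fun p => d p.1 * τ p

/-- The classical gradient `(∇η)ᵢⱼ = ∂ηᵢ/∂xⱼ`. -/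
def gradField {m n : ℕ} (η : E n → E m) (x : E n) : T m n :=
  WithLp.toLp 2 fun p => fderiv ℝ η x (EuclideanSpace.single p.2 1) p.1

/-! ### The domain -/

/-- A bounded domain (nonempty connected open set) of `ℝⁿ` with polygonal/polyhedral boundary: the
boundary is covered by finitely many affine hyperplanes, and the domain has no cracks
(it is the interior of its closure). -/
structure PolyhedralDomain (n : ℕ) where
  carrier : Set (E n)
  isOpen : IsOpen carrier
  isConnected : IsConnected carrier
  isBounded : Bornology.IsBounded carrier
  interior_closure : interior (closure carrier) = carrier
  polyhedral : ∃ S : Finset (E n × ℝ), (∀ h ∈ S, h.1 ≠ 0) ∧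
    frontier carrier ⊆ ⋃ h ∈ S, {x | inner ℝ h.1 x = h.2}

/-- The boundary `Γ`. -/
def PolyhedralDomain.boundary {n : ℕ} (Ω : PolyhedralDomain n) : Set (E n) := frontier Ω.carrier

/-- Lebesgue measure on `Ω`. -/
def PolyhedralDomain.vol {n : ℕ} (Ω : PolyhedralDomain n) : Measure (E n) :=
  volume.restrict Ω.carrier

instance {n : ℕ} (Ω : PolyhedralDomain n) : IsFiniteMeasure Ω.vol :=
  ⟨by simpa [PolyhedralDomain.vol] using Ω.isBounded.measure_lt_top⟩

/-- The `(n-1)`-dimensional surface measure on a part of the boundary (Hausdorff measure). -/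
def surf {n : ℕ} (S : Set (E n)) : Measure (E n) :=
  (Measure.hausdorffMeasure ((n : ℝ) - 1)).restrict S

variable {n : ℕ}

/-- `L²(Ω; V)`. -/
abbrev L2 (Ω : PolyhedralDomain n) (V : Type) [NormedAddCommGroup V] := Lp V 2 Ω.vol

/-! ### Test functions, weak gradient and weak divergence -/

/-- `η ∈ C_c^∞(Ω; V)`. -/
def IsTest (Ω : PolyhedralDomain n) {V : Type} [NormedAddCommGroup V] [NormedSpace ℝ V]
    (η : E n → V) : Prop :=
  ContDiff ℝ ∞ η ∧ HasCompactSupport η ∧ tsupport η ⊆ Ω.carrier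

/-- `∂η/∂xⱼ`. -/
def pd (η : E n → ℝ) (j : Fin n) (x : E n) : ℝ := fderiv ℝ η x (EuclideanSpace.single j 1)

/-- `G` is the weak gradient of `u`. -/
def IsWeakGrad (Ω : PolyhedralDomain n) {m : ℕ} (u : L2 Ω (E m)) (G : L2 Ω (T m n)) : Prop :=
  ∀ η : E n → ℝ, IsTest Ω η → ∀ i j,
    ∫ x, u x i * pd η j x ∂Ω.vol = -∫ x, G x (i, j) * η x ∂Ω.vol

/-- `d` is the weak row-wise divergence of `τ`. -/
def IsWeakDiv (Ω : PolyhedralDomain n) (τ : L2 Ω (T n n)) (d : L2 Ω (E n)) : Prop :=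
  ∀ η : E n → ℝ, IsTest Ω η → ∀ i,
    ∑ j, ∫ x, τ x (i, j) * pd η j x ∂Ω.vol = -∫ x, d x i * η x ∂Ω.vol

lemma IsTest.memLp {Ω : PolyhedralDomain n} {η : E n → ℝ} (h : IsTest Ω η) :
    MemLp η 2 Ω.vol :=
  (h.1.continuous.memLp_of_hasCompactSupport h.2.1 (μ := volume)).restrict _

lemma IsTest.memLp_pd {Ω : PolyhedralDomain n} {η : E n → ℝ} (h : IsTest Ω η) (j : Fin n) :
    MemLp (pd η j) 2 Ω.vol := by
  refine (Continuous.memLp_of_hasCompactSupport (μ := volume) ?_ ?_).restrict _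
  · exact (h.1.continuous_fderiv (by simp)).clm_apply continuous_const
  · exact h.2.1.fderiv_apply (𝕜 := ℝ) _

lemma memLp_coord {ι : Type} [Fintype ι] {Ω : PolyhedralDomain n}
    (u : L2 Ω (EuclideanSpace ℝ ι)) (i : ι) : MemLp (fun x => u x i) 2 Ω.vol :=
  (EuclideanSpace.proj i : EuclideanSpace ℝ ι →L[ℝ] ℝ).comp_memLp' (Lp.memLp u)

lemma integrable_coord_mul {ι : Type} [Fintype ι] {Ω : PolyhedralDomain n}
    (u : L2 Ω (EuclideanSpace ℝ ι)) (i : ι) {η : E n → ℝ} (h : MemLp η 2 Ω.vol) :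
    Integrable (fun x => u x i * η x) Ω.vol :=
  (memLp_coord u i).integrable_mul h

lemma integral_add_coord {ι : Type} [Fintype ι] {Ω : PolyhedralDomain n}
    (u v : L2 Ω (EuclideanSpace ℝ ι)) (i : ι) {η : E n → ℝ} (h : MemLp η 2 Ω.vol) :
    ∫ x, (u + v) x i * η x ∂Ω.vol = ∫ x, u x i * η x ∂Ω.vol + ∫ x, v x i * η x ∂Ω.vol := by
  rw [← integral_add (integrable_coord_mul u i h) (integrable_coord_mul v i h)]
  refine integral_congr_ae ?_
  filter_upwards [Lp.coeFn_add u v] with x hx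
  rw [hx]
  simp [add_mul]

lemma integral_smul_coord {ι : Type} [Fintype ι] {Ω : PolyhedralDomain n}
    (c : ℝ) (u : L2 Ω (EuclideanSpace ℝ ι)) (i : ι) (η : E n → ℝ) :
    ∫ x, (c • u) x i * η x ∂Ω.vol = c * ∫ x, u x i * η x ∂Ω.vol := by
  rw [← integral_const_mul]
  refine integral_congr_ae ?_
  filter_upwards [Lp.coeFn_smul c u] with x hx
  rw [hx]
  simp [mul_assoc]

lemma integral_zero_coord {ι : Type} [Fintype ι] {Ω : PolyhedralDomain n} (i : ι) (η : E n → ℝ) :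
    ∫ x, (0 : L2 Ω (EuclideanSpace ℝ ι)) x i * η x ∂Ω.vol = 0 := by
  rw [← integral_zero (E n) ℝ (μ := Ω.vol)]
  refine integral_congr_ae ?_
  filter_upwards [Lp.coeFn_zero (EuclideanSpace ℝ ι) 2 Ω.vol] with x hx
  rw [hx]
  simp

/-! ### Function spaces -/

/-- Pairs (function, gradient); the norm is `(‖u‖₀² + ‖∇u‖₀²)^{1/2}`. -/
abbrev SobPair (Ω : PolyhedralDomain n) (m : ℕ) := WithLp 2 (L2 Ω (E m) × L2 Ω (T m n))

/-- `H¹(Ω; ℝᵐ)`: an element is the pair of a function and its (unique) weak gradient. -/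
def H1 (Ω : PolyhedralDomain n) (m : ℕ) : Submodule ℝ (SobPair Ω m) where
  carrier := {p | IsWeakGrad Ω p.fst p.snd}
  add_mem' {p q} hp hq η hη i j := by
    simp only [WithLp.add_fst, WithLp.add_snd]
    rw [integral_add_coord _ _ _ (hη.memLp_pd j), integral_add_coord _ _ _ hη.memLp,
      hp η hη i j, hq η hη i j]
    ring
  zero_mem' η _ i j := by
    simp only [WithLp.zero_fst, WithLp.zero_snd]
    rw [integral_zero_coord, integral_zero_coord, neg_zero]
  smul_mem' c p hp η hη i j := by
    simp only [WithLp.smul_fst, WithLp.smul_snd]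
    rw [integral_smul_coord, integral_smul_coord, hp η hη i j]
    ring

/-- `C_c^∞(Ω; ℝᵐ)` inside the space of pairs. -/
def testPairs (Ω : PolyhedralDomain n) (m : ℕ) : Submodule ℝ (SobPair Ω m) where
  carrier := {p | ∃ η : E n → E m, IsTest Ω η ∧ p.fst =ᵐ[Ω.vol] η ∧ p.snd =ᵐ[Ω.vol] gradField η}
  add_mem' := by
    rintro p q ⟨η, hη, hp, hp'⟩ ⟨ζ, hζ, hq, hq'⟩
    refine ⟨η + ζ, ⟨hη.1.add hζ.1, hη.2.1.add hζ.2.1, ?_⟩, ?_, ?_⟩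
    · exact (tsupport_add η ζ).trans (Set.union_subset hη.2.2 hζ.2.2)
    · filter_upwards [Lp.coeFn_add p.fst q.fst, hp, hq] with x h h1 h2
      rw [WithLp.add_fst, h, Pi.add_apply, h1, h2, Pi.add_apply]
    · filter_upwards [Lp.coeFn_add p.snd q.snd, hp', hq'] with x h h1 h2
      rw [WithLp.add_snd, h, Pi.add_apply, h1, h2]
      ext a
      simp [gradField, fderiv_add (hη.1.differentiable (by simp) x)
        (hζ.1.differentiable (by simp) x)]
  zero_mem' := by
    refine ⟨0, ⟨contDiff_const, HasCompactSupport.zero, by simp⟩, ?_, ?_⟩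
    · exact Lp.coeFn_zero _ _ _
    · filter_upwards [Lp.coeFn_zero (T m n) 2 Ω.vol] with x h
      rw [WithLp.zero_snd, h]
      ext a
      simp [gradField]
  smul_mem' := by
    rintro c p ⟨η, hη, hp, hp'⟩
    refine ⟨c • η, ⟨hη.1.const_smul c, hη.2.1.smul_left, ?_⟩, ?_, ?_⟩
    · exact (tsupport_smul_subset_right (fun _ => c) η).trans hη.2.2
    · filter_upwards [Lp.coeFn_smul c p.fst, hp] with x h h1
      rw [WithLp.smul_fst, h, Pi.smul_apply, h1, Pi.smul_apply]
    · filter_upwards [Lp.coeFn_smul c p.snd, hp'] with x h h1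
      rw [WithLp.smul_snd, h, Pi.smul_apply, h1]
      ext a
      simp [gradField, fderiv_const_smul (hη.1.differentiable (by simp) x)]

/-- `H¹₀(Ω; ℝᵐ)`: the closure of `C_c^∞(Ω; ℝᵐ)` in the `H¹`-norm. -/
def H10 (Ω : PolyhedralDomain n) (m : ℕ) : Submodule ℝ (SobPair Ω m) :=
  (testPairs Ω m).topologicalClosure

/-- `H₀(div; Ω)`: an element is the pair of a tensor field with `∫ tr τ = 0` and its weak
divergence; the norm is `(‖τ‖₀² + ‖div τ‖₀²)^{1/2}`. -/
def Hdiv0 (Ω : PolyhedralDomain n) : Submodule ℝ (WithLp 2 (L2 Ω (T n n) × L2 Ω (E n))) where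
  carrier := {p | IsWeakDiv Ω p.fst p.snd ∧ ∑ i, ∫ x, p.fst x (i, i) * 1 ∂Ω.vol = 0}
  add_mem' {p q} hp hq := by
    refine ⟨fun η hη i => ?_, ?_⟩
    · simp only [WithLp.add_fst, WithLp.add_snd]
      simp_rw [fun j => integral_add_coord p.fst q.fst (i, j) (hη.memLp_pd j)]
      rw [integral_add_coord _ _ _ hη.memLp, Finset.sum_add_distrib, hp.1 η hη i, hq.1 η hη i]
      ring
    · simp only [WithLp.add_fst]
      simp_rw [fun i => integral_add_coord p.fst q.fst (i, i) (memLp_const (1 : ℝ))]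
      rw [Finset.sum_add_distrib, hp.2, hq.2, add_zero]
  zero_mem' := by
    refine ⟨fun η _ i => ?_, ?_⟩
    · simp only [WithLp.zero_fst, WithLp.zero_snd]
      simp_rw [integral_zero_coord]
      simp
    · simp only [WithLp.zero_fst]
      simp_rw [fun i => integral_zero_coord (Ω := Ω) (i, i) (fun _ => (1 : ℝ))]
      simp
  smul_mem' c p hp := by
    refine ⟨fun η hη i => ?_, ?_⟩
    · simp only [WithLp.smul_fst, WithLp.smul_snd]
      simp_rw [integral_smul_coord]
      rw [← Finset.mul_sum, hp.1 η hη i]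
      ring
    · simp only [WithLp.smul_fst]
      simp_rw [fun i => integral_smul_coord c p.fst (i, i) (fun _ => (1 : ℝ))]
      rw [← Finset.mul_sum, hp.2, mul_zero]

/-- `L²_tr(Ω)`: symmetric trace-free square-integrable tensor fields. -/
def Ltr (Ω : PolyhedralDomain n) : Submodule ℝ (L2 Ω (T n n)) where
  carrier := {r | ∀ᵐ x ∂Ω.vol, (∀ i j, r x (i, j) = r x (j, i)) ∧ tr (r x) = 0}
  add_mem' {r s} hr hs := by
    filter_upwards [hr, hs, Lp.coeFn_add r s] with x h1 h2 h
    rw [h]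
    refine ⟨fun i j => by simp [h1.1 i j, h2.1 i j], ?_⟩
    have a := h1.2
    have b := h2.2
    simp only [tr] at a b
    simp [tr, Finset.sum_add_distrib, a, b]
  zero_mem' := by
    filter_upwards [Lp.coeFn_zero (T n n) 2 Ω.vol] with x h
    rw [h]
    simp [tr]
  smul_mem' c r hr := by
    filter_upwards [hr, Lp.coeFn_smul c r] with x h1 h
    rw [h]
    refine ⟨fun i j => by simp [h1.1 i j], ?_⟩
    have a := h1.2
    simp only [tr] at a
    simp [tr, ← Finset.mul_sum, a]

/-- `ℍ = L²_tr(Ω) × H₀(div; Ω) × H¹₀(Ω)` with its natural Hilbert norm. -/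
abbrev HH (Ω : PolyhedralDomain n) := WithLp 2 (Ltr Ω × WithLp 2 (Hdiv0 Ω × H10 Ω n))

/-- The component `t` of `(t, σ, u) ∈ ℍ`. -/
def HH.t {Ω : PolyhedralDomain n} (x : HH Ω) : L2 Ω (T n n) := x.fst.1
/-- The component `σ` of `(t, σ, u) ∈ ℍ`. -/
def HH.σ {Ω : PolyhedralDomain n} (x : HH Ω) : L2 Ω (T n n) := x.snd.fst.1.fst
/-- `div σ` for `(t, σ, u) ∈ ℍ`. -/
def HH.divσ {Ω : PolyhedralDomain n} (x : HH Ω) : L2 Ω (E n) := x.snd.fst.1.snd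
/-- The component `u` of `(t, σ, u) ∈ ℍ`, as an element of `H¹₀(Ω)`. -/
def HH.vel {Ω : PolyhedralDomain n} (x : HH Ω) : H10 Ω n := x.snd.snd
/-- The component `u` of `(t, σ, u) ∈ ℍ`, as a vector field. -/
def HH.u {Ω : PolyhedralDomain n} (x : HH Ω) : L2 Ω (E n) := x.snd.snd.1.fst
/-- `∇u` for `(t, σ, u) ∈ ℍ`. -/
def HH.gradu {Ω : PolyhedralDomain n} (x : HH Ω) : L2 Ω (T n n) := x.snd.snd.1.snd

/-! ### Traces -/

/-- `φ|_Γ_D = g` in the sense of traces: `g` is the `L²(Γ_D)`-limit of the restrictions to `Γ_D` of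
functions smooth up to the boundary that converge to `φ` in `H¹(Ω)`. -/
def HasTrace {Ω : PolyhedralDomain n} {ΓD : Set (E n)} {m : ℕ} (φ : H1 Ω m)
    (g : Lp (E m) 2 (surf ΓD)) : Prop :=
  ∃ η : ℕ → E n → E m, (∀ k, ContDiff ℝ ∞ (η k)) ∧
    Tendsto (fun k => eLpNorm (fun x => η k x - φ.1.fst x) 2 Ω.vol) atTop (𝓝 0) ∧
    Tendsto (fun k => eLpNorm (fun x => gradField (η k) x - φ.1.snd x) 2 Ω.vol) atTop (𝓝 0) ∧
    Tendsto (fun k => eLpNorm (fun x => η k x - g x) 2 (surf ΓD)) atTop (𝓝 0)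

/-- `H¹_{Γ_D}(Ω)` (two components): the functions of `H¹(Ω)` with vanishing trace on `Γ_D`. -/
def H1D (Ω : PolyhedralDomain n) (ΓD : Set (E n)) : Set (H1 Ω 2) :=
  {ψ | HasTrace ψ (0 : Lp (E 2) 2 (surf ΓD))}

/-- `H^{1/2}(Γ_D)`: the traces on `Γ_D` of the functions of `H¹(Ω)`. -/
def HHalf (Ω : PolyhedralDomain n) (ΓD : Set (E n)) : Set (Lp (E 2) 2 (surf ΓD)) :=
  {g | ∃ φ : H1 Ω 2, HasTrace φ g}

/-- `‖g‖_{1/2,Γ_D}`: the least `H¹`-norm of an extension of `g` to `Ω`. -/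
def halfNorm (Ω : PolyhedralDomain n) {ΓD : Set (E n)} (g : Lp (E 2) 2 (surf ΓD)) : ℝ :=
  sInf {a | ∃ φ : H1 Ω 2, HasTrace φ g ∧ a = ‖φ‖}

/-! ### The variational problem -/

/-- The form `A_φ`. -/
def formA (Ω : PolyhedralDomain n) (ν : E 2 → ℝ) (γ κ₁ κ₂ κ₃ : ℝ) (φ : H1 Ω 2) (x y : HH Ω) : ℝ :=
  2 * ∫ ξ, ν (φ.1.fst ξ) * inner ℝ (x.t ξ) (y.t ξ - κ₃ • dev (y.σ ξ)) ∂Ω.vol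
  + ∫ ξ, inner ℝ (x.t ξ) (dev (y.σ ξ) - κ₁ • symPart (y.gradu ξ)) ∂Ω.vol
  - ∫ ξ, inner ℝ (dev (x.σ ξ)) (y.t ξ - κ₃ • dev (y.σ ξ)) ∂Ω.vol
  + (1 - κ₂ * γ) * ∫ ξ, inner ℝ (x.u ξ) (y.divσ ξ) ∂Ω.vol
  - ∫ ξ, inner ℝ (y.u ξ) (x.divσ ξ) ∂Ω.vol
  + ∫ ξ, inner ℝ (skewPart (x.gradu ξ)) (y.σ ξ) ∂Ω.vol
  - ∫ ξ, inner ℝ (x.σ ξ) (skewPart (y.gradu ξ)) ∂Ω.vol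
  + γ * ∫ ξ, inner ℝ (x.u ξ) (y.u ξ) ∂Ω.vol
  + κ₂ * ∫ ξ, inner ℝ (x.divσ ξ) (y.divσ ξ) ∂Ω.vol
  + κ₁ * ∫ ξ, inner ℝ (symPart (x.gradu ξ)) (symPart (y.gradu ξ)) ∂Ω.vol

/-- The form `B_w`. -/
def formB (Ω : PolyhedralDomain n) (κ₃ : ℝ) (w : H10 Ω n) (x y : HH Ω) : ℝ :=
  ∫ ξ, inner ℝ (dev (dyad (x.u ξ) (w.1.fst ξ))) (κ₃ • dev (y.σ ξ) - y.t ξ) ∂Ω.vol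

/-- The functional `F_φ`. -/
def formF (Ω : PolyhedralDomain n) (κ₂ : ℝ) (α : E 2) (g : E n) (φ : H1 Ω 2) (y : HH Ω) : ℝ :=
  ∫ ξ, inner ℝ α (φ.1.fst ξ) * inner ℝ g (y.u ξ - κ₂ • y.divσ ξ) ∂Ω.vol

/-- The form `C`, for the diffusion tensor `K = diag(k₁, k₂)`. -/
def formC (Ω : PolyhedralDomain n) (k : Fin 2 → E n → ℝ) (χ ψ : H1 Ω 2) : ℝ :=
  ∫ ξ, inner ℝ (diagMul (fun i => k i ξ) (χ.1.snd ξ)) (ψ.1.snd ξ) ∂Ω.vol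

/-- The functional `G_{w,φ}`. -/
def formG (Ω : PolyhedralDomain n) (w : H10 Ω n) (φ ψ : H1 Ω 2) : ℝ :=
  -∫ ξ, inner ℝ (tmul (φ.1.snd ξ) (w.1.fst ξ)) (ψ.1.fst ξ) ∂Ω.vol

/-- `x` solves the decoupled flow problem with given `(w, φ)`, that is `x = 𝒜(w, φ)`. -/
def SolvesFlow (Ω : PolyhedralDomain n) (ν : E 2 → ℝ) (γ κ₁ κ₂ κ₃ : ℝ) (α : E 2) (g : E n)
    (w : H10 Ω n) (φ : H1 Ω 2) (x : HH Ω) : Prop :=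
  ∀ y : HH Ω, formA Ω ν γ κ₁ κ₂ κ₃ φ x y + formB Ω κ₃ w x y = formF Ω κ₂ α g φ y

/-- `(x, φ)`, with `x = (t, σ, u)`, solves the semi-augmented mixed-primal problem. -/
def IsSolution (Ω : PolyhedralDomain n) {ΓD : Set (E n)} (ν : E 2 → ℝ) (γ κ₁ κ₂ κ₃ : ℝ)
    (α : E 2) (g : E n) (k : Fin 2 → E n → ℝ) (φD : Lp (E 2) 2 (surf ΓD))
    (x : HH Ω) (φ : H1 Ω 2) : Prop :=
  HasTrace φ φD ∧ SolvesFlow Ω ν γ κ₁ κ₂ κ₃ α g x.vel φ x ∧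
    ∀ ψ ∈ H1D Ω ΓD, formC Ω k φ ψ = formG Ω x.vel φ ψ

/-- The norm `‖t‖_{ε,Ω}` of `H^ε(Ω)`, `0 < ε < 1` (Sobolev–Slobodeckij); it is `∞` off `H^ε(Ω)`. -/
def fracNorm {Ω : PolyhedralDomain n} (ε : ℝ) (t : L2 Ω (T n n)) : ℝ≥0∞ :=
  (‖t‖ₑ ^ 2 + ∫⁻ x, ∫⁻ y, ‖t x - t y‖ₑ ^ 2 / ENNReal.ofReal (‖x - y‖ ^ (n + 2 * ε))
    ∂Ω.vol ∂Ω.vol) ^ (1 / 2 : ℝ)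

/-! ### Constants

The constants of the functional inequalities are the best ones, as elements of `[0, ∞]`. -/

/-- The norm of the injection `H¹(Ω; ℝᵐ) → L^q(Ω; ℝᵐ)`. -/
def sobolevConst (Ω : PolyhedralDomain n) (m : ℕ) (q : ℝ≥0∞) : ℝ≥0∞ :=
  sInf {c | ∀ u : H1 Ω m, eLpNorm u.1.fst q Ω.vol ≤ c * ‖u‖ₑ}

/-- `c₁(Ω) = ‖i‖²`, with `i` the injection of `H¹(Ω)` into `L⁴(Ω)`. -/
def c1 (Ω : PolyhedralDomain n) : ℝ≥0∞ := sobolevConst Ω n 4 ^ 2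

/-- `c₂(Ω)`: the best constant in `c₂ ‖τ‖₀² ≤ ‖τᵈ‖₀² + ‖div τ‖₀²` on `H₀(div; Ω)`. -/
def c2 (Ω : PolyhedralDomain n) : ℝ :=
  sSup {c | ∀ τ : Hdiv0 Ω,
    c * ‖τ.1.fst‖ ^ 2 ≤ ∫ ξ, ‖dev (τ.1.fst ξ)‖ ^ 2 ∂Ω.vol + ‖τ.1.snd‖ ^ 2}

/-- `c_gp`: the best constant in `‖ψ‖₁ ≤ c_gp |ψ|₁` on `H¹_{Γ_D}(Ω)`. -/
def cgp (Ω : PolyhedralDomain n) (ΓD : Set (E n)) : ℝ≥0∞ :=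
  sInf {c | ∀ ψ ∈ H1D Ω ΓD, ‖ψ‖ₑ ≤ c * ‖ψ.1.snd‖ₑ}

/-- `C_ε`: the norm of the injection of `H^ε(Ω)` into `L^{2n/(n-2ε)}(Ω)`, for tensor fields. -/
def Ceps (Ω : PolyhedralDomain n) (ε : ℝ) : ℝ≥0∞ :=
  sInf {c | ∀ t : L2 Ω (T n n), fracNorm ε t < ⊤ →
    eLpNorm t (ENNReal.ofReal (2 * n / (n - 2 * ε))) Ω.vol ≤ c * fracNorm ε t}

/-- The norm of the injection of `H¹(Ω)` into `L^{n/ε}(Ω)`. -/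
def Ceps' (Ω : PolyhedralDomain n) (ε : ℝ) : ℝ≥0∞ := sobolevConst Ω 2 (ENNReal.ofReal (n / ε))

/-- The ellipticity constant `α(Ω)` of the forms `A_φ`. -/
def ellA (Ω : PolyhedralDomain n) (ν₁ ν₂ γ κ₁ κ₂ κ₃ δ₁ δ₂ δ₃ : ℝ) : ℝ :=
  min (2 * ν₁ - κ₃ * ν₂ / δ₁ - κ₁ / (2 * δ₃))
    (min (c2 Ω * min (κ₃ * (1 - ν₂ * δ₁)) (κ₂ / 2 * (1 - γ * δ₂ / 2)))
      (min (κ₂ / 2 * (1 - γ * δ₂ / 2))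
        (min (γ * (1 - κ₂ / (2 * δ₂))) (κ₁ / 2 * (1 - δ₃)))))

/-- The radius `r₀ = α(Ω) / (2 c₁(Ω) (2 + κ₃²)^{1/2})`; here `a = α(Ω)`. -/
def r0 (Ω : PolyhedralDomain n) (a κ₃ : ℝ) : ℝ≥0∞ :=
  ENNReal.ofReal a / (2 * c1 Ω * ENNReal.ofReal (√(2 + κ₃ ^ 2)))

/-- `C_𝒜 = 2 √2 (2 + κ₂²)^{1/2} / α(Ω)`; here `a = α(Ω)`. -/
def CA (a κ₂ : ℝ) : ℝ := 2 * √2 * √(2 + κ₂ ^ 2) / a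

/-- `‖K‖_{∞,Ω}` for `K = diag(k₁, k₂)`. -/
def normK (Ω : PolyhedralDomain n) (k : Fin 2 → E n → ℝ) : ℝ≥0∞ := ⨆ i, eLpNorm (k i) ⊤ Ω.vol

/-- The ellipticity constant of `C` on `H¹_{Γ_D}(Ω)`. -/
def ellC (Ω : PolyhedralDomain n) (ΓD : Set (E n)) (k₀ : ℝ) : ℝ≥0∞ :=
  ENNReal.ofReal k₀ / cgp Ω ΓD ^ 2

/-- `C_ℬ`. -/
def CB (Ω : PolyhedralDomain n) (ΓD : Set (E n)) (k : Fin 2 → E n → ℝ) (k₀ : ℝ) : ℝ≥0∞ :=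
  max ((ellC Ω ΓD k₀)⁻¹ * c1 Ω) ((ellC Ω ΓD k₀)⁻¹ * normK Ω k + 1)

/-- `L_𝒜`; here `a = α(Ω)`. -/
def LA (Ω : PolyhedralDomain n) (a Lν κ₂ κ₃ ε : ℝ) : ℝ≥0∞ :=
  ENNReal.ofReal (2 / a) *
    max (c1 Ω * ENNReal.ofReal √(2 + κ₃ ^ 2))
      (max (ENNReal.ofReal (2 * Lν * √(2 + κ₃ ^ 2)) * Ceps Ω ε)
        (ENNReal.ofReal (√2 * √(2 + κ₂ ^ 2))))

/-- `L_ℬ`. -/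
def LB (Ω : PolyhedralDomain n) (ΓD : Set (E n)) (k₀ r : ℝ) : ℝ≥0∞ :=
  ENNReal.ofReal r * c1 Ω / ellC Ω ΓD k₀

/-- `L_Lip`; here `a = α(Ω)`, `d = |α| |g|`, and `Chat` is the constant of the `ε`-regularity
estimate. -/
def LLip (Ω : PolyhedralDomain n) (ΓD : Set (E n)) (a Lν κ₂ κ₃ ε k₀ r Chat d : ℝ) : ℝ≥0∞ :=
  ENNReal.ofReal (r * CA a κ₂) * (1 + LB Ω ΓD k₀ r) * LA Ω a Lν κ₂ κ₃ ε * ENNReal.ofReal d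
  + (1 + LB Ω ΓD k₀ r) * LA Ω a Lν κ₂ κ₃ ε * ENNReal.ofReal d *
      (ENNReal.ofReal r * Ceps' Ω ε * ENNReal.ofReal Chat + 1)
  + LB Ω ΓD k₀ r

end

end DoubleDiffusive

open DoubleDiffusive

namespace DoubleDiffusive

noncomputable section

/-! ### Abstract tools -/

/-! The system is decoupled and solved by Banach's fixed point theorem on `W_r`, with the sum of the
two norms as metric. With φ frozen in the viscosity and the source, and w frozen in the convection,
the flow problem is linear in (t, σ, u). With the new velocity u and the old φ in the convective
term, the transport problem C(χ, ·) = G_{u,φ} is linear in χ. The fixed points of (w, φ) ↦ (u, χ)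
are the solutions of (P).

Flow: Young's inequality with weights δᵢ, Korn's inequality and the definition of c₂ make A_φ
elliptic with constant α(Ω) (`flowA_coercive`). For ‖w‖ ≤ r < r₀ the form B_w consumes at most half
of it (`flowAB_coercive`), so Lax–Milgram applies. For two data the difference of the solutions is
tested with itself (`norm_sub_le_of_solvesFlow`). The delicate term is (ν(φ) - ν(φ'))t': the
ε-regularity places t' in L^{2n/(n-2ε)}, and φ - φ' is measured in L^{n/ε}, so Hölder's inequality
closes the estimate (`ofReal_norm_sub_le_of_solvesFlow`).

Transport: C is elliptic on H¹_{Γ_D}, and subtracting an extension of φ_D reduces to that space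
(`exists_transport`, `norm_le_of_transport`). The smallness assumption then makes W_r invariant, and
L_Lip < 1 makes the map a contraction (`contraction_arith`).

No Sobolev or Poincaré inequality has to be established: the best constants are defined for every Ω,
and the hypotheses r < r₀ and L_Lip < 1 can hold only if α(Ω) > 0, c₂ ≠ 0, c₁ < ∞ and c_gp < ∞. The
constants C_ε and C̃_ε may still be infinite when |α||g| = 0, so the Lipschitz estimates are carried
out in [0, ∞] with 0 · ∞ = 0. -/

/-- Lax–Milgram, for functionals. -/
lemma exists_of_coercive {V : Type*} [NormedAddCommGroup V] [InnerProductSpace ℝ V]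
    [CompleteSpace V] (B : V →L[ℝ] V →L[ℝ] ℝ) (F : V →L[ℝ] ℝ) {c : ℝ} (hc : 0 < c)
    (hB : ∀ v, c * ‖v‖ ^ 2 ≤ B v v) : ∃ v, ∀ w, B v w = F w := by
  have hco : IsCoercive B := ⟨c, hc, fun v => by simpa [sq, mul_assoc] using hB v⟩
  refine ⟨hco.continuousLinearEquivOfBilin.symm ((InnerProductSpace.toDual ℝ V).symm F),
    fun w => ?_⟩
  rw [← hco.continuousLinearEquivOfBilin_apply]
  simp

/-- Lax–Milgram on a closed subspace. -/
lemma exists_mem_of_coercive {V : Type*} [NormedAddCommGroup V] [InnerProductSpace ℝ V]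
    [CompleteSpace V] (B : V →L[ℝ] V →L[ℝ] ℝ) (F : V →L[ℝ] ℝ) (S : Submodule ℝ V)
    (hS : IsClosed (S : Set V)) {c : ℝ} (hc : 0 < c) (hB : ∀ v ∈ S, c * ‖v‖ ^ 2 ≤ B v v) :
    ∃ v ∈ S, ∀ w ∈ S, B v w = F w := by
  have : CompleteSpace S := hS.completeSpace_coe
  obtain ⟨v, hv⟩ := exists_of_coercive (B.bilinearComp S.subtypeL S.subtypeL) (F ∘L S.subtypeL) hc
    fun v => hB v.1 v.2
  exact ⟨v.1, v.2, fun w hw => hv ⟨w, hw⟩⟩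

/-- If `q` depends on `p` through a contractive relation, then the relation has a fixed point. -/
lemma exists_fixed_of_relation {X : Type*} [MetricSpace X] [CompleteSpace X] {S : Set X}
    (hS : IsClosed S) (hne : S.Nonempty) (R : X → X → Prop) {K : ℝ} (hK0 : 0 ≤ K) (hK : K < 1)
    (hex : ∀ p ∈ S, ∃ q ∈ S, R p q)
    (hlip : ∀ p ∈ S, ∀ p' ∈ S, ∀ q q', R p q → R p' q' → dist q q' ≤ K * dist p p') :
    ∃ p ∈ S, R p p := by
  -- `hlip` with p = p' makes the relation single-valued on S, so the choice is harmless.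
  choose f hfS hfR using hex
  have : CompleteSpace S := hS.completeSpace_coe
  let T : S → S := fun p => ⟨f p.1 p.2, hfS p.1 p.2⟩
  have hT : ContractingWith ⟨K, hK0⟩ T :=
    ⟨by exact_mod_cast hK, LipschitzWith.of_dist_le_mul fun p q =>
      hlip p.1 p.2 q.1 q.2 _ _ (hfR _ _) (hfR _ _)⟩
  obtain ⟨x, hx⟩ := hne
  obtain ⟨y, hy, -⟩ := hT.exists_fixedPoint ⟨x, hx⟩ (edist_ne_top _ _)
  refine ⟨y.1, y.2, ?_⟩
  have := hfR y.1 y.2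
  rwa [show f y.1 y.2 = y.1 from congrArg Subtype.val hy] at this

/-! ### Pointwise operations as continuous linear maps -/

variable {n m : ℕ}

/-- `dev` as a continuous linear map. -/
def devL (n : ℕ) : T n n →L[ℝ] T n n :=
  LinearMap.toContinuousLinearMap
    { toFun := dev
      map_add' := fun x y => by
        ext p
        simp only [dev, tr, PiLp.add_apply, Finset.sum_add_distrib]
        split_ifs <;> ring
      map_smul' := fun c x => by
        ext p
        simp only [dev, tr, PiLp.smul_apply, smul_eq_mul, ← Finset.mul_sum, RingHom.id_apply]
        split_ifs <;> ring }

/-- `symPart` as a continuous linear map. -/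
def symL (n : ℕ) : T n n →L[ℝ] T n n :=
  LinearMap.toContinuousLinearMap
    { toFun := symPart
      map_add' := fun x y => by
        ext p
        simp only [symPart, PiLp.add_apply]
        ring
      map_smul' := fun c x => by
        ext p
        simp only [symPart, PiLp.smul_apply, smul_eq_mul, RingHom.id_apply]
        ring }

/-- `skewPart` as a continuous linear map. -/
def skewL (n : ℕ) : T n n →L[ℝ] T n n :=
  LinearMap.toContinuousLinearMap
    { toFun := skewPart
      map_add' := fun x y => by
        ext p
        simp only [skewPart, PiLp.add_apply]
        ring
      map_smul' := fun c x => by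
        ext p
        simp only [skewPart, PiLp.smul_apply, smul_eq_mul, RingHom.id_apply]
        ring }

@[simp] lemma symL_apply (τ : T n n) : symL n τ = symPart τ := rfl

lemma norm_dyad (v : E m) (w : E n) : ‖dyad v w‖ = ‖v‖ * ‖w‖ := by
  rw [← sq_eq_sq₀ (by positivity) (by positivity), mul_pow, EuclideanSpace.real_norm_sq_eq,
    EuclideanSpace.real_norm_sq_eq, EuclideanSpace.real_norm_sq_eq, Finset.sum_mul_sum,
    Fintype.sum_prod_type]
  simp [dyad, mul_pow]

/-- `dyad` as a continuous bilinear map. -/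
def dyadL (m n : ℕ) : E m →L[ℝ] E n →L[ℝ] T m n :=
  LinearMap.mkContinuous₂
    (LinearMap.mk₂ ℝ dyad
      (fun a b c => by ext p; simp [dyad, add_mul])
      (fun a b c => by ext p; simp [dyad, mul_assoc])
      (fun a b c => by ext p; simp [dyad, mul_add])
      (fun a b c => by ext p; simp [dyad, mul_left_comm])) 1
    (fun v w => by simp [norm_dyad])

lemma norm_dyadL_le : ‖dyadL m n‖ ≤ 1 := LinearMap.mkContinuous₂_norm_le _ zero_le_one _

/-- Moves w onto the test function, so that the convective terms of the flow and of the transport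
are both governed by the product v ⊗ w. -/
lemma inner_tmul (τ : T m n) (w : E n) (v : E m) :
    inner ℝ (tmul τ w) v = inner ℝ τ (dyad v w) := by
  simp only [PiLp.inner_apply, Fintype.sum_prod_type, tmul, dyad, RCLike.inner_apply, conj_trivial,
    Finset.mul_sum]
  exact Finset.sum_congr rfl fun i _ => Finset.sum_congr rfl fun j _ => by ring

/-- The deviator is the orthogonal projection off ℝI; the removed part (tr τ / n) I has squared norm
(tr τ)²/n because |I|² = n. -/
lemma inner_dev_self (hn : n ≠ 0) (τ : T n n) :
    ‖dev τ‖ ^ 2 = ‖τ‖ ^ 2 - tr τ ^ 2 / n := by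
  have hn' : (n : ℝ) ≠ 0 := by exact_mod_cast hn
  rw [EuclideanSpace.real_norm_sq_eq, EuclideanSpace.real_norm_sq_eq, Fintype.sum_prod_type,
    Fintype.sum_prod_type]
  have h : ∀ i : Fin n, ∑ j, dev τ (i, j) ^ 2
      = ∑ j, τ (i, j) ^ 2 - (2 * (tr τ / n) * τ (i, i) - (tr τ / n) ^ 2) := by
    intro i
    have : ∀ j, dev τ (i, j) ^ 2 = τ (i, j) ^ 2
        - if i = j then (2 * (tr τ / n) * τ (i, j) - (tr τ / n) ^ 2) else 0 := by
      intro j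
      simp only [dev]
      split_ifs <;> ring
    simp [this]
  simp only [h, Finset.sum_sub_distrib, ← Finset.mul_sum]
  rw [show ∑ i, τ (i, i) = tr τ from rfl]
  simp
  field_simp
  ring

lemma norm_dev_le (τ : T n n) : ‖dev τ‖ ≤ ‖τ‖ := by
  rcases eq_or_ne n 0 with rfl | hn
  · exact (by rw [Subsingleton.elim (dev τ) τ])
  · refine (sq_le_sq₀ (norm_nonneg _) (norm_nonneg _)).1 ?_
    rw [inner_dev_self hn]
    have : 0 ≤ tr τ ^ 2 / n := by positivity
    linarith

/-- Twice the squared norm of the symmetric part. -/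
lemma two_mul_norm_symPart_sq (τ : T n n) :
    2 * ‖symPart τ‖ ^ 2 = ‖τ‖ ^ 2 + ∑ i, ∑ j, τ (i, j) * τ (j, i) := by
  simp only [EuclideanSpace.real_norm_sq_eq, Fintype.sum_prod_type, symPart]
  have h : ∑ i : Fin n, ∑ j : Fin n, τ (j, i) ^ 2 = ∑ i : Fin n, ∑ j : Fin n, τ (i, j) ^ 2 :=
    Finset.sum_comm
  have h2 : ∀ i j : Fin n, ((τ (i, j) + τ (j, i)) / 2) ^ 2
      = 1 / 4 * τ (i, j) ^ 2 + 1 / 4 * τ (j, i) ^ 2 + 1 / 2 * (τ (i, j) * τ (j, i)) := by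
    intro i j; ring
  simp only [h2, Finset.sum_add_distrib, ← Finset.mul_sum, h]
  ring

/-- The rank-one map `z ↦ (α · z) g`. -/
def buoyL (α : E m) (g : E n) : E m →L[ℝ] E n := (innerSL ℝ α).smulRight g

@[simp] lemma buoyL_apply (α z : E m) (g : E n) : buoyL α g z = (inner ℝ α z : ℝ) • g := rfl

lemma norm_buoyL_apply_le (α z : E m) (g : E n) : ‖buoyL α g z‖ ≤ ‖α‖ * ‖g‖ * ‖z‖ := by
  rw [buoyL_apply, norm_smul]
  have := norm_inner_le_norm (𝕜 := ℝ) α z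
  nlinarith [norm_nonneg g]

/-- The restriction of a tensor to its `i`-th row. -/
def rowL (m n : ℕ) (i : Fin m) : T m n →L[ℝ] T m n :=
  LinearMap.toContinuousLinearMap
    { toFun := fun τ => WithLp.toLp 2 fun p => if p.1 = i then τ p else 0
      map_add' := fun x y => by
        ext p
        simp only [PiLp.add_apply]
        split_ifs <;> simp
      map_smul' := fun c x => by
        ext p
        simp only [PiLp.smul_apply, RingHom.id_apply]
        split_ifs <;> simp }

/-- With constant operators `rowL`, measurability and boundedness of the operator field τ ↦ Kτ
reduce to those of the scalars kᵢ. -/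
lemma sum_smul_rowL (d : Fin m → ℝ) (τ : T m n) :
    (∑ i, d i • rowL m n i) τ = diagMul d τ := by
  ext p
  simp [rowL, diagMul]

lemma norm_diagMul_le {d : Fin m → ℝ} {c : ℝ} (hd : ∀ i, |d i| ≤ c) (hc : 0 ≤ c) (τ : T m n) :
    ‖diagMul d τ‖ ≤ c * ‖τ‖ := by
  refine (sq_le_sq₀ (norm_nonneg _) (by positivity)).1 ?_
  rw [mul_pow, EuclideanSpace.real_norm_sq_eq, EuclideanSpace.real_norm_sq_eq, Finset.mul_sum]
  refine Finset.sum_le_sum fun p _ => ?_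
  simp only [diagMul, mul_pow]
  refine mul_le_mul_of_nonneg_right ?_ (sq_nonneg _)
  exact sq_le_sq' (neg_le_of_abs_le (hd _)) (le_of_abs_le (hd _))

lemma le_inner_diagMul {d : Fin m → ℝ} {c : ℝ} (hd : ∀ i, c ≤ d i) (τ : T m n) :
    c * ‖τ‖ ^ 2 ≤ inner ℝ (diagMul d τ) τ := by
  rw [EuclideanSpace.real_norm_sq_eq, PiLp.inner_apply, Finset.mul_sum]
  refine Finset.sum_le_sum fun p _ => ?_
  simp only [diagMul, RCLike.inner_apply, conj_trivial]
  nlinarith [hd p.1, sq_nonneg (τ p)]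

/-! ### Multiplication operators on `L²` -/

/-- Pointwise application of a bounded measurable field of operators. -/
def mulOp (Ω : PolyhedralDomain n) {V : Type} [NormedAddCommGroup V] [NormedSpace ℝ V]
    (A : E n → V →L[ℝ] V) (hA : MemLp A ⊤ Ω.vol) : L2 Ω V →L[ℝ] L2 Ω V :=
  (ContinuousLinearMap.id ℝ (V →L[ℝ] V)).holderL Ω.vol ⊤ 2 2 (hA.toLp A)

lemma coeFn_mulOp {Ω : PolyhedralDomain n} {V : Type} [NormedAddCommGroup V] [NormedSpace ℝ V]
    {A : E n → V →L[ℝ] V} (hA : MemLp A ⊤ Ω.vol) (f : L2 Ω V) :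
    mulOp Ω A hA f =ᵐ[Ω.vol] fun x => A x (f x) := by
  filter_upwards [(ContinuousLinearMap.id ℝ (V →L[ℝ] V)).coeFn_holder (r := 2) (hA.toLp A) f,
    hA.coeFn_toLp] with x h1 h2
  refine Eq.trans h1 ?_
  rw [h2]
  rfl

attribute [irreducible] mulOp

/-- The integral of a pointwise inner product is an inner product in `L²`. -/
lemma integral_inner_eq {Ω : PolyhedralDomain n} {V : Type} [NormedAddCommGroup V]
    [InnerProductSpace ℝ V] (f g : L2 Ω V) {f' g' : E n → V} (hf : f =ᵐ[Ω.vol] f')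
    (hg : g =ᵐ[Ω.vol] g') : ∫ x, inner ℝ (f' x) (g' x) ∂Ω.vol = inner ℝ f g := by
  rw [L2.inner_def]
  refine integral_congr_ae ?_
  filter_upwards [hf, hg] with x h1 h2
  rw [h1, h2]

lemma integral_norm_sq_eq {Ω : PolyhedralDomain n} {V : Type} [NormedAddCommGroup V]
    [InnerProductSpace ℝ V] (f : L2 Ω V) {f' : E n → V} (hf : f =ᵐ[Ω.vol] f') :
    ∫ x, ‖f' x‖ ^ 2 ∂Ω.vol = ‖f‖ ^ 2 := by
  rw [← real_inner_self_eq_norm_sq, ← integral_inner_eq f f hf hf]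
  simp

end

end DoubleDiffusive

namespace DoubleDiffusive

noncomputable section

variable {n m : ℕ} {Ω : PolyhedralDomain n}

/-! ### Closedness of the function spaces -/

/-- The integral is an L² inner product with a fixed function. The conditions defining `H1` and
`Hdiv0` are equations between such functionals, hence closed. -/
lemma continuous_integral_coord {ι : Type} [Fintype ι] (i : ι) {f : E n → ℝ}
    (hf : MemLp f 2 Ω.vol) :
    Continuous fun u : L2 Ω (EuclideanSpace ℝ ι) => ∫ x, u x i * f x ∂Ω.vol := by
  have h : ∀ u : L2 Ω (EuclideanSpace ℝ ι), ∫ x, u x i * f x ∂Ω.vol =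
      inner ℝ (hf.toLp f)
        ((EuclideanSpace.proj i : EuclideanSpace ℝ ι →L[ℝ] ℝ).compLpL 2 Ω.vol u) := by
    intro u
    rw [← integral_inner_eq _ _ hf.coeFn_toLp (ContinuousLinearMap.coeFn_compLpL _ u)]
    simp
  simp only [h]
  fun_prop

lemma isClosed_H1 : IsClosed (H1 Ω m : Set (SobPair Ω m)) := by
  have h : (H1 Ω m : Set (SobPair Ω m)) = {p | IsWeakGrad Ω p.fst p.snd} := rfl
  rw [h]
  simp only [IsWeakGrad, Set.ofPred_forall]
  refine isClosed_iInter fun η => isClosed_iInter fun hη => isClosed_iInter fun i =>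
    isClosed_iInter fun j => isClosed_eq ?_ ?_
  · exact (continuous_integral_coord i (hη.memLp_pd j)).comp (WithLp.fstL 2 ℝ _ _).continuous
  · exact ((continuous_integral_coord (i, j) hη.memLp).comp
      (WithLp.sndL 2 ℝ _ _).continuous).neg

lemma isClosed_Hdiv0 :
    IsClosed (Hdiv0 Ω : Set (WithLp 2 (L2 Ω (T n n) × L2 Ω (E n)))) := by
  have h : (Hdiv0 Ω : Set (WithLp 2 (L2 Ω (T n n) × L2 Ω (E n)))) =
    {p | IsWeakDiv Ω p.fst p.snd} ∩ {p | ∑ i, ∫ x, p.fst x (i, i) * 1 ∂Ω.vol = 0} := rfl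
  rw [h]
  refine IsClosed.inter ?_ (isClosed_eq (continuous_finsetSum _ fun i _ => ?_) continuous_const)
  · simp only [IsWeakDiv, Set.ofPred_forall]
    refine isClosed_iInter fun η => isClosed_iInter fun hη => isClosed_iInter fun i =>
      isClosed_eq (continuous_finsetSum _ fun j _ => ?_) ?_
    · exact (continuous_integral_coord (i, j) (hη.memLp_pd j)).comp
        (WithLp.fstL 2 ℝ _ _).continuous
    · exact ((continuous_integral_coord i hη.memLp).comp (WithLp.sndL 2 ℝ _ _).continuous).neg
  · exact (continuous_integral_coord (i, i) (memLp_const (1 : ℝ))).comp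
      (WithLp.fstL 2 ℝ _ _).continuous

/-- The trace as a continuous linear map. -/
def trL (n : ℕ) : T n n →L[ℝ] ℝ :=
  ∑ i, (EuclideanSpace.proj (i, i) : T n n →L[ℝ] ℝ)

lemma trL_apply (τ : T n n) : trL n τ = tr τ := by simp [trL, tr]

/-- Symmetric fields are the fixed points, and trace-free fields the kernel, of bounded operators on
L². -/
lemma isClosed_Ltr : IsClosed (Ltr Ω : Set (L2 Ω (T n n))) := by
  have h : (Ltr Ω : Set (L2 Ω (T n n))) =
      {r | (symL n).compLpL 2 Ω.vol r = r} ∩ {r | (trL n).compLpL 2 Ω.vol r = 0} := by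
    ext r
    have h0 : r ∈ (Ltr Ω : Set (L2 Ω (T n n))) ↔
      ∀ᵐ x ∂Ω.vol, (∀ i j, r x (i, j) = r x (j, i)) ∧ tr (r x) = 0 := Iff.rfl
    have hs : ∀ τ : T n n, (∀ i j, τ (i, j) = τ (j, i)) ↔ symPart τ = τ := by
      intro τ
      constructor
      · intro h
        ext ⟨i, j⟩
        simp only [symPart]
        rw [h j i]
        ring
      · intro h i j
        rw [← h]
        simp only [symPart]
        ring
    rw [h0, eventually_and]
    refine and_congr ?_ ?_
    · rw [Set.mem_ofPred_eq, Lp.ext_iff]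
      constructor
      · intro h
        filter_upwards [h, (symL n).coeFn_compLpL r] with x h1 h2
        rw [h2, symL_apply, (hs _).1 h1]
      · intro h
        filter_upwards [h, (symL n).coeFn_compLpL r] with x h1 h2
        rw [hs, ← symL_apply, ← h2, h1]
    · rw [Set.mem_ofPred_eq, Lp.ext_iff]
      constructor
      · intro h
        filter_upwards [h, (trL n).coeFn_compLpL r, Lp.coeFn_zero ℝ 2 Ω.vol] with x h1 h2 h3
        rw [h2, trL_apply, h1, h3, Pi.zero_apply]
      · intro h
        filter_upwards [h, (trL n).coeFn_compLpL r, Lp.coeFn_zero ℝ 2 Ω.vol] with x h1 h2 h3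
        rw [← trL_apply, ← h2, h1, h3, Pi.zero_apply]
  rw [h]
  exact (isClosed_eq (ContinuousLinearMap.continuous _) continuous_id).inter
    (isClosed_eq (ContinuousLinearMap.continuous _) continuous_const)

instance : CompleteSpace (H1 Ω m) := isClosed_H1.completeSpace_coe

instance : CompleteSpace (H10 Ω m) :=
  (Submodule.isClosed_topologicalClosure _).completeSpace_coe

instance : CompleteSpace (Hdiv0 Ω) := isClosed_Hdiv0.completeSpace_coe

instance : CompleteSpace (Ltr Ω) := isClosed_Ltr.completeSpace_coe

/-! ### Test functions -/

lemma contDiff_pd {f : E n → ℝ} (hf : ContDiff ℝ ∞ f) (j : Fin n) : ContDiff ℝ ∞ (pd f j) :=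
  (hf.fderiv_right (m := ∞) (by simp)).clm_apply contDiff_const

lemma hasCompactSupport_pd {f : E n → ℝ} (hf : HasCompactSupport f) (j : Fin n) :
    HasCompactSupport (pd f j) :=
  hf.fderiv_apply (𝕜 := ℝ) _

/-- Compact support of one factor removes the boundary terms; f may thus be a nonzero constant, as
in `sobolevConst_ne_zero`. -/
lemma integral_mul_pd {f g : E n → ℝ} (hf : ContDiff ℝ ∞ f) (hg : ContDiff ℝ ∞ g)
    (hgc : HasCompactSupport g) (j : Fin n) :
    ∫ x, f x * pd g j x = -∫ x, pd f j x * g x := by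
  refine integral_mul_fderiv_eq_neg_fderiv_mul_of_integrable ?_ ?_ ?_
    (fun x _ => hf.differentiable (by simp) x) (fun x _ => hg.differentiable (by simp) x)
  · exact ((contDiff_pd hf j).continuous.mul hg.continuous).integrable_of_hasCompactSupport
      hgc.mul_left
  · exact (hf.continuous.mul (contDiff_pd hg j).continuous).integrable_of_hasCompactSupport
      (hasCompactSupport_pd hgc j).mul_left
  · exact (hf.continuous.mul hg.continuous).integrable_of_hasCompactSupport hgc.mul_left

lemma pd_comm {f : E n → ℝ} (hf : ContDiff ℝ ∞ f) (i j : Fin n) :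
    pd (pd f i) j = pd (pd f j) i := by
  funext x
  have hd : DifferentiableAt ℝ (fderiv ℝ f) x :=
    (hf.fderiv_right (m := 1) (by norm_cast)).differentiable (by simp) x
  have key : ∀ i j : Fin n, pd (pd f i) j x =
      fderiv ℝ (fderiv ℝ f) x (EuclideanSpace.single j 1) (EuclideanSpace.single i 1) := by
    intro i j
    have : HasFDerivAt (pd f i) ((fderiv ℝ (fderiv ℝ f) x).flip (EuclideanSpace.single i 1)) x := by
      have h := hd.hasFDerivAt.clm_apply (hasFDerivAt_const (EuclideanSpace.single i (1 : ℝ)) x)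
      simp only [ContinuousLinearMap.comp_zero, zero_add] at h
      exact h
    rw [pd, this.fderiv]
    rfl
  rw [key, key]
  exact (hf.contDiffAt.isSymmSndFDerivAt (by simpa using ENat.LEInfty.out)) _ _

/-- Both sides equal minus the integral of f ∂ᵢ∂ⱼg. This identity turns ∫ ∇v : (∇v)ᵀ into ∫ (div v)²
in Korn's inequality. -/
lemma integral_pd_mul_pd_comm {f g : E n → ℝ} (hf : ContDiff ℝ ∞ f) (hg : ContDiff ℝ ∞ g)
    (hgc : HasCompactSupport g) (i j : Fin n) :
    ∫ x, pd f j x * pd g i x = ∫ x, pd f i x * pd g j x := by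
  have h1 := integral_mul_pd hf (contDiff_pd hg i) (hasCompactSupport_pd hgc i) j
  have h2 := integral_mul_pd hf (contDiff_pd hg j) (hasCompactSupport_pd hgc j) i
  rw [pd_comm hg i j] at h1
  linarith

lemma integral_vol_eq {f : E n → ℝ} (hf : ∀ x, x ∉ Ω.carrier → f x = 0) :
    ∫ x, f x ∂Ω.vol = ∫ x, f x :=
  setIntegral_eq_integral_of_forall_compl_eq_zero hf

/-- The `i`-th component of a test field. -/
lemma IsTest.coord {η : E n → E m} (h : IsTest Ω η) (i : Fin m) :
    IsTest Ω fun x => η x i := by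
  have hs : tsupport (fun x => η x i) ⊆ tsupport η :=
    closure_mono fun x hx hx' => hx (by simp [hx'])
  exact ⟨(contDiff_euclidean.1 h.1) i, h.2.1.mono' (subset_closure.trans hs), hs.trans h.2.2⟩

lemma gradField_apply {η : E n → E m} (h : ContDiff ℝ ∞ η) (x : E n) (i : Fin m) (j : Fin n) :
    gradField η x (i, j) = pd (fun x => η x i) j x := by
  have := ((EuclideanSpace.proj i : E m →L[ℝ] ℝ).hasFDerivAt.comp x
    (h.differentiable (by simp) x).hasFDerivAt).fderiv
  rw [pd]
  erw [this]
  rfl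

lemma IsTest.eq_zero {η : E n → ℝ} (h : IsTest Ω η) {x : E n} (hx : x ∉ Ω.carrier) : η x = 0 :=
  image_eq_zero_of_notMem_tsupport fun h' => hx (h.2.2 h')

lemma IsTest.pd_eq_zero {η : E n → ℝ} (h : IsTest Ω η) (j : Fin n) {x : E n}
    (hx : x ∉ Ω.carrier) : pd η j x = 0 := by
  have : fderiv ℝ η x = 0 :=
    image_eq_zero_of_notMem_tsupport fun h' => hx (h.2.2 (tsupport_fderiv_subset ℝ h'))
  simp [pd, this]

/-! ### The inclusion of H¹₀ in H¹, and Korn's inequality. -/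

lemma testPairs_le_H1 : testPairs Ω m ≤ H1 Ω m := by
  rintro p ⟨η, hη, h1, h2⟩ ζ hζ i j
  have e1 : ∫ x, p.fst x i * pd ζ j x ∂Ω.vol = ∫ x, η x i * pd ζ j x := by
    rw [← integral_vol_eq (Ω := Ω) fun x hx => by simp [hζ.pd_eq_zero j hx]]
    refine integral_congr_ae ?_
    filter_upwards [h1] with x hx
    rw [hx]
  have e2 : ∫ x, p.snd x (i, j) * ζ x ∂Ω.vol = ∫ x, pd (fun x => η x i) j x * ζ x := by
    rw [← integral_vol_eq (Ω := Ω) fun x hx => by simp [hζ.eq_zero hx]]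
    refine integral_congr_ae ?_
    filter_upwards [h2] with x hx
    rw [hx, gradField_apply hη.1]
  rw [e1, e2, integral_mul_pd (hη.coord i).1 hζ.1 hζ.2.1]

lemma H10_le_H1 : H10 Ω m ≤ H1 Ω m :=
  Submodule.topologicalClosure_minimal _ testPairs_le_H1 isClosed_H1

/-- The inclusion of `H¹₀(Ω)` into `H¹(Ω)`. -/
def incl (Ω : PolyhedralDomain n) (m : ℕ) : H10 Ω m →L[ℝ] H1 Ω m :=
  (Submodule.subtypeL (H10 Ω m)).codRestrict (H1 Ω m) fun u => H10_le_H1 u.2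

/-- Korn's inequality in `H¹₀(Ω)`. -/
lemma korn (u : H10 Ω n) :
    ‖u.1.snd‖ ^ 2 ≤ 2 * ‖(symL n).compLpL 2 Ω.vol u.1.snd‖ ^ 2 := by
  have hcl : IsClosed {p : SobPair Ω n |
      ‖p.snd‖ ^ 2 ≤ 2 * ‖(symL n).compLpL 2 Ω.vol p.snd‖ ^ 2} := by
    have hc : Continuous fun p : SobPair Ω n => p.snd := (WithLp.sndL 2 ℝ _ _).continuous
    exact isClosed_le (by fun_prop) (by fun_prop)
  refine closure_minimal ?_ hcl u.2
  rintro p ⟨η, hη, -, h⟩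
  have hs := (symL n).coeFn_compLpL p.snd
  have hprod : ∀ i j : Fin n, Integrable (fun x => p.snd x (i, j) * p.snd x (j, i)) Ω.vol :=
    fun i j => integrable_coord_mul _ _ (memLp_coord p.snd (j, i))
  -- 2‖e(v)‖² = ‖∇v‖² + ∫ ∇v : (∇v)ᵀ, so it remains to see that the last integral is nonnegative.
  have e : 2 * ‖(symL n).compLpL 2 Ω.vol p.snd‖ ^ 2 =
      ‖p.snd‖ ^ 2 + ∑ i, ∑ j, ∫ x, p.snd x (i, j) * p.snd x (j, i) ∂Ω.vol := by
    rw [← integral_norm_sq_eq _ hs, ← integral_norm_sq_eq p.snd EventuallyEq.rfl,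
      ← integral_const_mul]
    simp only [symL_apply, two_mul_norm_symPart_sq]
    rw [integral_add, integral_finsetSum]
    · congr 1
      refine Finset.sum_congr rfl fun i _ => ?_
      rw [integral_finsetSum _ fun j _ => hprod i j]
    · exact fun i _ => integrable_finsetSum _ fun j _ => hprod i j
    · simpa using L2.integrable_inner (𝕜 := ℝ) p.snd p.snd
    · exact integrable_finsetSum _ fun i _ => integrable_finsetSum _ fun j _ => hprod i j
  have e2 : ∀ i j : Fin n, ∫ x, p.snd x (i, j) * p.snd x (j, i) ∂Ω.vol =
      ∫ x, p.snd x (i, i) * p.snd x (j, j) ∂Ω.vol := by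
    have key : ∀ i j k l : Fin n, ∫ x, p.snd x (i, j) * p.snd x (k, l) ∂Ω.vol =
        ∫ x, pd (fun x => η x i) j x * pd (fun x => η x k) l x := by
      intro i j k l
      rw [← integral_vol_eq (Ω := Ω) fun x hx => by simp [(hη.coord i).pd_eq_zero j hx]]
      refine integral_congr_ae ?_
      filter_upwards [h] with x hx
      rw [hx, gradField_apply hη.1, gradField_apply hη.1]
    intro i j
    rw [key, key, integral_pd_mul_pd_comm (hη.coord i).1 (hη.coord j).1
      (hη.coord j).2.1]
  have e3 : 0 ≤ ∑ i, ∑ j, ∫ x, p.snd x (i, j) * p.snd x (j, i) ∂Ω.vol := by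
    have hprod' : ∀ i j : Fin n, Integrable (fun x => p.snd x (i, i) * p.snd x (j, j)) Ω.vol :=
      fun i j => integrable_coord_mul _ _ (memLp_coord p.snd (j, j))
    rw [Finset.sum_congr rfl fun i _ => Finset.sum_congr rfl fun j _ => e2 i j]
    -- After the exchange of derivatives the double sum is the integral of (div v)².
    calc (0 : ℝ) ≤ ∫ x, (∑ i, p.snd x (i, i)) * (∑ j, p.snd x (j, j)) ∂Ω.vol :=
          integral_nonneg fun x => mul_self_nonneg _
      _ = _ := by
        simp only [Finset.sum_mul_sum]
        rw [integral_finsetSum]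
        · refine Finset.sum_congr rfl fun i _ => ?_
          rw [integral_finsetSum _ fun j _ => hprod' i j]
        · exact fun i _ => integrable_finsetSum _ fun j _ => hprod' i j
  rw [Set.mem_ofPred_eq, e]
  linarith

end

end DoubleDiffusive

namespace DoubleDiffusive

noncomputable section

variable {n m : ℕ} {Ω : PolyhedralDomain n}

/-! ### Traces -/

lemma continuous_gradField {η : E n → E m} (h : ContDiff ℝ ∞ η) : Continuous (gradField η) := by
  refine (PiLp.continuous_toLp 2 _).comp (continuous_pi fun p => ?_)
  exact (EuclideanSpace.proj p.1 : E m →L[ℝ] ℝ).continuous.comp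
    ((h.continuous_fderiv (by simp)).clm_apply continuous_const)

/-- Replacing sequences by single approximants spares a diagonal argument when limits of functions
with a given trace are taken. -/
lemma hasTrace_iff {ΓD : Set (E n)} (φ : H1 Ω m) (g : Lp (E m) 2 (surf ΓD)) :
    HasTrace φ g ↔ ∀ δ : ℝ≥0∞, 0 < δ → ∃ η : E n → E m, ContDiff ℝ ∞ η ∧
      eLpNorm (fun x => η x - φ.1.fst x) 2 Ω.vol < δ ∧
      eLpNorm (fun x => gradField η x - φ.1.snd x) 2 Ω.vol < δ ∧
      eLpNorm (fun x => η x - g x) 2 (surf ΓD) < δ := by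
  constructor
  · rintro ⟨η, h, h1, h2, h3⟩ δ hδ
    obtain ⟨k, hk1, hk2, hk3⟩ := ((h1.eventually_lt_const hδ).and
      ((h2.eventually_lt_const hδ).and (h3.eventually_lt_const hδ))).exists
    exact ⟨η k, h k, hk1, hk2, hk3⟩
  · intro h
    choose η hη using fun k : ℕ => h ((k : ℝ≥0∞)⁻¹) (by simp)
    have hz := ENNReal.tendsto_inv_nat_nhds_zero
    refine ⟨η, fun k => (hη k).1, ?_, ?_, ?_⟩
    · exact tendsto_of_tendsto_of_tendsto_of_le_of_le tendsto_const_nhds hz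
        (fun _ => zero_le) fun k => (hη k).2.1.le
    · exact tendsto_of_tendsto_of_tendsto_of_le_of_le tendsto_const_nhds hz
        (fun _ => zero_le) fun k => (hη k).2.2.1.le
    · exact tendsto_of_tendsto_of_tendsto_of_le_of_le tendsto_const_nhds hz
        (fun _ => zero_le) fun k => (hη k).2.2.2.le

lemma HasTrace.add {ΓD : Set (E n)} {φ ψ : H1 Ω m} {g h : Lp (E m) 2 (surf ΓD)}
    (hφ : HasTrace φ g) (hψ : HasTrace ψ h) : HasTrace (φ + ψ) (g + h) := by
  obtain ⟨η, hη, a1, a2, a3⟩ := hφ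
  obtain ⟨ζ, hζ, b1, b2, b3⟩ := hψ
  have sq : ∀ {u v w : ℕ → ℝ≥0∞}, Tendsto u atTop (𝓝 0) → Tendsto v atTop (𝓝 0) →
      (∀ k, w k ≤ u k + v k) → Tendsto w atTop (𝓝 0) := fun hu hv hw =>
    tendsto_of_tendsto_of_tendsto_of_le_of_le tendsto_const_nhds (by simpa using hu.add hv)
      (fun _ => zero_le) hw
  refine ⟨fun k => η k + ζ k, fun k => (hη k).add (hζ k), sq a1 b1 fun k => ?_,
    sq a2 b2 fun k => ?_, sq a3 b3 fun k => ?_⟩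
  · refine le_trans (le_of_eq (eLpNorm_congr_ae ?_)) (eLpNorm_add_le
      ((hη k).continuous.aestronglyMeasurable.sub (Lp.aestronglyMeasurable _))
      ((hζ k).continuous.aestronglyMeasurable.sub (Lp.aestronglyMeasurable _)) (by norm_num))
    filter_upwards [Lp.coeFn_add φ.1.fst ψ.1.fst] with x hx
    have : (φ + ψ).1.fst x = φ.1.fst x + ψ.1.fst x := hx
    simp only [Pi.add_apply, this]
    abel
  · refine le_trans (le_of_eq (eLpNorm_congr_ae ?_)) (eLpNorm_add_le
      ((continuous_gradField (hη k)).aestronglyMeasurable.sub (Lp.aestronglyMeasurable _))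
      ((continuous_gradField (hζ k)).aestronglyMeasurable.sub (Lp.aestronglyMeasurable _))
      (by norm_num))
    filter_upwards [Lp.coeFn_add φ.1.snd ψ.1.snd] with x hx
    have : (φ + ψ).1.snd x = φ.1.snd x + ψ.1.snd x := hx
    have hg : gradField (η k + ζ k) x = gradField (η k) x + gradField (ζ k) x := by
      ext a
      simp [gradField, fderiv_add ((hη k).differentiable (by simp) x)
        ((hζ k).differentiable (by simp) x)]
    simp only [Pi.add_apply, this, hg]
    abel
  · refine le_trans (le_of_eq (eLpNorm_congr_ae ?_)) (eLpNorm_add_le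
      ((hη k).continuous.aestronglyMeasurable.sub (Lp.aestronglyMeasurable _))
      ((hζ k).continuous.aestronglyMeasurable.sub (Lp.aestronglyMeasurable _)) (by norm_num))
    filter_upwards [Lp.coeFn_add g h] with x hx
    simp only [Pi.add_apply, hx]
    abel

lemma HasTrace.const_smul {ΓD : Set (E n)} {φ : H1 Ω m} {g : Lp (E m) 2 (surf ΓD)}
    (hφ : HasTrace φ g) (c : ℝ) : HasTrace (c • φ) (c • g) := by
  obtain ⟨η, hη, a1, a2, a3⟩ := hφ
  have sq : ∀ {u w : ℕ → ℝ≥0∞}, Tendsto u atTop (𝓝 0) →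
      (∀ k, w k = ‖c‖ₑ * u k) → Tendsto w atTop (𝓝 0) := fun hu hw => by
    have := ENNReal.Tendsto.const_mul (a := ‖c‖ₑ) hu (Or.inr (by simp))
    rw [mul_zero] at this
    exact this.congr fun k => (hw k).symm
  refine ⟨fun k => c • η k, fun k => (hη k).const_smul c, sq a1 fun k => ?_,
    sq a2 fun k => ?_, sq a3 fun k => ?_⟩
  · rw [← eLpNorm_const_smul]
    refine eLpNorm_congr_ae ?_
    filter_upwards [Lp.coeFn_smul c φ.1.fst] with x hx
    have : (c • φ).1.fst x = c • φ.1.fst x := hx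
    simp only [Pi.smul_apply, this, smul_sub]
  · rw [← eLpNorm_const_smul]
    refine eLpNorm_congr_ae ?_
    filter_upwards [Lp.coeFn_smul c φ.1.snd] with x hx
    have : (c • φ).1.snd x = c • φ.1.snd x := hx
    have hg : gradField (c • η k) x = c • gradField (η k) x := by
      ext a
      simp [gradField, fderiv_const_smul ((hη k).differentiable (by simp) x)]
    simp only [Pi.smul_apply, this, hg, smul_sub]
  · rw [← eLpNorm_const_smul]
    refine eLpNorm_congr_ae ?_
    filter_upwards [Lp.coeFn_smul c g] with x hx
    simp only [Pi.smul_apply, hx, smul_sub]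

lemma hasTrace_zero {ΓD : Set (E n)} : HasTrace (0 : H1 Ω m) (0 : Lp (E m) 2 (surf ΓD)) := by
  refine ⟨fun _ => 0, fun _ => contDiff_const, ?_, ?_, ?_⟩
  · refine tendsto_const_nhds.congr fun k => (?_ : (0 : ℝ≥0∞) = _)
    rw [← eLpNorm_zero (p := 2) (ε := E m) (μ := Ω.vol)]
    refine eLpNorm_congr_ae ?_
    filter_upwards [Lp.coeFn_zero (E m) 2 Ω.vol] with x hx
    have : (0 : H1 Ω m).1.fst x = 0 := hx
    simp only [this, Pi.zero_apply, sub_zero]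
  · refine tendsto_const_nhds.congr fun k => (?_ : (0 : ℝ≥0∞) = _)
    rw [← eLpNorm_zero (p := 2) (ε := T m n) (μ := Ω.vol)]
    refine eLpNorm_congr_ae ?_
    filter_upwards [Lp.coeFn_zero (T m n) 2 Ω.vol] with x hx
    have : (0 : H1 Ω m).1.snd x = 0 := hx
    simp only [this]
    ext a
    simp [gradField]
  · refine tendsto_const_nhds.congr fun k => (?_ : (0 : ℝ≥0∞) = _)
    rw [← eLpNorm_zero (p := 2) (ε := E m) (μ := surf ΓD)]
    refine eLpNorm_congr_ae ?_
    filter_upwards [Lp.coeFn_zero (E m) 2 (surf ΓD)] with x hx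
    simp only [hx, Pi.zero_apply, sub_zero]

/-- `H¹_{Γ_D}(Ω)` as a submodule of `H¹(Ω)`. -/
def H1Dsub (Ω : PolyhedralDomain n) (ΓD : Set (E n)) : Submodule ℝ (H1 Ω 2) where
  carrier := H1D Ω ΓD
  add_mem' {φ ψ} hφ hψ := by
    have := HasTrace.add (show HasTrace φ _ from hφ) (show HasTrace ψ _ from hψ)
    rwa [add_zero] at this
  zero_mem' := hasTrace_zero
  smul_mem' c φ hφ := by
    have := HasTrace.const_smul (show HasTrace φ _ from hφ) c
    rwa [smul_zero] at this

/-- Makes the difference of two functions with the same Dirichlet datum an admissible test function.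
Linearity of the trace relation is enough; uniqueness of traces plays no role. -/
lemma HasTrace.sub_mem {ΓD : Set (E n)} {φ ψ : H1 Ω 2} {g : Lp (E 2) 2 (surf ΓD)}
    (hφ : HasTrace φ g) (hψ : HasTrace ψ g) : φ - ψ ∈ H1D Ω ΓD := by
  have := hφ.add (hψ.const_smul (-1))
  simp only [neg_smul, one_smul, ← sub_eq_add_neg, sub_self] at this
  exact this

lemma norm_fst_le (u : SobPair Ω m) : ‖u.fst‖ ≤ ‖u‖ := WithLp.norm_fst_le _ u
lemma norm_snd_le (u : SobPair Ω m) : ‖u.snd‖ ≤ ‖u‖ := WithLp.norm_snd_le _ u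

/-- No trace inequality is involved: if ψ is close to φ and has zero trace, a smooth approximant of
ψ also approximates φ, and the condition on Γ_D does not involve φ. -/
lemma isClosed_H1D (ΓD : Set (E n)) : IsClosed (H1D Ω ΓD) := by
  refine isClosed_of_closure_subset fun φ hφ => (hasTrace_iff _ _).2 fun δ hδ => ?_
  have hδ2 : 0 < δ / 2 := ENNReal.half_pos hδ.ne'
  -- The minimum with 1 keeps the radius finite when δ = ∞.
  obtain ⟨ψ, hψ, hd⟩ := Metric.mem_closure_iff.1 hφ (min (δ / 2) 1).toReal
    (ENNReal.toReal_pos (by simp [hδ.ne']) (by simp))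
  have hdist : ‖ψ.1 - φ.1‖ₑ < δ / 2 := by
    have h1 : ‖ψ.1 - φ.1‖ < (min (δ / 2) 1).toReal := by
      rw [dist_comm, dist_eq_norm] at hd
      exact hd
    rw [← ofReal_norm]
    refine ((ENNReal.ofReal_lt_iff_lt_toReal (norm_nonneg _) (by simp)).2 h1).trans_le
      (min_le_left _ _)
  obtain ⟨η, hη, h1, h2, h3⟩ := (hasTrace_iff _ _).1 hψ (δ / 2) hδ2
  refine ⟨η, hη, ?_, ?_, h3.trans_le ENNReal.half_le_self⟩
  · have e : eLpNorm (fun x => ψ.1.fst x - φ.1.fst x) 2 Ω.vol ≤ ‖ψ.1 - φ.1‖ₑ := by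
      calc _ = ‖(ψ.1 - φ.1).fst‖ₑ := by
            rw [Lp.enorm_def]
            exact eLpNorm_congr_ae (Lp.coeFn_sub ψ.1.fst φ.1.fst).symm
        _ ≤ _ := enorm_le_iff_norm_le.2 (norm_fst_le _)
    rw [← ENNReal.add_halves δ]
    refine lt_of_le_of_lt ?_ (ENNReal.add_lt_add h1 (e.trans_lt hdist))
    refine le_trans (le_of_eq ?_) (eLpNorm_add_le
      (hη.continuous.aestronglyMeasurable.sub (Lp.aestronglyMeasurable _))
      ((Lp.aestronglyMeasurable _).sub (Lp.aestronglyMeasurable _)) (by norm_num))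
    congr 1
    funext x
    simp
  · have e : eLpNorm (fun x => ψ.1.snd x - φ.1.snd x) 2 Ω.vol ≤ ‖ψ.1 - φ.1‖ₑ := by
      calc _ = ‖(ψ.1 - φ.1).snd‖ₑ := by
            rw [Lp.enorm_def]
            exact eLpNorm_congr_ae (Lp.coeFn_sub ψ.1.snd φ.1.snd).symm
        _ ≤ _ := enorm_le_iff_norm_le.2 (norm_snd_le _)
    rw [← ENNReal.add_halves δ]
    refine lt_of_le_of_lt ?_ (ENNReal.add_lt_add h2 (e.trans_lt hdist))
    refine le_trans (le_of_eq ?_) (eLpNorm_add_le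
      ((continuous_gradField hη).aestronglyMeasurable.sub (Lp.aestronglyMeasurable _))
      ((Lp.aestronglyMeasurable _).sub (Lp.aestronglyMeasurable _)) (by norm_num))
    congr 1
    funext x
    simp

/-! ### Best constants -/

/-- A best constant is itself admissible, by division by y. The case y = 0 is separate: there `sInf
S * y` vanishes even when S is empty and its infimum is ∞. -/
lemma le_sInf_mul {S : Set ℝ≥0∞} {x y : ℝ≥0∞} (hy : y ≠ ⊤) (h0 : y = 0 → x = 0)
    (hS : ∀ c ∈ S, x ≤ c * y) : x ≤ sInf S * y := by
  rcases eq_or_ne y 0 with h | h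
  · simp [h0 h]
  · rw [← ENNReal.div_le_iff h hy]
    exact le_sInf fun c hc => (ENNReal.div_le_iff h hy).2 (hS c hc)

lemma eLpNorm_le_sobolevConst (q : ℝ≥0∞) (u : H1 Ω m) :
    eLpNorm u.1.fst q Ω.vol ≤ sobolevConst Ω m q * ‖u‖ₑ := by
  refine le_sInf_mul (by simp) (fun h => ?_) fun c hc => hc u
  have h0 : u = 0 := enorm_eq_zero.1 h
  have h1 : u.1.fst =ᵐ[Ω.vol] 0 := by
    rw [h0]
    exact Lp.coeFn_zero (E m) 2 Ω.vol
  rw [eLpNorm_congr_ae h1]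
  simp

lemma enorm_le_cgp {ΓD : Set (E n)} {ψ : H1 Ω 2} (hψ : ψ ∈ H1D Ω ΓD) (hc : cgp Ω ΓD ≠ ⊤) :
    ‖ψ‖ₑ ≤ cgp Ω ΓD * ‖ψ.1.snd‖ₑ := by
  refine le_sInf_mul (by simp) (fun h => ?_) fun c hc => hc ψ hψ
  -- A finite infimum means that some c is admissible, and this c forces ψ = 0 when ∇ψ = 0.
  have : {c | ∀ ψ ∈ H1D Ω ΓD, ‖ψ‖ₑ ≤ c * ‖ψ.1.snd‖ₑ}.Nonempty := by
    by_contra hne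
    rw [Set.not_nonempty_iff_eq_empty] at hne
    exact hc (by rw [cgp, hne, sInf_empty])
  obtain ⟨c, hc⟩ := this
  simpa [h] using hc ψ hψ

lemma eLpNorm_le_Ceps {ε : ℝ} {t : L2 Ω (T n n)} (ht : fracNorm ε t ≠ ⊤) :
    eLpNorm t (ENNReal.ofReal (2 * n / (n - 2 * ε))) Ω.vol ≤ Ceps Ω ε * fracNorm ε t := by
  refine le_sInf_mul ht (fun h => ?_) fun c hc => hc t ht.lt_top
  have h0 : t = 0 := by
    rcases ENNReal.rpow_eq_zero_iff.1 h with ⟨h', -⟩ | ⟨-, h'⟩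
    · exact enorm_eq_zero.1 (pow_eq_zero_iff two_ne_zero |>.1 (add_eq_zero.1 h').1)
    · norm_num at h'
  rw [h0, eLpNorm_congr_ae (Lp.coeFn_zero (T n n) 2 Ω.vol)]
  simp

/-- The best constant `c₂` satisfies its inequality. -/
lemma c2_mul_le (hc : c2 Ω ≠ 0) (τ : Hdiv0 Ω) :
    c2 Ω * ‖τ.1.fst‖ ^ 2 ≤ ∫ ξ, ‖dev (τ.1.fst ξ)‖ ^ 2 ∂Ω.vol + ‖τ.1.snd‖ ^ 2 := by
  set S := {c : ℝ | ∀ τ : Hdiv0 Ω,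
    c * ‖τ.1.fst‖ ^ 2 ≤ ∫ ξ, ‖dev (τ.1.fst ξ)‖ ^ 2 ∂Ω.vol + ‖τ.1.snd‖ ^ 2} with hS
  -- A real supremum is 0 by default for an unbounded or empty set, so c₂ ≠ 0 excludes both; S being
  -- closed, it then contains its supremum.
  have hbdd : BddAbove S := by
    by_contra h
    exact hc (Real.sSup_of_not_bddAbove h)
  have hne : S.Nonempty := by
    by_contra h
    rw [Set.not_nonempty_iff_eq_empty] at h
    exact hc (by rw [c2, ← hS, h, Real.sSup_empty])
  have hcl : IsClosed S := by
    rw [hS]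
    simp only [Set.ofPred_forall]
    exact isClosed_iInter fun τ => isClosed_le (by fun_prop) continuous_const
  exact hcl.csSup_mem hne hbdd τ

/-! ### The embeddings into `L^q` -/

lemma memLp_of_sobolevConst {q : ℝ≥0∞} (h : sobolevConst Ω m q ≠ ⊤) (u : H1 Ω m) :
    MemLp u.1.fst q Ω.vol :=
  ⟨Lp.aestronglyMeasurable _, (eLpNorm_le_sobolevConst q u).trans_lt
    (ENNReal.mul_lt_top h.lt_top (by simp))⟩

/-- The injection of `H¹(Ω; ℝᵐ)` into `L^q(Ω; ℝᵐ)`. -/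
def embL (Ω : PolyhedralDomain n) (m : ℕ) (q : ℝ≥0∞) [Fact (1 ≤ q)]
    (h : sobolevConst Ω m q ≠ ⊤) : H1 Ω m →L[ℝ] Lp (E m) q Ω.vol :=
  LinearMap.mkContinuous
    { toFun := fun u => (memLp_of_sobolevConst h u).toLp _
      map_add' := fun u v => by
        rw [← MemLp.toLp_add]
        exact MemLp.toLp_congr _ _ (Lp.coeFn_add u.1.fst v.1.fst)
      map_smul' := fun c u => by
        rw [RingHom.id_apply, ← MemLp.toLp_const_smul]
        exact MemLp.toLp_congr _ _ (Lp.coeFn_smul c u.1.fst) }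
    (sobolevConst Ω m q).toReal fun u => by
      change ‖(memLp_of_sobolevConst h u).toLp _‖ ≤ _
      rw [Lp.norm_toLp, ← toReal_enorm u, ← ENNReal.toReal_mul]
      exact ENNReal.toReal_mono (ENNReal.mul_ne_top h (by simp)) (eLpNorm_le_sobolevConst q u)

lemma coeFn_embL {q : ℝ≥0∞} [Fact (1 ≤ q)] (h : sobolevConst Ω m q ≠ ⊤) (u : H1 Ω m) :
    embL Ω m q h u =ᵐ[Ω.vol] u.1.fst :=
  (memLp_of_sobolevConst h u).coeFn_toLp

lemma norm_embL_le {q : ℝ≥0∞} [Fact (1 ≤ q)] (h : sobolevConst Ω m q ≠ ⊤) (u : H1 Ω m) :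
    ‖embL Ω m q h u‖ ≤ (sobolevConst Ω m q).toReal * ‖u‖ :=
  (embL Ω m q h).le_of_opNorm_le (LinearMap.mkContinuous_norm_le _ ENNReal.toReal_nonneg _) u

attribute [irreducible] embL

/-! ### Comparison and positivity of the embedding constants. -/

/-- Appending a zero component. -/
def padL (m : ℕ) : E m →L[ℝ] E (m + 1) :=
  LinearMap.toContinuousLinearMap
    { toFun := fun v => WithLp.toLp 2 fun i => Fin.lastCases 0 v i
      map_add' := fun x y => by
        ext i
        refine Fin.lastCases ?_ (fun i => ?_) i <;> simp
      map_smul' := fun c x => by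
        ext i
        refine Fin.lastCases ?_ (fun i => ?_) i <;> simp }

/-- Appending a zero row. -/
def padRowL (m n : ℕ) : T m n →L[ℝ] T (m + 1) n :=
  LinearMap.toContinuousLinearMap
    { toFun := fun v => WithLp.toLp 2 fun p => Fin.lastCases (0 : ℝ) (fun i => v (i, p.2)) p.1
      map_add' := fun x y => by
        ext ⟨i, j⟩
        refine Fin.lastCases ?_ (fun i => ?_) i <;> simp
      map_smul' := fun c x => by
        ext ⟨i, j⟩
        refine Fin.lastCases ?_ (fun i => ?_) i <;> simp }

lemma padL_castSucc (v : E m) (i : Fin m) : padL m v i.castSucc = v i := by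
  simp [padL]

lemma padL_last (v : E m) : padL m v (Fin.last m) = 0 := by
  simp [padL]

lemma padRowL_castSucc (v : T m n) (i : Fin m) (j : Fin n) :
    padRowL m n v (i.castSucc, j) = v (i, j) := by
  simp [padRowL]

lemma padRowL_last (v : T m n) (j : Fin n) : padRowL m n v (Fin.last m, j) = 0 := by
  simp [padRowL]

lemma norm_padL (v : E m) : ‖padL m v‖ = ‖v‖ := by
  rw [← sq_eq_sq₀ (norm_nonneg _) (norm_nonneg _), EuclideanSpace.real_norm_sq_eq,
    EuclideanSpace.real_norm_sq_eq, Fin.sum_univ_castSucc]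
  simp [padL_castSucc, padL_last]

lemma norm_padRowL (v : T m n) : ‖padRowL m n v‖ = ‖v‖ := by
  rw [← sq_eq_sq₀ (norm_nonneg _) (norm_nonneg _), EuclideanSpace.real_norm_sq_eq,
    EuclideanSpace.real_norm_sq_eq, Fintype.sum_prod_type, Fintype.sum_prod_type,
    Fin.sum_univ_castSucc]
  simp [padRowL_castSucc, padRowL_last]

lemma norm_compLpL_of_isometry {V W : Type} [NormedAddCommGroup V] [NormedSpace ℝ V]
    [NormedAddCommGroup W] [NormedSpace ℝ W] (L : V →L[ℝ] W) (hL : ∀ v, ‖L v‖ = ‖v‖)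
    (f : L2 Ω V) : ‖L.compLpL 2 Ω.vol f‖ = ‖f‖ := by
  rw [Lp.norm_def, Lp.norm_def]
  congr 1
  refine eLpNorm_congr_norm_ae ?_
  filter_upwards [L.coeFn_compLpL f] with x hx
  rw [hx, hL]

/-- Appending a zero component preserves both the H¹-norm and the L^q-norm. For n = 3 this lets c₁,
defined with three components, control the two-component vector φ. -/
lemma sobolevConst_le_succ (q : ℝ≥0∞) : sobolevConst Ω m q ≤ sobolevConst Ω (m + 1) q := by
  refine le_sInf fun c hc => sInf_le fun u => ?_
  let p : SobPair Ω (m + 1) := WithLp.toLp 2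
    ((padL m).compLpL 2 Ω.vol u.1.fst, (padRowL m n).compLpL 2 Ω.vol u.1.snd)
  have h1 : p.fst =ᵐ[Ω.vol] fun x => padL m (u.1.fst x) := (padL m).coeFn_compLpL _
  have h2 : p.snd =ᵐ[Ω.vol] fun x => padRowL m n (u.1.snd x) := (padRowL m n).coeFn_compLpL _
  have hp : p ∈ H1 Ω (m + 1) := by
    intro η hη i j
    have e1 : ∫ x, p.fst x i * pd η j x ∂Ω.vol = ∫ x, padL m (u.1.fst x) i * pd η j x ∂Ω.vol := by
      refine integral_congr_ae ?_
      filter_upwards [h1] with x hx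
      rw [hx]
    have e2 : ∫ x, p.snd x (i, j) * η x ∂Ω.vol =
        ∫ x, padRowL m n (u.1.snd x) (i, j) * η x ∂Ω.vol := by
      refine integral_congr_ae ?_
      filter_upwards [h2] with x hx
      rw [hx]
    rw [e1, e2]
    refine Fin.lastCases ?_ (fun i => ?_) i
    · simp [padL_last, padRowL_last]
    · simp only [padL_castSucc, padRowL_castSucc]
      exact u.2 η hη i j
  have hnorm : ‖(⟨p, hp⟩ : H1 Ω (m + 1))‖ = ‖u‖ := by
    change ‖p‖ = ‖u.1‖
    rw [← sq_eq_sq₀ (norm_nonneg _) (norm_nonneg _), WithLp.prod_norm_sq_eq_of_L2,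
      WithLp.prod_norm_sq_eq_of_L2]
    congr 2
    · exact norm_compLpL_of_isometry _ norm_padL _
    · exact norm_compLpL_of_isometry _ norm_padRowL _
  have := hc ⟨p, hp⟩
  rw [← ofReal_norm, hnorm, ofReal_norm] at this
  refine le_trans (le_of_eq ?_) this
  refine eLpNorm_congr_norm_ae ?_
  filter_upwards [h1] with x hx
  change _ = ‖p.fst x‖
  rw [hx, norm_padL]

lemma sobolevConst_two_le (hn : n = 2 ∨ n = 3) (q : ℝ≥0∞) :
    sobolevConst Ω 2 q ≤ sobolevConst Ω n q := by
  rcases hn with rfl | rfl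
  · exact le_rfl
  · exact sobolevConst_le_succ q

lemma vol_ne_zero : Ω.vol ≠ 0 := by
  rw [PolyhedralDomain.vol, Ne, Measure.restrict_eq_zero]
  exact (Ω.isOpen.measure_pos _ Ω.isConnected.nonempty).ne'

/-- A nonzero constant field lies in H¹ of the bounded Ω and has nonzero L^q-norm. -/
lemma sobolevConst_ne_zero (hm : 0 < m) {q : ℝ≥0∞} (hq : q ≠ 0) : sobolevConst Ω m q ≠ 0 := by
  intro h0
  let e : E m := EuclideanSpace.single ⟨0, hm⟩ 1
  let p : SobPair Ω m := WithLp.toLp 2 ((memLp_const e).toLp _, 0)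
  have h1 : p.fst =ᵐ[Ω.vol] fun _ => e := (memLp_const e).coeFn_toLp
  have hp : p ∈ H1 Ω m := by
    intro η hη i j
    have e1 : ∫ x, p.fst x i * pd η j x ∂Ω.vol = ∫ x, e i * pd η j x := by
      rw [← integral_vol_eq (Ω := Ω) fun x hx => by simp [hη.pd_eq_zero j hx]]
      refine integral_congr_ae ?_
      filter_upwards [h1] with x hx
      rw [hx]
    have e2 : ∫ x, p.snd x (i, j) * η x ∂Ω.vol = 0 := integral_zero_coord (i, j) η
    rw [e1, e2, integral_mul_pd contDiff_const hη.1 hη.2.1]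
    simp [pd]
  have := eLpNorm_le_sobolevConst q ⟨p, hp⟩
  rw [h0, zero_mul, nonpos_iff_eq_zero, eLpNorm_congr_ae h1,
    eLpNorm_eq_zero_iff aestronglyMeasurable_const hq] at this
  have hne : (ae Ω.vol).NeBot := ae_neBot.2 vol_ne_zero
  obtain ⟨x, hx⟩ := this.exists
  have hx' : e = 0 := hx
  have : (e : E m) ⟨0, hm⟩ = 0 := by rw [hx']; rfl
  simp [e] at this

end

end DoubleDiffusive

namespace DoubleDiffusive

noncomputable section

variable {n m : ℕ} {Ω : PolyhedralDomain n}

/-! ### Components of `ℍ` as continuous linear maps -/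

/-- The component `t`. -/
def tL (Ω : PolyhedralDomain n) : HH Ω →L[ℝ] L2 Ω (T n n) :=
  (Ltr Ω).subtypeL ∘L WithLp.fstL 2 ℝ _ _
/-- The component `σ`. -/
def σL (Ω : PolyhedralDomain n) : HH Ω →L[ℝ] L2 Ω (T n n) :=
  WithLp.fstL 2 ℝ _ _ ∘L (Hdiv0 Ω).subtypeL ∘L WithLp.fstL 2 ℝ _ _ ∘L WithLp.sndL 2 ℝ _ _
/-- The divergence of `σ`. -/
def divL (Ω : PolyhedralDomain n) : HH Ω →L[ℝ] L2 Ω (E n) :=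
  WithLp.sndL 2 ℝ _ _ ∘L (Hdiv0 Ω).subtypeL ∘L WithLp.fstL 2 ℝ _ _ ∘L WithLp.sndL 2 ℝ _ _
/-- The component `u` in `H¹₀(Ω)`. -/
def velL (Ω : PolyhedralDomain n) : HH Ω →L[ℝ] H10 Ω n :=
  WithLp.sndL 2 ℝ _ _ ∘L WithLp.sndL 2 ℝ _ _
/-- The component `u` in `L²(Ω)`. -/
def uL (Ω : PolyhedralDomain n) : HH Ω →L[ℝ] L2 Ω (E n) :=
  WithLp.fstL 2 ℝ _ _ ∘L (H10 Ω n).subtypeL ∘L velL Ω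
/-- The gradient of `u`. -/
def graduL (Ω : PolyhedralDomain n) : HH Ω →L[ℝ] L2 Ω (T n n) :=
  WithLp.sndL 2 ℝ _ _ ∘L (H10 Ω n).subtypeL ∘L velL Ω

lemma HH.norm_vel_sq (x : HH Ω) : ‖x.vel‖ ^ 2 = ‖x.u‖ ^ 2 + ‖x.gradu‖ ^ 2 :=
  WithLp.prod_norm_sq_eq_of_L2 x.snd.snd.1

lemma HH.norm_sq (x : HH Ω) : ‖x‖ ^ 2 =
    ‖x.t‖ ^ 2 + (‖x.σ‖ ^ 2 + ‖x.divσ‖ ^ 2) + (‖x.u‖ ^ 2 + ‖x.gradu‖ ^ 2) := by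
  rw [← HH.norm_vel_sq, WithLp.prod_norm_sq_eq_of_L2, WithLp.prod_norm_sq_eq_of_L2,
    ← add_assoc]
  congr 2
  exact WithLp.prod_norm_sq_eq_of_L2 x.snd.fst.1

lemma HH.norm_vel_le (x : HH Ω) : ‖x.vel‖ ≤ ‖x‖ := by
  refine (sq_le_sq₀ (norm_nonneg _) (norm_nonneg _)).1 ?_
  rw [HH.norm_sq, ← HH.norm_vel_sq]
  nlinarith [sq_nonneg ‖x.t‖, sq_nonneg ‖x.σ‖, sq_nonneg ‖x.divσ‖]

/-- The pairing `(x, y) ↦ ⟪f x, g y⟫`. -/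
def pairL {X Y V : Type*} [NormedAddCommGroup X] [NormedSpace ℝ X] [NormedAddCommGroup Y]
    [NormedSpace ℝ Y] [NormedAddCommGroup V] [InnerProductSpace ℝ V] (f : X →L[ℝ] V)
    (g : Y →L[ℝ] V) : X →L[ℝ] Y →L[ℝ] ℝ :=
  (LinearMap.mkContinuous₂ (innerₗ V) 1 fun x y => by
    simpa using norm_inner_le_norm (𝕜 := ℝ) x y : V →L[ℝ] V →L[ℝ] ℝ).bilinearComp f g

/-! ### Pointwise operations on fields -/

/-- The deviatoric part of a field. -/
def devLp (Ω : PolyhedralDomain n) : L2 Ω (T n n) →L[ℝ] L2 Ω (T n n) :=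
  (devL n).compLpL 2 Ω.vol
/-- The symmetric part of a field. -/
def symLp (Ω : PolyhedralDomain n) : L2 Ω (T n n) →L[ℝ] L2 Ω (T n n) :=
  (symL n).compLpL 2 Ω.vol
/-- The skew part of a field. -/
def skewLp (Ω : PolyhedralDomain n) : L2 Ω (T n n) →L[ℝ] L2 Ω (T n n) :=
  (skewL n).compLpL 2 Ω.vol

lemma coeFn_devLp (f : L2 Ω (T n n)) : devLp Ω f =ᵐ[Ω.vol] fun x => dev (f x) :=
  (devL n).coeFn_compLpL f
lemma coeFn_symLp (f : L2 Ω (T n n)) : symLp Ω f =ᵐ[Ω.vol] fun x => symPart (f x) :=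
  (symL n).coeFn_compLpL f
lemma coeFn_skewLp (f : L2 Ω (T n n)) : skewLp Ω f =ᵐ[Ω.vol] fun x => skewPart (f x) :=
  (skewL n).coeFn_compLpL f

lemma korn_symLp (u : H10 Ω n) : ‖u.1.snd‖ ^ 2 ≤ 2 * ‖symLp Ω u.1.snd‖ ^ 2 := korn u

attribute [irreducible] devLp symLp skewLp

lemma norm_devLp_le (f : L2 Ω (T n n)) : ‖devLp Ω f‖ ≤ ‖f‖ := by
  refine Lp.norm_le_norm_of_ae_le ?_
  filter_upwards [coeFn_devLp f] with x hx
  rw [hx]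
  exact norm_dev_le _

lemma coeFn_sub_smul {V : Type} [NormedAddCommGroup V] [NormedSpace ℝ V] (c : ℝ) (f g : L2 Ω V)
    {f' g' : E n → V} (hf : f =ᵐ[Ω.vol] f') (hg : g =ᵐ[Ω.vol] g') :
    (f - c • g : L2 Ω V) =ᵐ[Ω.vol] fun x => f' x - c • g' x := by
  filter_upwards [Lp.coeFn_sub f (c • g), Lp.coeFn_smul c g, hf, hg] with x h1 h2 h3 h4
  rw [h1, Pi.sub_apply, h2, Pi.smul_apply, h3, h4]

/-! ### The flow form -/

/-- The field of operators `ν(φ) I`. -/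
def viscField (ν : E 2 → ℝ) (φ : H1 Ω 2) (ξ : E n) : T n n →L[ℝ] T n n :=
  ν (φ.1.fst ξ) • ContinuousLinearMap.id ℝ (T n n)

lemma memLp_viscField {ν : E 2 → ℝ} {ν₁ ν₂ Lν : ℝ} (hν₁ : 0 < ν₁)
    (hν : ∀ a, ν₁ ≤ ν a ∧ ν a ≤ ν₂) (hνLip : ∀ a b, |ν a - ν b| ≤ Lν * ‖a - b‖) (φ : H1 Ω 2) :
    MemLp (viscField ν φ) ⊤ Ω.vol := by
  have hc : Continuous ν := by
    have : LipschitzWith Lν.toNNReal ν := LipschitzWith.of_dist_le_mul fun a b => by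
      rw [Real.dist_eq, dist_eq_norm]
      exact (hνLip a b).trans (mul_le_mul_of_nonneg_right (Real.le_coe_toNNReal _)
        (norm_nonneg _))
    exact this.continuous
  refine memLp_top_of_bound ?_ ν₂ (Eventually.of_forall fun ξ => ?_)
  · exact (hc.comp_aestronglyMeasurable (Lp.aestronglyMeasurable φ.1.fst)).smul_const _
  · have h := hν (φ.1.fst ξ)
    refine ContinuousLinearMap.opNorm_le_bound _ (by linarith) fun τ => ?_
    simp only [viscField, smul_apply, ContinuousLinearMap.id_apply, norm_smul,
      Real.norm_eq_abs]
    rw [abs_of_pos (by linarith)]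
    exact mul_le_mul_of_nonneg_right h.2 (norm_nonneg _)

/-- The operator `t ↦ ν(φ) t` on `L²(Ω)`. -/
def viscOp (ν : E 2 → ℝ) (φ : H1 Ω 2) (h : MemLp (viscField ν φ) ⊤ Ω.vol) :
    L2 Ω (T n n) →L[ℝ] L2 Ω (T n n) := mulOp Ω (viscField ν φ) h

lemma coeFn_viscOp {ν : E 2 → ℝ} {φ : H1 Ω 2} (h : MemLp (viscField ν φ) ⊤ Ω.vol)
    (f : L2 Ω (T n n)) : viscOp ν φ h f =ᵐ[Ω.vol] fun x => ν (φ.1.fst x) • f x :=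
  coeFn_mulOp h f

attribute [irreducible] viscOp

lemma norm_viscOp_le {ν : E 2 → ℝ} {ν₁ ν₂ : ℝ} (hν₁ : 0 < ν₁)
    (hν : ∀ a, ν₁ ≤ ν a ∧ ν a ≤ ν₂) {φ : H1 Ω 2} (h : MemLp (viscField ν φ) ⊤ Ω.vol)
    (f : L2 Ω (T n n)) : ‖viscOp ν φ h f‖ ≤ ν₂ * ‖f‖ := by
  refine Lp.norm_le_mul_norm_of_ae_le_mul ?_
  filter_upwards [coeFn_viscOp h f] with x hx
  have hb := hν (φ.1.fst x)
  rw [hx, norm_smul, Real.norm_eq_abs, abs_of_pos (by linarith)]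
  exact mul_le_mul_of_nonneg_right hb.2 (norm_nonneg _)

lemma le_inner_viscOp {ν : E 2 → ℝ} {ν₁ ν₂ : ℝ}
    (hν : ∀ a, ν₁ ≤ ν a ∧ ν a ≤ ν₂) {φ : H1 Ω 2} (h : MemLp (viscField ν φ) ⊤ Ω.vol)
    (f : L2 Ω (T n n)) : ν₁ * ‖f‖ ^ 2 ≤ inner ℝ (viscOp ν φ h f) f := by
  rw [← real_inner_self_eq_norm_sq, L2.inner_def, L2.inner_def, ← integral_const_mul]
  refine integral_mono_ae ((L2.integrable_inner f f).const_mul _) (L2.integrable_inner _ _) ?_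
  filter_upwards [coeFn_viscOp h f] with x hx
  have hb := hν (φ.1.fst x)
  simp only [hx, real_inner_smul_left, real_inner_self_eq_norm_sq]
  exact mul_le_mul_of_nonneg_right hb.1 (sq_nonneg _)

/-- The bilinear form behind `A_φ`, in terms of its component maps. -/
def flowForm {X V U : Type*} [NormedAddCommGroup X] [NormedSpace ℝ X] [NormedAddCommGroup V]
    [InnerProductSpace ℝ V] [NormedAddCommGroup U] [InnerProductSpace ℝ U]
    (νt t σ σd e s : X →L[ℝ] V) (u d : X →L[ℝ] U) (γ κ₁ κ₂ κ₃ : ℝ) : X →L[ℝ] X →L[ℝ] ℝ :=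
  (2 : ℝ) • pairL νt (t - κ₃ • σd) + pairL t (σd - κ₁ • e) - pairL σd (t - κ₃ • σd)
  + (1 - κ₂ * γ) • pairL u d - pairL d u + pairL s σ - pairL σ s
  + γ • pairL u u + κ₂ • pairL d d + κ₁ • pairL e e

/-- The form `A_φ` as a continuous bilinear form, for the viscosity operator `M`. -/
def flowA (M : L2 Ω (T n n) →L[ℝ] L2 Ω (T n n)) (γ κ₁ κ₂ κ₃ : ℝ) : HH Ω →L[ℝ] HH Ω →L[ℝ] ℝ :=
  flowForm (M ∘L tL Ω) (tL Ω) (σL Ω) (devLp Ω ∘L σL Ω) (symLp Ω ∘L graduL Ω)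
    (skewLp Ω ∘L graduL Ω) (uL Ω) (divL Ω) γ κ₁ κ₂ κ₃

lemma flowA_apply (M : L2 Ω (T n n) →L[ℝ] L2 Ω (T n n)) (γ κ₁ κ₂ κ₃ : ℝ) (x y : HH Ω) :
    flowA M γ κ₁ κ₂ κ₃ x y =
      2 * inner ℝ (M x.t) (y.t - κ₃ • devLp Ω y.σ)
      + inner ℝ x.t (devLp Ω y.σ - κ₁ • symLp Ω y.gradu)
      - inner ℝ (devLp Ω x.σ) (y.t - κ₃ • devLp Ω y.σ)
      + (1 - κ₂ * γ) * inner ℝ x.u y.divσ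
      - inner ℝ x.divσ y.u
      + inner ℝ (skewLp Ω x.gradu) y.σ
      - inner ℝ x.σ (skewLp Ω y.gradu)
      + γ * inner ℝ x.u y.u
      + κ₂ * inner ℝ x.divσ y.divσ
      + κ₁ * inner ℝ (symLp Ω x.gradu) (symLp Ω y.gradu) := rfl

attribute [irreducible] flowA

lemma formA_eq {ν : E 2 → ℝ} {φ : H1 Ω 2} (h : MemLp (viscField ν φ) ⊤ Ω.vol)
    (γ κ₁ κ₂ κ₃ : ℝ) (x y : HH Ω) :
    formA Ω ν γ κ₁ κ₂ κ₃ φ x y = flowA (viscOp ν φ h) γ κ₁ κ₂ κ₃ x y := by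
  have hr := coeFn_sub_smul κ₃ y.t (devLp Ω y.σ) EventuallyEq.rfl (coeFn_devLp _)
  have hs := coeFn_sub_smul κ₁ (devLp Ω y.σ) (symLp Ω y.gradu) (coeFn_devLp _) (coeFn_symLp _)
  rw [flowA_apply, formA]
  simp only [← real_inner_smul_left]
  rw [integral_inner_eq _ _ (coeFn_viscOp h x.t) hr, integral_inner_eq _ _ EventuallyEq.rfl hs,
    integral_inner_eq _ _ (coeFn_devLp x.σ) hr,
    integral_inner_eq x.u y.divσ EventuallyEq.rfl EventuallyEq.rfl,
    integral_inner_eq y.u x.divσ EventuallyEq.rfl EventuallyEq.rfl,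
    integral_inner_eq _ y.σ (coeFn_skewLp x.gradu) EventuallyEq.rfl,
    integral_inner_eq x.σ _ EventuallyEq.rfl (coeFn_skewLp y.gradu),
    integral_inner_eq x.u y.u EventuallyEq.rfl EventuallyEq.rfl,
    integral_inner_eq x.divσ y.divσ EventuallyEq.rfl EventuallyEq.rfl,
    integral_inner_eq _ _ (coeFn_symLp x.gradu) (coeFn_symLp y.gradu)]
  simp only [real_inner_smul_left, real_inner_comm y.u x.divσ]

/-! ### Ellipticity of the flow form. -/

lemma young_le {a b δ : ℝ} (hδ : 0 < δ) : a * b ≤ a ^ 2 / (2 * δ) + δ / 2 * b ^ 2 := by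
  rw [div_add' _ _ _ (by positivity), le_div_iff₀ (by positivity)]
  nlinarith [sq_nonneg (a - δ * b)]

/-- The arithmetic of the ellipticity estimate; `t, s, σ, d, u, e, G` stand for the norms of
`t, σᵈ, σ, div σ, u, e(u), ∇u`. -/
lemma ellipticity_arith {a c ν₁ ν₂ γ κ₁ κ₂ κ₃ δ₁ δ₂ δ₃ t s σ d u e G I₁ I₂ I₃ I₄ I₅ I₆ : ℝ}
    (hν₂ : 0 < ν₂) (hγ : 0 < γ) (hδ₁0 : 0 < δ₁) (hδ₁ : δ₁ * ν₂ < 1) (hδ₂0 : 0 < δ₂)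
    (hδ₂ : δ₂ * γ < 2) (hδ₃0 : 0 < δ₃) (hδ₃ : δ₃ < 1) (hκ₁ : 0 < κ₁) (hκ₂ : 0 < κ₂) (hκ₃ : 0 < κ₃)
    (ha1 : a ≤ 2 * ν₁ - κ₃ * ν₂ / δ₁ - κ₁ / (2 * δ₃))
    (ha2 : a ≤ c * min (κ₃ * (1 - ν₂ * δ₁)) (κ₂ / 2 * (1 - γ * δ₂ / 2)))
    (ha3 : a ≤ κ₂ / 2 * (1 - γ * δ₂ / 2)) (ha4 : a ≤ γ * (1 - κ₂ / (2 * δ₂)))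
    (ha5 : a ≤ κ₁ / 2 * (1 - δ₃)) (hσ : c * σ ^ 2 ≤ s ^ 2 + d ^ 2) (hk : G ^ 2 ≤ 2 * e ^ 2)
    (h₁ : ν₁ * t ^ 2 ≤ I₁) (h₂ : I₂ ≤ ν₂ * t * s) (h₃ : I₃ ≤ t * e) (h₄ : I₄ ≤ u * d) :
    a * (t ^ 2 + (σ ^ 2 + d ^ 2) + (u ^ 2 + G ^ 2)) ≤
      2 * (I₁ - κ₃ * I₂) + (I₅ - κ₁ * I₃) - (I₅ - κ₃ * s ^ 2) + (1 - κ₂ * γ) * I₄ - I₄ + I₆ - I₆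
      + γ * u ^ 2 + κ₂ * d ^ 2 + κ₁ * e ^ 2 := by
  -- On the diagonal I₅ and I₆ cancel, and Young's inequality leaves κ₃(1 - ν₂δ₁)s² and κ₂(1 -
  -- γδ₂/2)d². Half of the d² term is kept for div σ; the other half and the s² term dominate μ(s² +
  -- d²), which controls σ through c₂.
  set μ := min (κ₃ * (1 - ν₂ * δ₁)) (κ₂ / 2 * (1 - γ * δ₂ / 2)) with hμ
  have hμ0 : 0 < μ := lt_min (mul_pos hκ₃ (by linarith)) (mul_pos (by linarith) (by linarith))
  have y2 : I₂ ≤ ν₂ * (t ^ 2 / (2 * δ₁) + δ₁ / 2 * s ^ 2) := by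
    refine h₂.trans ?_
    rw [mul_assoc]
    exact mul_le_mul_of_nonneg_left (young_le hδ₁0) hν₂.le
  have z1 := mul_le_mul_of_nonneg_right ha1 (sq_nonneg t)
  have z2 := mul_le_mul_of_nonneg_right ha2 (sq_nonneg σ)
  have z3 := mul_le_mul_of_nonneg_right ha3 (sq_nonneg d)
  have z4 := mul_le_mul_of_nonneg_right ha4 (sq_nonneg u)
  have z5 := mul_le_mul_of_nonneg_right ha5 (sq_nonneg G)
  have w1 := mul_le_mul_of_nonneg_left hσ hμ0.le
  have hμ1 : μ ≤ κ₃ * (1 - ν₂ * δ₁) := min_le_left _ _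
  have hμ2 : μ ≤ κ₂ / 2 * (1 - γ * δ₂ / 2) := min_le_right _ _
  have w2 := mul_le_mul_of_nonneg_right hμ1 (sq_nonneg s)
  have w3 := mul_le_mul_of_nonneg_right hμ2 (sq_nonneg d)
  have w4 := mul_le_mul_of_nonneg_left hk (mul_nonneg (by linarith) (by linarith) :
    0 ≤ κ₁ / 2 * (1 - δ₃))
  -- Slack: κ₁(1 - δ₃/2)e² is available, whereas Korn's inequality uses only κ₁(1 - δ₃)e².
  have w5 : 0 ≤ κ₁ * δ₃ / 2 * e ^ 2 := by positivity
  have v2 := mul_le_mul_of_nonneg_left y2 (by positivity : 0 ≤ 2 * κ₃)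
  have v3 := mul_le_mul_of_nonneg_left (h₃.trans (young_le hδ₃0)) hκ₁.le
  have v4 := mul_le_mul_of_nonneg_left (h₄.trans (young_le hδ₂0)) (by positivity : 0 ≤ κ₂ * γ)
  clear_value μ
  ring_nf at z1 z2 z3 z4 z5 w1 w2 w3 w4 w5 v2 v3 v4 ⊢
  linarith

/-- Ellipticity of the forms `A_φ`. -/
lemma flowA_coercive {ν₁ ν₂ γ κ₁ κ₂ κ₃ δ₁ δ₂ δ₃ : ℝ} (hν₂ : 0 < ν₂) (hγ : 0 < γ)
    (hδ₁ : δ₁ ∈ Set.Ioo 0 (1 / ν₂)) (hδ₂ : δ₂ ∈ Set.Ioo 0 (2 / γ)) (hδ₃ : δ₃ ∈ Set.Ioo 0 1)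
    (hκ₁ : 0 < κ₁) (hκ₂ : 0 < κ₂) (hκ₃ : 0 < κ₃)
    (ha : 0 < ellA Ω ν₁ ν₂ γ κ₁ κ₂ κ₃ δ₁ δ₂ δ₃)
    {M : L2 Ω (T n n) →L[ℝ] L2 Ω (T n n)} (hM : ∀ f, ‖M f‖ ≤ ν₂ * ‖f‖)
    (hM' : ∀ f, ν₁ * ‖f‖ ^ 2 ≤ inner ℝ (M f) f) (x : HH Ω) :
    ellA Ω ν₁ ν₂ γ κ₁ κ₂ κ₃ δ₁ δ₂ δ₃ * ‖x‖ ^ 2 ≤ flowA M γ κ₁ κ₂ κ₃ x x := by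
  have ha2 : ellA Ω ν₁ ν₂ γ κ₁ κ₂ κ₃ δ₁ δ₂ δ₃ ≤
      c2 Ω * min (κ₃ * (1 - ν₂ * δ₁)) (κ₂ / 2 * (1 - γ * δ₂ / 2)) :=
    (min_le_right _ _).trans (min_le_left _ _)
  -- α(Ω) > 0 is possible only if c₂ ≠ 0, which is what `c2_mul_le` needs.
  have hc2 : c2 Ω ≠ 0 := by
    intro h
    rw [h, zero_mul] at ha2
    linarith
  have hσ : c2 Ω * ‖x.σ‖ ^ 2 ≤ ‖devLp Ω x.σ‖ ^ 2 + ‖x.divσ‖ ^ 2 := by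
    have := c2_mul_le hc2 x.snd.fst
    rwa [integral_norm_sq_eq _ (coeFn_devLp _)] at this
  rw [flowA_apply, HH.norm_sq, real_inner_comm x.u x.divσ,
    real_inner_comm x.σ (skewLp Ω x.gradu), inner_sub_right, inner_sub_right, inner_sub_right,
    real_inner_smul_right, real_inner_smul_right, real_inner_smul_right,
    real_inner_comm x.t (devLp Ω x.σ), real_inner_self_eq_norm_sq, real_inner_self_eq_norm_sq,
    real_inner_self_eq_norm_sq, real_inner_self_eq_norm_sq]
  exact ellipticity_arith hν₂ hγ hδ₁.1 ((lt_div_iff₀ hν₂).1 hδ₁.2) hδ₂.1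
    ((lt_div_iff₀ hγ).1 hδ₂.2) hδ₃.1 hδ₃.2 hκ₁ hκ₂ hκ₃ (min_le_left _ _) ha2
    ((min_le_right _ _).trans ((min_le_right _ _).trans (min_le_left _ _)))
    ((min_le_right _ _).trans
      ((min_le_right _ _).trans ((min_le_right _ _).trans (min_le_left _ _))))
    ((min_le_right _ _).trans
      ((min_le_right _ _).trans ((min_le_right _ _).trans (min_le_right _ _))))
    hσ (korn_symLp x.vel) (hM' x.t)
    ((real_inner_le_norm _ _).trans (mul_le_mul_of_nonneg_right (hM _) (norm_nonneg _)))
    (real_inner_le_norm _ _) (real_inner_le_norm _ _)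

end

end DoubleDiffusive

namespace DoubleDiffusive

noncomputable section

variable {n m : ℕ} {Ω : PolyhedralDomain n}

/-! ### Hölder exponents (4, 4, 2) and the size of the test fields. -/

instance : Fact ((1 : ℝ≥0∞) ≤ 4) := ⟨by norm_num⟩

instance : ENNReal.HolderTriple 4 4 2 := ⟨by
  rw [← ENNReal.toReal_eq_toReal_iff' (by simp) (by simp), ENNReal.toReal_add (by simp) (by simp)]
  norm_num [ENNReal.toReal_inv]⟩

/-- Cauchy–Schwarz, which would even allow 1 + κ²; the form 2 + κ² is the one occurring in r₀, C_𝒜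
and L_𝒜. -/
lemma mul_add_le_sqrt {κ a b N : ℝ} (hN : 0 ≤ N) (h : a ^ 2 + b ^ 2 ≤ N ^ 2) :
    κ * a + b ≤ √(2 + κ ^ 2) * N := by
  refine le_of_sq_le_sq ?_ (by positivity)
  rw [mul_pow, Real.sq_sqrt (by positivity)]
  nlinarith [sq_nonneg (κ * b - a), sq_nonneg a, sq_nonneg b,
    mul_le_mul_of_nonneg_left h (by positivity : 0 ≤ 2 + κ ^ 2)]

lemma norm_test_le (κ₃ : ℝ) (hκ₃ : 0 ≤ κ₃) (y : HH Ω) :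
    ‖y.t - κ₃ • devLp Ω y.σ‖ ≤ √(2 + κ₃ ^ 2) * ‖y‖ := by
  have h1 : ‖y.t - κ₃ • devLp Ω y.σ‖ ≤ κ₃ * ‖y.σ‖ + ‖y.t‖ := by
    refine (norm_sub_le _ _).trans ?_
    rw [norm_smul, Real.norm_eq_abs, abs_of_nonneg hκ₃, add_comm]
    gcongr
    exact norm_devLp_le _
  refine h1.trans (mul_add_le_sqrt (norm_nonneg _) ?_)
  rw [HH.norm_sq]
  nlinarith [sq_nonneg ‖y.divσ‖, sq_nonneg ‖y.u‖, sq_nonneg ‖y.gradu‖]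

/-! ### The convective forms -/

/-- `v ⊗ w` for `v ∈ H¹(Ω; ℝᵐ)` and `w ∈ H¹₀(Ω)`. -/
def dyadOp (hm : sobolevConst Ω m 4 ≠ ⊤) (hn : sobolevConst Ω n 4 ≠ ⊤) :
    H10 Ω n →L[ℝ] H1 Ω m →L[ℝ] L2 Ω (T m n) :=
  ((dyadL m n).holderL Ω.vol 4 4 2).flip.bilinearComp (embL Ω n 4 hn ∘L incl Ω n) (embL Ω m 4 hm)

lemma coeFn_dyadOp (hm : sobolevConst Ω m 4 ≠ ⊤) (hn : sobolevConst Ω n 4 ≠ ⊤) (w : H10 Ω n)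
    (v : H1 Ω m) :
    dyadOp hm hn w v =ᵐ[Ω.vol] fun ξ => dyad (v.1.fst ξ) (w.1.fst ξ) := by
  filter_upwards [(dyadL m n).coeFn_holder (r := 2) (embL Ω m 4 hm v) (embL Ω n 4 hn (incl Ω n w)),
    coeFn_embL hm v, coeFn_embL hn (incl Ω n w)] with ξ h1 h2 h3
  refine Eq.trans h1 ?_
  rw [h2, h3]
  rfl

/-- Hölder's inequality with two factors in L⁴ uses the embedding twice, whence the square in c₁;
`hmn` absorbs the constant for m components. -/
lemma norm_dyadOp_le (hm : sobolevConst Ω m 4 ≠ ⊤) (hn : sobolevConst Ω n 4 ≠ ⊤)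
    (hmn : sobolevConst Ω m 4 ≤ sobolevConst Ω n 4) (w : H10 Ω n) (v : H1 Ω m) :
    ‖dyadOp hm hn w v‖ ≤ (c1 Ω).toReal * ‖w‖ * ‖v‖ := by
  have h1 : ‖dyadOp hm hn w v‖ ≤ ‖dyadL m n‖ * ‖embL Ω m 4 hm v‖ * ‖embL Ω n 4 hn (incl Ω n w)‖ :=
    (dyadL m n).norm_holder_apply_apply_le _ _
  have h2 : ‖embL Ω m 4 hm v‖ ≤ (sobolevConst Ω n 4).toReal * ‖v‖ :=
    (norm_embL_le hm v).trans (mul_le_mul_of_nonneg_right (ENNReal.toReal_mono hn hmn)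
      (norm_nonneg _))
  have h3 : ‖embL Ω n 4 hn (incl Ω n w)‖ ≤ (sobolevConst Ω n 4).toReal * ‖w‖ := norm_embL_le hn _
  refine h1.trans ?_
  calc _ ≤ 1 * ((sobolevConst Ω n 4).toReal * ‖v‖) * ((sobolevConst Ω n 4).toReal * ‖w‖) := by
        gcongr
        exact norm_dyadL_le
    _ = _ := by
        rw [c1, ENNReal.toReal_pow]
        ring

attribute [irreducible] dyadOp

lemma sobolevConst_ne_top_of_c1 (hc : c1 Ω ≠ ⊤) : sobolevConst Ω n 4 ≠ ⊤ := by
  intro h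
  simp [c1, h] at hc

/-- The bilinear form behind `B_w`. -/
def flowB (hn : sobolevConst Ω n 4 ≠ ⊤) (κ₃ : ℝ) (w : H10 Ω n) : HH Ω →L[ℝ] HH Ω →L[ℝ] ℝ :=
  -pairL (devLp Ω ∘L dyadOp hn hn w ∘L incl Ω n ∘L velL Ω) (tL Ω - κ₃ • (devLp Ω ∘L σL Ω))

lemma flowB_apply (hn : sobolevConst Ω n 4 ≠ ⊤) (κ₃ : ℝ) (w : H10 Ω n) (x y : HH Ω) :
    flowB hn κ₃ w x y =
      -inner ℝ (devLp Ω (dyadOp hn hn w (incl Ω n x.vel))) (y.t - κ₃ • devLp Ω y.σ) := rfl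

attribute [irreducible] flowB

lemma formB_eq (hn : sobolevConst Ω n 4 ≠ ⊤) (κ₃ : ℝ) (w : H10 Ω n) (x y : HH Ω) :
    formB Ω κ₃ w x y = flowB hn κ₃ w x y := by
  have hr := coeFn_sub_smul κ₃ y.t (devLp Ω y.σ) EventuallyEq.rfl (coeFn_devLp _)
  have hd : devLp Ω (dyadOp hn hn w (incl Ω n x.vel)) =ᵐ[Ω.vol]
      fun ξ => dev (dyad (x.u ξ) (w.1.fst ξ)) := by
    filter_upwards [coeFn_devLp (dyadOp hn hn w (incl Ω n x.vel)),
      coeFn_dyadOp hn hn w (incl Ω n x.vel)] with ξ h1 h2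
    rw [h1, h2]
    rfl
  -- The sign is moved out so that the test field is r - κ₃τᵈ, the one estimated in `norm_test_le`.
  rw [flowB_apply, ← integral_inner_eq _ _ hd hr, formB, ← integral_neg]
  refine integral_congr_ae (Eventually.of_forall fun ξ => ?_)
  simp only [← inner_neg_right, neg_sub]

lemma abs_flowB_le (hn : sobolevConst Ω n 4 ≠ ⊤) {κ₃ : ℝ} (hκ₃ : 0 ≤ κ₃) (w : H10 Ω n)
    (x y : HH Ω) :
    |flowB hn κ₃ w x y| ≤ (c1 Ω).toReal * ‖w‖ * ‖x.vel‖ * (√(2 + κ₃ ^ 2) * ‖y‖) := by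
  rw [flowB_apply, abs_neg]
  refine (abs_real_inner_le_norm _ _).trans ?_
  have h := norm_dyadOp_le hn hn le_rfl w (incl Ω n x.vel)
  exact mul_le_mul ((norm_devLp_le _).trans h) (norm_test_le κ₃ hκ₃ y) (norm_nonneg _)
    (by positivity)

lemma flowB_sub (hn : sobolevConst Ω n 4 ≠ ⊤) (κ₃ : ℝ) (w w' : H10 Ω n) (x y : HH Ω) :
    flowB hn κ₃ (w - w') x y = flowB hn κ₃ w x y - flowB hn κ₃ w' x y := by
  simp only [flowB_apply, map_sub, sub_apply, inner_sub_left]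
  ring

/-! ### The source -/

/-- The functional `F_φ`. -/
def flowF (κ₂ : ℝ) (α : E 2) (g : E n) (φ : H1 Ω 2) : HH Ω →L[ℝ] ℝ :=
  pairL ((buoyL α g).compLpL 2 Ω.vol) (uL Ω - κ₂ • divL Ω) φ.1.fst

lemma flowF_apply (κ₂ : ℝ) (α : E 2) (g : E n) (φ : H1 Ω 2) (y : HH Ω) :
    flowF κ₂ α g φ y = inner ℝ ((buoyL α g).compLpL 2 Ω.vol φ.1.fst) (y.u - κ₂ • y.divσ) := rfl

attribute [irreducible] flowF

lemma formF_eq (κ₂ : ℝ) (α : E 2) (g : E n) (φ : H1 Ω 2) (y : HH Ω) :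
    formF Ω κ₂ α g φ y = flowF κ₂ α g φ y := by
  rw [flowF_apply, ← integral_inner_eq _ _ ((buoyL α g).coeFn_compLpL φ.1.fst)
    (coeFn_sub_smul κ₂ y.u y.divσ EventuallyEq.rfl EventuallyEq.rfl), formF]
  simp only [buoyL_apply, real_inner_smul_left]

lemma abs_flowF_le {κ₂ : ℝ} (hκ₂ : 0 ≤ κ₂) (α : E 2) (g : E n) (φ : H1 Ω 2) (y : HH Ω) :
    |flowF κ₂ α g φ y| ≤ ‖α‖ * ‖g‖ * ‖φ.1.fst‖ * (√2 * √(2 + κ₂ ^ 2) * ‖y‖) := by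
  rw [flowF_apply]
  have h1 : ‖(buoyL α g).compLpL 2 Ω.vol φ.1.fst‖ ≤ ‖α‖ * ‖g‖ * ‖φ.1.fst‖ := by
    refine Lp.norm_le_mul_norm_of_ae_le_mul ?_
    filter_upwards [(buoyL α g).coeFn_compLpL φ.1.fst] with x hx
    rw [hx]
    exact norm_buoyL_apply_le _ _ _
  have h2 : ‖y.u - κ₂ • y.divσ‖ ≤ √2 * √(2 + κ₂ ^ 2) * ‖y‖ := by
    have h3 : ‖y.u - κ₂ • y.divσ‖ ≤ κ₂ * ‖y.divσ‖ + ‖y.u‖ := by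
      refine (norm_sub_le _ _).trans ?_
      rw [norm_smul, Real.norm_eq_abs, abs_of_nonneg hκ₂, add_comm]
    refine h3.trans ((mul_add_le_sqrt (norm_nonneg y) ?_).trans ?_)
    · rw [HH.norm_sq]
      nlinarith [sq_nonneg ‖y.σ‖, sq_nonneg ‖y.t‖, sq_nonneg ‖y.gradu‖]
    -- The factor √2 ≥ 1 is surplus, inserted to match C_𝒜.
    · rw [mul_assoc]
      exact le_mul_of_one_le_left (by positivity) (Real.one_le_sqrt.2 (by norm_num))
  exact (abs_real_inner_le_norm _ _).trans (mul_le_mul h1 h2 (norm_nonneg _) (by positivity))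

lemma flowF_sub (κ₂ : ℝ) (α : E 2) (g : E n) (φ φ' : H1 Ω 2) (y : HH Ω) :
    flowF κ₂ α g (φ - φ') y = flowF κ₂ α g φ y - flowF κ₂ α g φ' y := by
  rw [flowF_apply, flowF_apply, flowF_apply, ← inner_sub_left, ← map_sub]
  rfl

/-! ### Dependence on the viscosity -/

lemma flowA_sub (M M' : L2 Ω (T n n) →L[ℝ] L2 Ω (T n n)) (γ κ₁ κ₂ κ₃ : ℝ) (x y : HH Ω) :
    flowA M γ κ₁ κ₂ κ₃ x y - flowA M' γ κ₁ κ₂ κ₃ x y =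
      2 * inner ℝ (M x.t - M' x.t) (y.t - κ₃ • devLp Ω y.σ) := by
  rw [flowA_apply, flowA_apply, inner_sub_left]
  ring

/-- The Lipschitz bound on ν holds pointwise, and Hölder's inequality separates φ - φ' from t. In
[0, ∞] no integrability beyond L² has to be known beforehand. -/
lemma enorm_viscOp_sub_le {ν : E 2 → ℝ} {Lν : ℝ} (hLν : 0 ≤ Lν)
    (hνLip : ∀ a b, |ν a - ν b| ≤ Lν * ‖a - b‖) {φ φ' : H1 Ω 2}
    (h : MemLp (viscField ν φ) ⊤ Ω.vol) (h' : MemLp (viscField ν φ') ⊤ Ω.vol)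
    (t : L2 Ω (T n n)) {p q : ℝ≥0∞} [ENNReal.HolderTriple p q 2] :
    ‖viscOp ν φ h t - viscOp ν φ' h' t‖ₑ ≤
      ENNReal.ofReal Lν * eLpNorm (φ - φ').1.fst p Ω.vol * eLpNorm t q Ω.vol := by
  have e1 : ‖viscOp ν φ h t - viscOp ν φ' h' t‖ₑ ≤
      eLpNorm (fun ξ => (Lν * ‖(φ - φ').1.fst ξ‖) • t ξ) 2 Ω.vol := by
    rw [Lp.enorm_def]
    refine eLpNorm_mono_ae ?_
    filter_upwards [Lp.coeFn_sub (viscOp ν φ h t) (viscOp ν φ' h' t), coeFn_viscOp h t,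
      coeFn_viscOp h' t, Lp.coeFn_sub φ.1.fst φ'.1.fst] with ξ h1 h2 h3 h4
    have h5 : (φ - φ').1.fst ξ = φ.1.fst ξ - φ'.1.fst ξ := h4
    rw [h1, Pi.sub_apply, h2, h3, ← sub_smul, norm_smul, norm_smul, h5]
    refine mul_le_mul_of_nonneg_right ((hνLip _ _).trans (le_of_eq ?_)) (norm_nonneg _)
    rw [Real.norm_eq_abs, abs_of_nonneg (by positivity)]
  refine e1.trans ?_
  have := eLpNorm_le_eLpNorm_mul_eLpNorm_of_nnnorm (p := p) (q := q) (r := 2) (μ := Ω.vol)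
    (Lp.aestronglyMeasurable (φ - φ').1.fst) (Lp.aestronglyMeasurable t)
    (fun a b => (Lν * ‖a‖) • b) Lν.toNNReal (Eventually.of_forall fun ξ => ?_)
  · exact this
  · rw [← NNReal.coe_le_coe]
    simp [norm_smul, abs_of_nonneg hLν, Real.coe_toNNReal _ hLν]

/-! ### The transport forms -/

/-- The field of operators `τ ↦ K τ`. -/
def diffField (k : Fin 2 → E n → ℝ) (ξ : E n) : T 2 n →L[ℝ] T 2 n := ∑ i, k i ξ • rowL 2 n i

lemma memLp_top_sum_smul {W : Type*} [NormedAddCommGroup W] [NormedSpace ℝ W]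
    {k : Fin m → E n → ℝ} (hk : ∀ i, MemLp (k i) ⊤ Ω.vol) (A : Fin m → W) :
    MemLp (fun ξ => ∑ i, k i ξ • A i) ⊤ Ω.vol := by
  have h : ∀ i, MemLp (fun ξ => k i ξ • A i) ⊤ Ω.vol := fun i =>
    (hk i).of_le_mul (c := ‖A i‖) ((hk i).1.smul_const _)
      (Eventually.of_forall fun ξ => by rw [norm_smul, mul_comm])
  exact memLp_finsetSum Finset.univ fun i _ => h i

lemma memLp_diffField {k : Fin 2 → E n → ℝ} (hk : ∀ i, MemLp (k i) ⊤ Ω.vol) :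
    MemLp (diffField k) ⊤ Ω.vol := memLp_top_sum_smul hk (rowL 2 n)

/-- The form `C` as a continuous bilinear form. -/
def transC (k : Fin 2 → E n → ℝ) (hk : MemLp (diffField k) ⊤ Ω.vol) :
    H1 Ω 2 →L[ℝ] H1 Ω 2 →L[ℝ] ℝ :=
  pairL (mulOp Ω (diffField k) hk ∘L WithLp.sndL 2 ℝ _ _ ∘L (H1 Ω 2).subtypeL)
    (WithLp.sndL 2 ℝ _ _ ∘L (H1 Ω 2).subtypeL)

lemma transC_apply (k : Fin 2 → E n → ℝ) (hk : MemLp (diffField k) ⊤ Ω.vol) (χ ψ : H1 Ω 2) :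
    transC k hk χ ψ = inner ℝ (mulOp Ω (diffField k) hk χ.1.snd) ψ.1.snd := rfl

attribute [irreducible] transC

lemma coeFn_diff {k : Fin 2 → E n → ℝ} (hk : MemLp (diffField k) ⊤ Ω.vol) (f : L2 Ω (T 2 n)) :
    mulOp Ω (diffField k) hk f =ᵐ[Ω.vol] fun ξ => diagMul (fun i => k i ξ) (f ξ) := by
  filter_upwards [coeFn_mulOp hk f] with ξ h
  rw [h, diffField, sum_smul_rowL]

lemma formC_eq {k : Fin 2 → E n → ℝ} (hk : MemLp (diffField k) ⊤ Ω.vol) (χ ψ : H1 Ω 2) :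
    formC Ω k χ ψ = transC k hk χ ψ := by
  rw [transC_apply, ← integral_inner_eq _ _ (coeFn_diff hk _) EventuallyEq.rfl, formC]

lemma normK_ne_top {k : Fin 2 → E n → ℝ} (hk : ∀ i, MemLp (k i) ⊤ Ω.vol) : normK Ω k ≠ ⊤ :=
  ((iSup_le fun i => Finset.single_le_sum (f := fun i => eLpNorm (k i) ⊤ Ω.vol)
    (fun _ _ => zero_le) (Finset.mem_univ i)).trans_lt
      (ENNReal.sum_lt_top.2 fun i _ => (hk i).2)).ne

lemma abs_transC_le {k : Fin 2 → E n → ℝ} (hk : ∀ i, MemLp (k i) ⊤ Ω.vol) (χ ψ : H1 Ω 2) :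
    |transC k (memLp_diffField hk) χ ψ| ≤ (normK Ω k).toReal * ‖χ‖ * ‖ψ‖ := by
  have h1 : ‖mulOp Ω (diffField k) (memLp_diffField hk) χ.1.snd‖ ≤
      (normK Ω k).toReal * ‖χ.1.snd‖ := by
    refine Lp.norm_le_mul_norm_of_ae_le_mul ?_
    have hb : ∀ᵐ ξ ∂Ω.vol, ∀ i, ‖k i ξ‖ₑ ≤ normK Ω k := by
      rw [ae_all_iff]
      intro i
      filter_upwards [enorm_ae_le_eLpNormEssSup (k i) Ω.vol] with ξ h
      rw [← eLpNorm_exponent_top] at h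
      exact h.trans (le_iSup (fun i => eLpNorm (k i) ⊤ Ω.vol) i)
    filter_upwards [coeFn_diff (memLp_diffField hk) χ.1.snd, hb] with ξ h2 h3
    rw [h2]
    refine norm_diagMul_le (fun i => ?_) ENNReal.toReal_nonneg _
    have := ENNReal.toReal_mono (normK_ne_top hk) (h3 i)
    rwa [toReal_enorm] at this
  rw [transC_apply]
  refine (abs_real_inner_le_norm _ _).trans ?_
  have h4 : ‖χ.1.snd‖ ≤ ‖χ‖ := norm_snd_le _
  have h5 : ‖ψ.1.snd‖ ≤ ‖ψ‖ := norm_snd_le _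
  have h6 : (0 : ℝ) ≤ (normK Ω k).toReal := ENNReal.toReal_nonneg
  calc _ ≤ (normK Ω k).toReal * ‖χ.1.snd‖ * ‖ψ.1.snd‖ := by gcongr
    _ ≤ _ := by gcongr

lemma le_transC_self {k : Fin 2 → E n → ℝ} {k₀ : ℝ} (hk : MemLp (diffField k) ⊤ Ω.vol)
    (hk₀ : ∀ᵐ x ∂Ω.vol, ∀ i, k₀ ≤ k i x) (ψ : H1 Ω 2) :
    k₀ * ‖ψ.1.snd‖ ^ 2 ≤ transC k hk ψ ψ := by
  rw [transC_apply, ← real_inner_self_eq_norm_sq, L2.inner_def, L2.inner_def,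
    ← integral_const_mul]
  refine integral_mono_ae ((L2.integrable_inner _ _).const_mul _) (L2.integrable_inner _ _) ?_
  filter_upwards [coeFn_diff hk ψ.1.snd, hk₀] with x hx hx'
  simp only [hx, real_inner_self_eq_norm_sq]
  exact le_inner_diagMul hx' _

/-- The functional `G_{w,φ}`. -/
def transG (h2 : sobolevConst Ω 2 4 ≠ ⊤) (hn : sobolevConst Ω n 4 ≠ ⊤) (w : H10 Ω n) :
    H1 Ω 2 →L[ℝ] H1 Ω 2 →L[ℝ] ℝ :=
  -pairL (WithLp.sndL 2 ℝ _ _ ∘L (H1 Ω 2).subtypeL) (dyadOp h2 hn w)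

lemma transG_apply (h2 : sobolevConst Ω 2 4 ≠ ⊤) (hn : sobolevConst Ω n 4 ≠ ⊤) (w : H10 Ω n)
    (φ ψ : H1 Ω 2) : transG h2 hn w φ ψ = -inner ℝ φ.1.snd (dyadOp h2 hn w ψ) := rfl

attribute [irreducible] transG

lemma formG_eq (h2 : sobolevConst Ω 2 4 ≠ ⊤) (hn : sobolevConst Ω n 4 ≠ ⊤) (w : H10 Ω n)
    (φ ψ : H1 Ω 2) : formG Ω w φ ψ = transG h2 hn w φ ψ := by
  rw [transG_apply, ← integral_inner_eq _ _ EventuallyEq.rfl (coeFn_dyadOp h2 hn w ψ), formG]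
  simp only [inner_tmul]

lemma abs_transG_le (h2 : sobolevConst Ω 2 4 ≠ ⊤) (hn : sobolevConst Ω n 4 ≠ ⊤)
    (hle : sobolevConst Ω 2 4 ≤ sobolevConst Ω n 4) (w : H10 Ω n) (φ ψ : H1 Ω 2) :
    |transG h2 hn w φ ψ| ≤ (c1 Ω).toReal * ‖w‖ * ‖φ‖ * ‖ψ‖ := by
  rw [transG_apply, abs_neg]
  refine (abs_real_inner_le_norm _ _).trans ?_
  have h4 : ‖φ.1.snd‖ ≤ ‖φ‖ := norm_snd_le _
  calc _ ≤ ‖φ‖ * ((c1 Ω).toReal * ‖w‖ * ‖ψ‖) :=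
        mul_le_mul h4 (norm_dyadOp_le h2 hn hle w ψ) (norm_nonneg _) (norm_nonneg _)
    _ = _ := by ring

lemma transG_sub_left (h2 : sobolevConst Ω 2 4 ≠ ⊤) (hn : sobolevConst Ω n 4 ≠ ⊤)
    (w w' : H10 Ω n) (φ ψ : H1 Ω 2) :
    transG h2 hn (w - w') φ ψ = transG h2 hn w φ ψ - transG h2 hn w' φ ψ := by
  simp only [transG_apply, map_sub, sub_apply, inner_sub_right]
  ring

end

end DoubleDiffusive

namespace DoubleDiffusive

noncomputable section

variable {n m : ℕ} {Ω : PolyhedralDomain n}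

/-! ### The decoupled flow problem -/

lemma mul_le_of_mul_sq_le {c N z : ℝ} (hN : 0 ≤ N) (hz : 0 ≤ z) (h : c * z ^ 2 ≤ N * z) :
    c * z ≤ N := by
  rcases hz.eq_or_lt with rfl | hz
  · simpa using hN
  · exact le_of_mul_le_mul_right (by linarith [h, sq z, mul_assoc c z z]) hz

/-- The form `A_φ + B_w`. -/
def flowAB (M : L2 Ω (T n n) →L[ℝ] L2 Ω (T n n)) (hn : sobolevConst Ω n 4 ≠ ⊤) (γ κ₁ κ₂ κ₃ : ℝ)
    (w : H10 Ω n) : HH Ω →L[ℝ] HH Ω →L[ℝ] ℝ :=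
  flowA M γ κ₁ κ₂ κ₃ + flowB hn κ₃ w

lemma flowAB_apply (M : L2 Ω (T n n) →L[ℝ] L2 Ω (T n n)) (hn : sobolevConst Ω n 4 ≠ ⊤)
    (γ κ₁ κ₂ κ₃ : ℝ) (w : H10 Ω n) (x y : HH Ω) : flowAB M hn γ κ₁ κ₂ κ₃ w x y =
      flowA M γ κ₁ κ₂ κ₃ x y + flowB hn κ₃ w x y := rfl

attribute [irreducible] flowAB

lemma solvesFlow_iff {ν : E 2 → ℝ} {φ : H1 Ω 2} (h : MemLp (viscField ν φ) ⊤ Ω.vol)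
    (hn : sobolevConst Ω n 4 ≠ ⊤) {γ κ₁ κ₂ κ₃ : ℝ} {α : E 2} {g : E n} {w : H10 Ω n} {x : HH Ω} :
    SolvesFlow Ω ν γ κ₁ κ₂ κ₃ α g w φ x ↔
      ∀ y, flowAB (viscOp ν φ h) hn γ κ₁ κ₂ κ₃ w x y = flowF κ₂ α g φ y := by
  refine forall_congr' fun y => Iff.of_eq (congrArg₂ (· = ·) ?_ (formF_eq κ₂ α g φ y))
  exact (congrArg₂ (· + ·) (formA_eq h γ κ₁ κ₂ κ₃ x y) (formB_eq hn κ₃ w x y)).trans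
    (flowAB_apply (viscOp ν φ h) hn γ κ₁ κ₂ κ₃ w x y).symm

lemma flowAB_sub_left (M : L2 Ω (T n n) →L[ℝ] L2 Ω (T n n)) (hn : sobolevConst Ω n 4 ≠ ⊤)
    (γ κ₁ κ₂ κ₃ : ℝ) (w : H10 Ω n) (x x' y : HH Ω) : flowAB M hn γ κ₁ κ₂ κ₃ w (x - x') y =
      flowAB M hn γ κ₁ κ₂ κ₃ w x y - flowAB M hn γ κ₁ κ₂ κ₃ w x' y :=
  ContinuousLinearMap.map_sub₂ _ _ _ _

/-- The convective term does not destroy the ellipticity for small `w`. -/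
lemma flowAB_coercive {M : L2 Ω (T n n) →L[ℝ] L2 Ω (T n n)} (hn : sobolevConst Ω n 4 ≠ ⊤)
    {γ κ₁ κ₂ κ₃ a : ℝ} (hκ₃ : 0 ≤ κ₃) (hA : ∀ x, a * ‖x‖ ^ 2 ≤ flowA M γ κ₁ κ₂ κ₃ x x)
    {w : H10 Ω n} (hw : (c1 Ω).toReal * ‖w‖ * √(2 + κ₃ ^ 2) ≤ a / 2) (x : HH Ω) :
    a / 2 * ‖x‖ ^ 2 ≤ flowAB M hn γ κ₁ κ₂ κ₃ w x x := by
  have h1 := neg_le_of_abs_le (abs_flowB_le hn hκ₃ w x x)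
  have h2 : (c1 Ω).toReal * ‖w‖ * ‖x.vel‖ * (√(2 + κ₃ ^ 2) * ‖x‖) ≤ a / 2 * ‖x‖ ^ 2 := by
    have h0 : 0 ≤ (c1 Ω).toReal := ENNReal.toReal_nonneg
    calc (c1 Ω).toReal * ‖w‖ * ‖x.vel‖ * (√(2 + κ₃ ^ 2) * ‖x‖)
        ≤ (c1 Ω).toReal * ‖w‖ * ‖x‖ * (√(2 + κ₃ ^ 2) * ‖x‖) := by
          gcongr
          exact x.norm_vel_le
      _ = (c1 Ω).toReal * ‖w‖ * √(2 + κ₃ ^ 2) * ‖x‖ ^ 2 := by ring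
      _ ≤ _ := by gcongr
  rw [flowAB_apply]
  linarith [hA x]

lemma exists_solvesFlow {ν : E 2 → ℝ} {φ : H1 Ω 2} (h : MemLp (viscField ν φ) ⊤ Ω.vol)
    (hn : sobolevConst Ω n 4 ≠ ⊤) {γ κ₁ κ₂ κ₃ a : ℝ} (α : E 2) (g : E n) {w : H10 Ω n}
    (ha : 0 < a)
    (hAB : ∀ x, a / 2 * ‖x‖ ^ 2 ≤ flowAB (viscOp ν φ h) hn γ κ₁ κ₂ κ₃ w x x) :
    ∃ x, SolvesFlow Ω ν γ κ₁ κ₂ κ₃ α g w φ x := by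
  obtain ⟨x, hx⟩ := exists_of_coercive (V := HH Ω) (flowAB (viscOp ν φ h) hn γ κ₁ κ₂ κ₃ w)
    (flowF κ₂ α g φ) (half_pos ha) hAB
  exact ⟨x, (solvesFlow_iff h hn).2 hx⟩

/-- The solution is tested with itself; the factor 2 in C_𝒜 comes from the ellipticity constant
α(Ω)/2. -/
lemma norm_le_of_solvesFlow {ν : E 2 → ℝ} {φ : H1 Ω 2} (h : MemLp (viscField ν φ) ⊤ Ω.vol)
    (hn : sobolevConst Ω n 4 ≠ ⊤) {γ κ₁ κ₂ κ₃ a : ℝ} {α : E 2} {g : E n} {w : H10 Ω n}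
    (ha : 0 < a) (hκ₂ : 0 ≤ κ₂)
    (hAB : ∀ x, a / 2 * ‖x‖ ^ 2 ≤ flowAB (viscOp ν φ h) hn γ κ₁ κ₂ κ₃ w x x) {x : HH Ω}
    (hx : SolvesFlow Ω ν γ κ₁ κ₂ κ₃ α g w φ x) :
    ‖x‖ ≤ CA a κ₂ * (‖α‖ * ‖g‖) * ‖φ.1.fst‖ := by
  have h1 := hAB x
  rw [(solvesFlow_iff h hn).1 hx x] at h1
  have h2 := h1.trans (le_of_abs_le (abs_flowF_le hκ₂ α g φ x))
  rw [← mul_assoc] at h2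
  have h3 := mul_le_of_mul_sq_le (by positivity) (norm_nonneg x) h2
  rw [CA, div_mul_eq_mul_div, div_mul_eq_mul_div, le_div_iff₀ ha]
  linarith

-- With z = x - x', (A_φ + B_w)(z, z) = F_{φ-φ'}(z) - (A_φ - A_{φ'})(x', z) - B_{w-w'}(x', z). The
-- change of viscosity meets only t', so regularity is needed for one of the two solutions.
set_option maxHeartbeats 1000000 in
lemma norm_sub_le_of_solvesFlow {ν : E 2 → ℝ} {φ φ' : H1 Ω 2}
    (h : MemLp (viscField ν φ) ⊤ Ω.vol) (h' : MemLp (viscField ν φ') ⊤ Ω.vol)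
    (hn : sobolevConst Ω n 4 ≠ ⊤) {γ κ₁ κ₂ κ₃ a : ℝ} {α : E 2} {g : E n} {w w' : H10 Ω n}
    (hκ₂ : 0 ≤ κ₂) (hκ₃ : 0 ≤ κ₃)
    (hAB : ∀ x, a / 2 * ‖x‖ ^ 2 ≤ flowAB (viscOp ν φ h) hn γ κ₁ κ₂ κ₃ w x x) {x x' : HH Ω}
    (hx : SolvesFlow Ω ν γ κ₁ κ₂ κ₃ α g w φ x) (hx' : SolvesFlow Ω ν γ κ₁ κ₂ κ₃ α g w' φ' x') :
    a / 2 * ‖x - x'‖ ≤ ‖α‖ * ‖g‖ * ‖φ - φ'‖ * (√2 * √(2 + κ₂ ^ 2))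
      + 2 * (‖viscOp ν φ h x'.t - viscOp ν φ' h' x'.t‖ * √(2 + κ₃ ^ 2))
      + (c1 Ω).toReal * ‖w - w'‖ * ‖x'.vel‖ * √(2 + κ₃ ^ 2) := by
  set z := x - x'
  have e1 := (solvesFlow_iff h hn).1 hx z
  have e2 := (solvesFlow_iff h' hn).1 hx' z
  have e3 : flowAB (viscOp ν φ h) hn γ κ₁ κ₂ κ₃ w z z =
      flowAB (viscOp ν φ h) hn γ κ₁ κ₂ κ₃ w x z - flowAB (viscOp ν φ h) hn γ κ₁ κ₂ κ₃ w x' z :=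
    flowAB_sub_left (viscOp ν φ h) hn γ κ₁ κ₂ κ₃ w x x' z
  have e4 := flowA_sub (viscOp ν φ h) (viscOp ν φ' h') γ κ₁ κ₂ κ₃ x' z
  have e5 := flowB_sub hn κ₃ w w' x' z
  have e6 := flowF_sub κ₂ α g φ φ' z
  have b1 := le_of_abs_le (abs_flowF_le hκ₂ α g (φ - φ') z)
  have b2 := neg_le_of_abs_le (abs_flowB_le hn hκ₃ (w - w') x' z)
  have b3 : -(‖viscOp ν φ h x'.t - viscOp ν φ' h' x'.t‖ * (√(2 + κ₃ ^ 2) * ‖z‖)) ≤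
      inner ℝ (viscOp ν φ h x'.t - viscOp ν φ' h' x'.t) (z.t - κ₃ • devLp Ω z.σ) :=
    (neg_le_neg (mul_le_mul_of_nonneg_left (norm_test_le κ₃ hκ₃ z) (norm_nonneg _))).trans
      (neg_le_of_abs_le (abs_real_inner_le_norm _ _))
  have b4 : ‖α‖ * ‖g‖ * ‖(φ - φ').1.fst‖ * (√2 * √(2 + κ₂ ^ 2) * ‖z‖) ≤
      ‖α‖ * ‖g‖ * ‖φ - φ'‖ * (√2 * √(2 + κ₂ ^ 2) * ‖z‖) := by
    gcongr
    exact norm_fst_le _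
  refine mul_le_of_mul_sq_le (by positivity) (norm_nonneg z) ?_
  have hc := hAB z
  have e7 := flowAB_apply (viscOp ν φ h) hn γ κ₁ κ₂ κ₃ w x' z
  have e8 := flowAB_apply (viscOp ν φ' h') hn γ κ₁ κ₂ κ₃ w' x' z
  linarith

lemma ofReal_flow_bound {a d f b V s c W U N : ℝ} (ha : 0 ≤ a) (hd : 0 ≤ d) (hf : 0 ≤ f)
    (hb : 0 ≤ b) (hV : 0 ≤ V) (hs : 0 ≤ s) (hc : 0 ≤ c) (hW : 0 ≤ W) (hU : 0 ≤ U)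
    (h : a / 2 * N ≤ d * f * b + 2 * (V * s) + c * W * U * s) :
    ENNReal.ofReal (a / 2) * ENNReal.ofReal N ≤
      ENNReal.ofReal d * ENNReal.ofReal f * ENNReal.ofReal b
      + 2 * (ENNReal.ofReal V * ENNReal.ofReal s)
      + ENNReal.ofReal c * ENNReal.ofReal W * ENNReal.ofReal U * ENNReal.ofReal s := by
  have h2 := ENNReal.ofReal_le_ofReal h
  rwa [ENNReal.ofReal_mul (by positivity), ENNReal.ofReal_add (by positivity) (by positivity),
    ENNReal.ofReal_add (by positivity) (by positivity), ENNReal.ofReal_mul (by positivity),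
    ENNReal.ofReal_mul hd, ENNReal.ofReal_mul (p := 2) (by positivity),
    ENNReal.ofReal_mul hV, ENNReal.ofReal_mul (p := c * W * U) (by positivity),
    ENNReal.ofReal_mul (p := c * W) (by positivity), ENNReal.ofReal_mul hc,
    show ENNReal.ofReal 2 = 2 by simp] at h2

/-- The arithmetic of the Lipschitz estimate for the flow problem. -/
lemma lipschitz_arith {a d r A Lν Chat b s : ℝ} {c C C' N F W V : ℝ≥0∞} (ha : 0 < a)
    (hr : 0 ≤ r) (hChat : 0 ≤ Chat) (hLν : 0 ≤ Lν) (hd : 0 ≤ d) (hA : 0 ≤ A)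
    (hV : V ≤ ENNReal.ofReal Lν * (C' * F) * (C * ENNReal.ofReal (Chat * d * r)))
    (key : ENNReal.ofReal (a / 2) * N ≤ ENNReal.ofReal d * F * ENNReal.ofReal b
      + 2 * (V * ENNReal.ofReal s) + c * W * ENNReal.ofReal (r * A * d) * ENNReal.ofReal s) :
    N ≤ ENNReal.ofReal (2 / a) * max (c * ENNReal.ofReal s)
        (max (ENNReal.ofReal (2 * Lν * s) * C) (ENNReal.ofReal b)) * ENNReal.ofReal d *
      (ENNReal.ofReal (r * A) * W + (ENNReal.ofReal r * C' * ENNReal.ofReal Chat + 1) * F) := by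
  have hainv : ENNReal.ofReal (2 / a) * ENNReal.ofReal (a / 2) = 1 := by
    rw [← ENNReal.ofReal_mul (by positivity)]
    simp [ha.ne']
  have hle : N ≤ ENNReal.ofReal (2 / a) * (ENNReal.ofReal (a / 2) * N) := by
    rw [← mul_assoc, hainv, one_mul]
  refine hle.trans ?_
  rw [mul_assoc, mul_assoc]
  gcongr ENNReal.ofReal (2 / a) * ?_
  refine key.trans ?_
  set X₁ := c * ENNReal.ofReal s with hX₁
  set X₂ := ENNReal.ofReal (2 * Lν * s) * C with hX₂
  set X₃ := ENNReal.ofReal b with hX₃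
  -- Each summand is charged to its own entry of the maximum in L_𝒜: convection to X₁, viscosity to
  -- X₂, source to X₃.
  have m1 : X₁ ≤ max X₁ (max X₂ X₃) := le_max_left _ _
  have m2 : X₂ ≤ max X₁ (max X₂ X₃) := (le_max_left _ _).trans (le_max_right _ _)
  have m3 : X₃ ≤ max X₁ (max X₂ X₃) := (le_max_right _ _).trans (le_max_right _ _)
  have s2 : 2 * (V * ENNReal.ofReal s) ≤ X₂ * (ENNReal.ofReal d *
      (ENNReal.ofReal r * C' * ENNReal.ofReal Chat * F)) := by
    calc _ ≤ 2 * (ENNReal.ofReal Lν * (C' * F) *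
          (C * ENNReal.ofReal (Chat * d * r)) * ENNReal.ofReal s) := by gcongr
      _ = _ := by
        rw [hX₂, ENNReal.ofReal_mul (by positivity), ENNReal.ofReal_mul (by positivity),
          ENNReal.ofReal_mul (by positivity), ENNReal.ofReal_mul (by positivity),
          show ENNReal.ofReal 2 = 2 by simp]
        ring
  have s3 : c * W * ENNReal.ofReal (r * A * d) * ENNReal.ofReal s =
      X₁ * (ENNReal.ofReal d * (ENNReal.ofReal (r * A) * W)) := by
    rw [hX₁, ENNReal.ofReal_mul (by positivity)]
    ring
  have s1 : ENNReal.ofReal d * F * X₃ = X₃ * (ENNReal.ofReal d * F) := by ring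
  rw [s3, s1]
  generalize max X₁ (max X₂ X₃) = X at m1 m2 m3 ⊢
  calc _ ≤ X * (ENNReal.ofReal d * F) + X * (ENNReal.ofReal d *
      (ENNReal.ofReal r * C' * ENNReal.ofReal Chat * F)) +
      X * (ENNReal.ofReal d * (ENNReal.ofReal (r * A) * W)) := by
        refine add_le_add (add_le_add ?_ (s2.trans ?_)) ?_ <;> gcongr
    _ = _ := by ring

/-- The effect of the viscosity on `ε`-regular fields. -/
lemma ofReal_norm_viscOp_sub_le {ν : E 2 → ℝ} {Lν : ℝ} (hLν : 0 ≤ Lν)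
    (hνLip : ∀ a b, |ν a - ν b| ≤ Lν * ‖a - b‖) {φ φ' : H1 Ω 2}
    (h : MemLp (viscField ν φ) ⊤ Ω.vol) (h' : MemLp (viscField ν φ') ⊤ Ω.vol)
    {ε R : ℝ} (hε : 0 < ε) (hεn : 2 * ε < n) {t : L2 Ω (T n n)}
    (hreg : fracNorm ε t ≤ ENNReal.ofReal R) :
    ENNReal.ofReal ‖viscOp ν φ h t - viscOp ν φ' h' t‖ ≤
      ENNReal.ofReal Lν * (Ceps' Ω ε * ENNReal.ofReal ‖φ - φ'‖) *
        (Ceps Ω ε * ENNReal.ofReal R) := by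
  have hn0 : (0 : ℝ) < n := by linarith
  -- ε/n + (n - 2ε)/(2n) = 1/2.
  have : ENNReal.HolderTriple (ENNReal.ofReal (n / ε))
      (ENNReal.ofReal (2 * n / (n - 2 * ε))) 2 := ⟨by
    have h1 : (0 : ℝ) < n / ε := by positivity
    have h2 : (0 : ℝ) < 2 * n / (n - 2 * ε) := div_pos (by positivity) (by linarith)
    rw [← ENNReal.ofReal_inv_of_pos h1, ← ENNReal.ofReal_inv_of_pos h2,
      ← ENNReal.ofReal_add (by positivity) (by positivity),
      show (2 : ℝ≥0∞) = ENNReal.ofReal 2 by simp, ← ENNReal.ofReal_inv_of_pos two_pos]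
    congr 1
    field_simp
    ring⟩
  rw [ofReal_norm, ofReal_norm]
  refine (enorm_viscOp_sub_le hLν hνLip h h' t (p := ENNReal.ofReal (n / ε))
    (q := ENNReal.ofReal (2 * n / (n - 2 * ε)))).trans ?_
  refine mul_le_mul' (mul_le_mul' le_rfl (eLpNorm_le_sobolevConst _ _)) ?_
  exact (eLpNorm_le_Ceps (hreg.trans_lt ENNReal.ofReal_lt_top).ne).trans
    (mul_le_mul' le_rfl hreg)

/-- Lipschitz continuity of the flow solution operator. -/
lemma ofReal_norm_sub_le_of_solvesFlow {ν : E 2 → ℝ} {Lν : ℝ} (hLν : 0 ≤ Lν)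
    (hνLip : ∀ a b, |ν a - ν b| ≤ Lν * ‖a - b‖) {φ φ' : H1 Ω 2}
    (h : MemLp (viscField ν φ) ⊤ Ω.vol) (h' : MemLp (viscField ν φ') ⊤ Ω.vol)
    (hc : c1 Ω ≠ ⊤) (hn : sobolevConst Ω n 4 ≠ ⊤) {γ κ₁ κ₂ κ₃ a r ε Chat : ℝ} {α : E 2} {g : E n}
    {w w' : H10 Ω n} (ha : 0 < a) (hr : 0 ≤ r) (hChat : 0 ≤ Chat) (hκ₂ : 0 ≤ κ₂) (hκ₃ : 0 ≤ κ₃)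
    (hε : 0 < ε) (hεn : 2 * ε < n)
    (hAB : ∀ x, a / 2 * ‖x‖ ^ 2 ≤ flowAB (viscOp ν φ h) hn γ κ₁ κ₂ κ₃ w x x) {x x' : HH Ω}
    (hx : SolvesFlow Ω ν γ κ₁ κ₂ κ₃ α g w φ x) (hx' : SolvesFlow Ω ν γ κ₁ κ₂ κ₃ α g w' φ' x')
    (hreg : fracNorm ε x'.t ≤ ENNReal.ofReal (Chat * (‖α‖ * ‖g‖) * r))
    (hbd : ‖x'.vel‖ ≤ r * CA a κ₂ * (‖α‖ * ‖g‖)) :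
    ENNReal.ofReal ‖x - x'‖ ≤ LA Ω a Lν κ₂ κ₃ ε * ENNReal.ofReal (‖α‖ * ‖g‖) *
      (ENNReal.ofReal (r * CA a κ₂) * ENNReal.ofReal ‖w - w'‖ +
        (ENNReal.ofReal r * Ceps' Ω ε * ENNReal.ofReal Chat + 1) *
          ENNReal.ofReal ‖φ - φ'‖) := by
  have hd0 : 0 ≤ ‖α‖ * ‖g‖ := mul_nonneg (norm_nonneg _) (norm_nonneg _)
  have hCA : 0 ≤ CA a κ₂ := by unfold CA; positivity
  have hcr : 0 ≤ (c1 Ω).toReal := ENNReal.toReal_nonneg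
  have h0 := norm_sub_le_of_solvesFlow h h' hn hκ₂ hκ₃ hAB hx hx'
  have h1 : (c1 Ω).toReal * ‖w - w'‖ * ‖x'.vel‖ * √(2 + κ₃ ^ 2) ≤
      (c1 Ω).toReal * ‖w - w'‖ * (r * CA a κ₂ * (‖α‖ * ‖g‖)) * √(2 + κ₃ ^ 2) :=
    mul_le_mul_of_nonneg_right (mul_le_mul_of_nonneg_left hbd
      (mul_nonneg hcr (norm_nonneg _))) (Real.sqrt_nonneg _)
  have h2 := ofReal_flow_bound ha.le hd0 (norm_nonneg _)
    (mul_nonneg (Real.sqrt_nonneg _) (Real.sqrt_nonneg _)) (norm_nonneg _)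
    (Real.sqrt_nonneg _) hcr (norm_nonneg _) (mul_nonneg (mul_nonneg hr hCA) hd0)
    (h0.trans (add_le_add le_rfl h1))
  rw [ENNReal.ofReal_toReal hc] at h2
  exact lipschitz_arith ha hr hChat hLν hd0 hCA
    (ofReal_norm_viscOp_sub_le hLν hνLip h h' hε hεn hreg) h2

/-! ### The decoupled transport problem -/

lemma cgp_ne_top {ΓD : Set (E n)} {k₀ : ℝ} (h : ellC Ω ΓD k₀ ≠ 0) : cgp Ω ΓD ≠ ⊤ := by
  intro h'
  simp [ellC, h'] at h

/-- Ellipticity of `C` on `H¹_{Γ_D}(Ω)`. -/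
lemma norm_sq_le_transC {ΓD : Set (E n)} {k : Fin 2 → E n → ℝ} {k₀ : ℝ} (hk₀ : 0 < k₀)
    (hkd : MemLp (diffField k) ⊤ Ω.vol) (hk : ∀ᵐ x ∂Ω.vol, ∀ i, k₀ ≤ k i x)
    (hell : ellC Ω ΓD k₀ ≠ 0) {ψ : H1 Ω 2} (hψ : ψ ∈ H1D Ω ΓD) :
    ‖ψ‖ ^ 2 ≤ ((ellC Ω ΓD k₀)⁻¹).toReal * transC k hkd ψ ψ := by
  have hc := cgp_ne_top hell
  have h1 : ‖ψ‖ ≤ (cgp Ω ΓD).toReal * ‖ψ.1.snd‖ := by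
    have := ENNReal.toReal_mono (ENNReal.mul_ne_top hc (by simp)) (enorm_le_cgp hψ hc)
    rwa [ENNReal.toReal_mul, toReal_enorm, toReal_enorm] at this
  have h2 : ((ellC Ω ΓD k₀)⁻¹).toReal = (cgp Ω ΓD).toReal ^ 2 / k₀ := by
    rw [ellC, ENNReal.toReal_inv, ENNReal.toReal_div, ENNReal.toReal_ofReal hk₀.le,
      ENNReal.toReal_pow, inv_div]
  rw [h2]
  calc ‖ψ‖ ^ 2 ≤ ((cgp Ω ΓD).toReal * ‖ψ.1.snd‖) ^ 2 := by gcongr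
    _ = (cgp Ω ΓD).toReal ^ 2 / k₀ * (k₀ * ‖ψ.1.snd‖ ^ 2) := by
      field_simp
    _ ≤ _ := by
      gcongr
      exact le_transC_self hkd hk ψ

/-- Lax–Milgram on H¹_{Γ_D} for χ - φe, with φe any extension of the datum. The convective term
carries the old φ, so it belongs to the given functional G and ellipticity of C alone suffices. -/
lemma exists_transport {ΓD : Set (E n)} {k : Fin 2 → E n → ℝ} {k₀ : ℝ} (hk₀ : 0 < k₀)
    (hkd : MemLp (diffField k) ⊤ Ω.vol) (hk : ∀ᵐ x ∂Ω.vol, ∀ i, k₀ ≤ k i x)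
    (hell : ellC Ω ΓD k₀ ≠ 0) {φD : Lp (E 2) 2 (surf ΓD)} (hφD : φD ∈ HHalf Ω ΓD)
    (G : H1 Ω 2 →L[ℝ] ℝ) :
    ∃ χ : H1 Ω 2, HasTrace χ φD ∧ ∀ ψ ∈ H1D Ω ΓD, transC k hkd χ ψ = G ψ := by
  obtain ⟨φe, hφe⟩ := hφD
  have hβ : 0 ≤ ((ellC Ω ΓD k₀)⁻¹).toReal := ENNReal.toReal_nonneg
  -- The inverse ellipticity constant could be 0 in `toReal` form; adding 1 keeps the coercivity
  -- constant well defined and positive.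
  obtain ⟨v, hvS, hv⟩ := exists_mem_of_coercive (transC k hkd) (G - transC k hkd φe) (H1Dsub Ω ΓD)
    (isClosed_H1D ΓD) (c := 1 / (((ellC Ω ΓD k₀)⁻¹).toReal + 1)) (by positivity)
    (fun v hv => by
      have h1 := norm_sq_le_transC hk₀ hkd hk hell hv
      have h2 : 0 ≤ transC k hkd v v :=
        (by positivity : 0 ≤ k₀ * ‖v.1.snd‖ ^ 2).trans (le_transC_self hkd hk v)
      rw [one_div, inv_mul_le_iff₀ (by positivity)]
      linarith)
  refine ⟨v + φe, ?_, fun ψ hψ => ?_⟩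
  · have := HasTrace.add (show HasTrace v _ from hvS) hφe
    rwa [zero_add] at this
  · have h1 : transC k hkd v ψ = G ψ - transC k hkd φe ψ := hv ψ hψ
    rw [ContinuousLinearMap.map_add₂, h1]
    ring

lemma norm_le_of_transC {ΓD : Set (E n)} {k : Fin 2 → E n → ℝ} {k₀ : ℝ} (hk₀ : 0 < k₀)
    (hkd : MemLp (diffField k) ⊤ Ω.vol) (hk : ∀ᵐ x ∂Ω.vol, ∀ i, k₀ ≤ k i x)
    (hell : ellC Ω ΓD k₀ ≠ 0) {ψ : H1 Ω 2} (hψ : ψ ∈ H1D Ω ΓD) {N : ℝ} (hN : 0 ≤ N)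
    (h : transC k hkd ψ ψ ≤ N * ‖ψ‖) : ‖ψ‖ ≤ ((ellC Ω ΓD k₀)⁻¹).toReal * N := by
  have h1 := norm_sq_le_transC hk₀ hkd hk hell hψ
  have hβ : 0 ≤ ((ellC Ω ΓD k₀)⁻¹).toReal := ENNReal.toReal_nonneg
  have h2 := h1.trans (mul_le_mul_of_nonneg_left h hβ)
  have := mul_le_of_mul_sq_le (c := 1) (mul_nonneg hβ hN) (norm_nonneg ψ)
    (by rw [one_mul, mul_assoc]; exact h2)
  rwa [one_mul] at this

lemma CB_toReal {ΓD : Set (E n)} {k : Fin 2 → E n → ℝ} {k₀ : ℝ} (hell : ellC Ω ΓD k₀ ≠ 0)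
    (hc : c1 Ω ≠ ⊤) (hk : ∀ i, MemLp (k i) ⊤ Ω.vol) :
    CB Ω ΓD k k₀ ≠ ⊤ ∧
    (CB Ω ΓD k k₀).toReal = max (((ellC Ω ΓD k₀)⁻¹).toReal * (c1 Ω).toReal)
      (((ellC Ω ΓD k₀)⁻¹).toReal * (normK Ω k).toReal + 1) := by
  have h1 : (ellC Ω ΓD k₀)⁻¹ * c1 Ω ≠ ⊤ := ENNReal.mul_ne_top (by simpa using hell) hc
  have h2 : (ellC Ω ΓD k₀)⁻¹ * normK Ω k ≠ ⊤ :=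
    ENNReal.mul_ne_top (by simpa using hell) (normK_ne_top hk)
  have h3 : (ellC Ω ΓD k₀)⁻¹ * normK Ω k + 1 ≠ ⊤ := ENNReal.add_ne_top.2 ⟨h2, by simp⟩
  refine ⟨(max_lt h1.lt_top h3.lt_top).ne, ?_⟩
  rw [CB, ENNReal.toReal_max h1 h3, ENNReal.toReal_add h2 (by simp), ENNReal.toReal_mul,
    ENNReal.toReal_mul, ENNReal.toReal_one]

/-- A priori bound for the transport problem. -/
lemma norm_le_of_transport {ΓD : Set (E n)} {k : Fin 2 → E n → ℝ} {k₀ : ℝ} (hk₀ : 0 < k₀)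
    (hkinf : ∀ i, MemLp (k i) ⊤ Ω.vol) (hk : ∀ᵐ x ∂Ω.vol, ∀ i, k₀ ≤ k i x)
    (hell : ellC Ω ΓD k₀ ≠ 0) (hc : c1 Ω ≠ ⊤) (h2 : sobolevConst Ω 2 4 ≠ ⊤)
    (hn : sobolevConst Ω n 4 ≠ ⊤) (hle : sobolevConst Ω 2 4 ≤ sobolevConst Ω n 4)
    {φD : Lp (E 2) 2 (surf ΓD)} (hφD : φD ∈ HHalf Ω ΓD) {w : H10 Ω n} {φ χ : H1 Ω 2}
    (hχ : HasTrace χ φD)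
    (hsol : ∀ ψ ∈ H1D Ω ΓD, transC k (memLp_diffField hkinf) χ ψ = transG h2 hn w φ ψ) :
    ‖χ‖ ≤ (CB Ω ΓD k k₀).toReal * (‖w‖ * ‖φ‖ + halfNorm Ω φD) := by
  obtain ⟨-, hCB⟩ := CB_toReal hell hc hkinf
  set β := ((ellC Ω ΓD k₀)⁻¹).toReal with hβdef
  have hβ : 0 ≤ β := ENNReal.toReal_nonneg
  have hK : 0 ≤ (normK Ω k).toReal := ENNReal.toReal_nonneg
  have hc0 : 0 ≤ (c1 Ω).toReal := ENNReal.toReal_nonneg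
  set CBr := (CB Ω ΓD k k₀).toReal with hCBr
  have hm1 : β * (c1 Ω).toReal ≤ CBr := by rw [hCB]; exact le_max_left _ _
  have hm2 : β * (normK Ω k).toReal + 1 ≤ CBr := by rw [hCB]; exact le_max_right _ _
  have hpos : 0 < CBr := by nlinarith [mul_nonneg hβ hK]
  have hb : ∀ φe : H1 Ω 2, HasTrace φe φD → ‖χ‖ ≤ CBr * (‖w‖ * ‖φ‖ + ‖φe‖) := by
    intro φe hφe
    have hz : χ - φe ∈ H1D Ω ΓD := hχ.sub_mem hφe
    have h1 : transC k (memLp_diffField hkinf) (χ - φe) (χ - φe) ≤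
        ((c1 Ω).toReal * ‖w‖ * ‖φ‖ + (normK Ω k).toReal * ‖φe‖) * ‖χ - φe‖ := by
      have e1 : transC k (memLp_diffField hkinf) (χ - φe) (χ - φe) =
          transC k (memLp_diffField hkinf) χ (χ - φe)
            - transC k (memLp_diffField hkinf) φe (χ - φe) := by
        rw [ContinuousLinearMap.map_sub₂]
      rw [e1, hsol _ hz]
      have b1 := le_of_abs_le (abs_transG_le h2 hn hle w φ (χ - φe))
      have b2 := neg_le_of_abs_le (abs_transC_le hkinf φe (χ - φe))
      linarith
    have h3 := norm_le_of_transC hk₀ (memLp_diffField hkinf) hk hell hz (by positivity) h1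
    -- Undoing the lifting produces the summand + 1 in C_ℬ.
    have h4 : ‖χ‖ ≤ ‖χ - φe‖ + ‖φe‖ := by simpa using norm_add_le (χ - φe) φe
    have h5 : β * (c1 Ω).toReal * (‖w‖ * ‖φ‖) ≤ CBr * (‖w‖ * ‖φ‖) := by gcongr
    have h6 : (β * (normK Ω k).toReal + 1) * ‖φe‖ ≤ CBr * ‖φe‖ := by gcongr
    linarith
  -- The bound holds for every extension φe, hence for the infimum of their norms; its attainment is
  -- not needed.
  rw [← div_le_iff₀' hpos, ← sub_le_iff_le_add']
  obtain ⟨φe, hφe⟩ := hφD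
  refine le_csInf ⟨_, φe, hφe, rfl⟩ ?_
  rintro _ ⟨φe, hφe, rfl⟩
  rw [sub_le_iff_le_add', div_le_iff₀' hpos]
  exact hb φe hφe

/-- Lipschitz continuity of the transport solution operator. -/
lemma norm_sub_le_of_transport {ΓD : Set (E n)} {k : Fin 2 → E n → ℝ} {k₀ r : ℝ} (hk₀ : 0 < k₀)
    (hkd : MemLp (diffField k) ⊤ Ω.vol) (hk : ∀ᵐ x ∂Ω.vol, ∀ i, k₀ ≤ k i x)
    (hell : ellC Ω ΓD k₀ ≠ 0) (h2 : sobolevConst Ω 2 4 ≠ ⊤)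
    (hn : sobolevConst Ω n 4 ≠ ⊤) (hle : sobolevConst Ω 2 4 ≤ sobolevConst Ω n 4)
    {φD : Lp (E 2) 2 (surf ΓD)} {w w' : H10 Ω n} {φ φ' χ χ' : H1 Ω 2}
    (hr : 0 ≤ r) (hφ : ‖φ‖ ≤ r) (hw' : ‖w'‖ ≤ r)
    (hχ : HasTrace χ φD) (hχ' : HasTrace χ' φD)
    (hsol : ∀ ψ ∈ H1D Ω ΓD, transC k hkd χ ψ = transG h2 hn w φ ψ)
    (hsol' : ∀ ψ ∈ H1D Ω ΓD, transC k hkd χ' ψ = transG h2 hn w' φ' ψ) :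
    ‖χ - χ'‖ ≤ ((ellC Ω ΓD k₀)⁻¹).toReal * (r * (c1 Ω).toReal * (‖w - w'‖ + ‖φ - φ'‖)) := by
  have hc0 : 0 ≤ (c1 Ω).toReal := ENNReal.toReal_nonneg
  have hz : χ - χ' ∈ H1D Ω ΓD := hχ.sub_mem hχ'
  refine norm_le_of_transC hk₀ hkd hk hell hz (by positivity) ?_
  have e1 : transC k hkd (χ - χ') (χ - χ') =
      transC k hkd χ (χ - χ') - transC k hkd χ' (χ - χ') := by
    rw [ContinuousLinearMap.map_sub₂]
  -- G_{w,φ} - G_{w',φ'} = G_{w-w',φ} + G_{w',φ-φ'}, so only φ and w' need the bound r.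
  have e2 := transG_sub_left h2 hn w w' φ (χ - χ')
  have e3 : transG h2 hn w' (φ - φ') (χ - χ') =
      transG h2 hn w' φ (χ - χ') - transG h2 hn w' φ' (χ - χ') := by
    rw [ContinuousLinearMap.map_sub₂]
  have b1 := le_of_abs_le (abs_transG_le h2 hn hle (w - w') φ (χ - χ'))
  have b2 := le_of_abs_le (abs_transG_le h2 hn hle w' (φ - φ') (χ - χ'))
  have b3 : (c1 Ω).toReal * ‖w - w'‖ * ‖φ‖ * ‖χ - χ'‖ ≤
      (c1 Ω).toReal * ‖w - w'‖ * r * ‖χ - χ'‖ := by gcongr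
  have b4 : (c1 Ω).toReal * ‖w'‖ * ‖φ - φ'‖ * ‖χ - χ'‖ ≤
      (c1 Ω).toReal * r * ‖φ - φ'‖ * ‖χ - χ'‖ := by gcongr
  rw [e1, hsol _ hz, hsol' _ hz]
  linarith

end

end DoubleDiffusive

namespace DoubleDiffusive

noncomputable section

variable {n : ℕ} {Ω : PolyhedralDomain n}

/-! ### Coupling -/

/-- W, F are the distances of the old pair and U, X of the new one. The transport sees the new
velocity, hence U rather than W in `hX`; the resulting factor is L_Lip, with R = rC_𝒜, A = L_𝒜, D =
|α||g|, L = L_ℬ and Q = rC̃_εĈ(r) + 1. -/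
lemma contraction_arith {U X W F R Q A D L : ℝ≥0∞} (hU : U ≤ A * D * (R * W + Q * F))
    (hX : X ≤ L * (U + F)) :
    U + X ≤ (R * (1 + L) * A * D + (1 + L) * A * D * Q + L) * (W + F) := by
  calc U + X ≤ U + L * (U + F) := by gcongr
    _ = (1 + L) * U + L * F := by ring
    _ ≤ (1 + L) * (A * D * (R * W + Q * F)) + L * F := by gcongr
    _ = R * (1 + L) * A * D * W + ((1 + L) * A * D * Q + L) * F := by ring
    _ ≤ (R * (1 + L) * A * D + (1 + L) * A * D * Q + L) * W
        + (R * (1 + L) * A * D + (1 + L) * A * D * Q + L) * F := by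
      gcongr
      · rw [add_assoc]
        exact le_self_add
      · exact le_add_self
    _ = _ := by ring

lemma add_le_toReal_mul_add {u x w f : ℝ} {L : ℝ≥0∞} (hu : 0 ≤ u) (hx : 0 ≤ x) (hw : 0 ≤ w)
    (hf : 0 ≤ f) (hL : L ≠ ⊤)
    (h : ENNReal.ofReal u + ENNReal.ofReal x ≤ L * (ENNReal.ofReal w + ENNReal.ofReal f)) :
    u + x ≤ L.toReal * (w + f) := by
  rw [← ENNReal.ofReal_add hu hx, ← ENNReal.ofReal_add hw hf] at h
  have h' := ENNReal.toReal_mono (ENNReal.mul_ne_top hL ENNReal.ofReal_ne_top) h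
  rwa [ENNReal.toReal_mul, ENNReal.toReal_ofReal (add_nonneg hu hx),
    ENNReal.toReal_ofReal (add_nonneg hw hf)] at h'

lemma halfNorm_nonneg {ΓD : Set (E n)} (φD : Lp (E 2) 2 (surf ΓD)) : 0 ≤ halfNorm Ω φD := by
  refine Real.sInf_nonneg ?_
  rintro _ ⟨φ, -, rfl⟩
  exact norm_nonneg _

/-- `ENNReal.ofReal` truncates at 0, so r₀ = 0 when a ≤ 0. -/
lemma pos_of_lt_r0 {a κ₃ : ℝ} {r : ℝ≥0∞} (h : r < r0 Ω a κ₃) : 0 < a := by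
  by_contra hcon
  rw [r0, ENNReal.ofReal_of_nonpos (not_lt.1 hcon), ENNReal.zero_div] at h
  exact not_lt_zero h

lemma c1_ne_top_of_lt_r0 {a κ₃ : ℝ} {r : ℝ≥0∞} (h : r < r0 Ω a κ₃) : c1 Ω ≠ ⊤ := by
  intro hc
  have : (0 : ℝ) < √(2 + κ₃ ^ 2) := by positivity
  rw [r0, hc, ENNReal.mul_top two_ne_zero, ENNReal.top_mul (by simpa using this),
    ENNReal.div_top] at h
  exact not_lt_zero h

lemma mul_le_of_lt_r0 {a κ₃ r : ℝ} (hr : 0 ≤ r) (h : ENNReal.ofReal r < r0 Ω a κ₃) :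
    (c1 Ω).toReal * r * √(2 + κ₃ ^ 2) ≤ a / 2 := by
  have h1 := ENNReal.mul_lt_of_lt_div h
  have h2 := ENNReal.toReal_mono ENNReal.ofReal_ne_top h1.le
  rw [ENNReal.toReal_ofReal (pos_of_lt_r0 h).le] at h2
  simp only [ENNReal.toReal_mul, ENNReal.toReal_ofReal hr, ENNReal.toReal_ofNat,
    ENNReal.toReal_ofReal (Real.sqrt_nonneg _)] at h2
  linarith

/-- L_ℬ has the nonzero numerator r c₁, so a zero denominator would make it infinite. This is how
finiteness of c_gp is obtained. -/
lemma ellC_ne_zero_of_LB {ΓD : Set (E n)} {k₀ r : ℝ} (hn : 0 < n) (hr : 0 < r)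
    (h : LB Ω ΓD k₀ r ≠ ⊤) : ellC Ω ΓD k₀ ≠ 0 := by
  intro h0
  refine h ?_
  rw [LB, h0, ENNReal.div_zero]
  refine mul_ne_zero (by simpa using hr) (pow_ne_zero _ (sobolevConst_ne_zero hn (by norm_num)))

/-- The difference estimate for identical data has a zero right-hand side. -/
lemma eq_of_solvesFlow {ν : E 2 → ℝ} {φ : H1 Ω 2} (h : MemLp (viscField ν φ) ⊤ Ω.vol)
    (hn : sobolevConst Ω n 4 ≠ ⊤) {γ κ₁ κ₂ κ₃ a : ℝ} {α : E 2} {g : E n} {w : H10 Ω n}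
    (ha : 0 < a) (hκ₂ : 0 ≤ κ₂) (hκ₃ : 0 ≤ κ₃)
    (hAB : ∀ x, a / 2 * ‖x‖ ^ 2 ≤ flowAB (viscOp ν φ h) hn γ κ₁ κ₂ κ₃ w x x) {x x' : HH Ω}
    (hx : SolvesFlow Ω ν γ κ₁ κ₂ κ₃ α g w φ x) (hx' : SolvesFlow Ω ν γ κ₁ κ₂ κ₃ α g w φ x') :
    x = x' := by
  have h0 := norm_sub_le_of_solvesFlow h h hn hκ₂ hκ₃ hAB hx hx'
  have e1 : ‖φ - φ‖ = 0 := by rw [sub_self, norm_zero]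
  have e2 : ‖w - w‖ = 0 := by rw [sub_self, norm_zero]
  have e3 : ‖viscOp ν φ h x'.t - viscOp ν φ h x'.t‖ = 0 := by rw [sub_self, norm_zero]
  rw [e1, e2, e3] at h0
  have h1 : ‖x - x'‖ = 0 := by
    refine le_antisymm ?_ (norm_nonneg _)
    generalize ‖x - x'‖ = N at h0 ⊢
    simp only [mul_zero, zero_mul, add_zero] at h0
    nlinarith
  exact sub_eq_zero.1 (norm_eq_zero.1 h1)

/-- Lipschitz continuity of the transport solution operator, with the constant `L_ℬ`. -/
lemma ofReal_norm_sub_le_of_transport {ΓD : Set (E n)} {k : Fin 2 → E n → ℝ} {k₀ r : ℝ}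
    (hk₀ : 0 < k₀) (hkd : MemLp (diffField k) ⊤ Ω.vol) (hk : ∀ᵐ x ∂Ω.vol, ∀ i, k₀ ≤ k i x)
    (hell : ellC Ω ΓD k₀ ≠ 0) (hc : c1 Ω ≠ ⊤) (h2 : sobolevConst Ω 2 4 ≠ ⊤)
    (hn : sobolevConst Ω n 4 ≠ ⊤) (hle : sobolevConst Ω 2 4 ≤ sobolevConst Ω n 4)
    {φD : Lp (E 2) 2 (surf ΓD)} {w w' : H10 Ω n} {φ φ' χ χ' : H1 Ω 2}
    (hr : 0 ≤ r) (hφ : ‖φ‖ ≤ r) (hw' : ‖w'‖ ≤ r)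
    (hχ : HasTrace χ φD) (hχ' : HasTrace χ' φD)
    (hsol : ∀ ψ ∈ H1D Ω ΓD, transC k hkd χ ψ = transG h2 hn w φ ψ)
    (hsol' : ∀ ψ ∈ H1D Ω ΓD, transC k hkd χ' ψ = transG h2 hn w' φ' ψ) :
    ENNReal.ofReal ‖χ - χ'‖ ≤
      LB Ω ΓD k₀ r * (ENNReal.ofReal ‖w - w'‖ + ENNReal.ofReal ‖φ - φ'‖) := by
  have hβ : (ellC Ω ΓD k₀)⁻¹ ≠ ⊤ := by simpa using hell
  have h := ENNReal.ofReal_le_ofReal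
    (norm_sub_le_of_transport hk₀ hkd hk hell h2 hn hle hr hφ hw' hχ hχ' hsol hsol')
  refine h.trans (le_of_eq ?_)
  rw [ENNReal.ofReal_mul ENNReal.toReal_nonneg, ENNReal.ofReal_toReal hβ,
    ENNReal.ofReal_mul (mul_nonneg hr ENNReal.toReal_nonneg), ENNReal.ofReal_mul hr,
    ENNReal.ofReal_toReal hc, ENNReal.ofReal_add (norm_nonneg _) (norm_nonneg _), LB,
    div_eq_mul_inv]
  ring

end

end DoubleDiffusive

/-! ### The fixed point argument. -/

set_option maxHeartbeats 2000000 in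
theorem mainTheorem1 {n : ℕ} (hn : n = 2 ∨ n = 3) (Ω : PolyhedralDomain n)
    -- the Dirichlet part of the boundary
    (ΓD : Set (E n)) (hΓD : ΓD ⊆ Ω.boundary) (hΓDm : MeasurableSet ΓD)
    (hΓDpos : 0 < surf ΓD Set.univ)
    -- viscosity
    (ν : E 2 → ℝ) (ν₁ ν₂ Lν : ℝ) (hν₁ : 0 < ν₁) (hν₂ : 0 < ν₂) (hLν : 0 < Lν)
    (hν : ∀ a, ν₁ ≤ ν a ∧ ν a ≤ ν₂) (hνLip : ∀ a b, |ν a - ν b| ≤ Lν * ‖a - b‖)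
    -- diffusion tensor
    (k : Fin 2 → E n → ℝ) (k₀ : ℝ) (hk₀ : 0 < k₀) (hkinf : ∀ i, MemLp (k i) ⊤ Ω.vol)
    (hk : ∀ᵐ x ∂Ω.vol, ∀ i, k₀ ≤ k i x)
    -- inverse Darcy number, expansion coefficients, gravity, Dirichlet datum
    (γ : ℝ) (hγ : 0 < γ) (α : E 2) (g : E n)
    (φD : Lp (E 2) 2 (surf ΓD)) (hφD : φD ∈ HHalf Ω ΓD)
    -- stabilization parameters
    (κ₁ κ₂ κ₃ δ₁ δ₂ δ₃ : ℝ)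
    (hδ₁ : δ₁ ∈ Set.Ioo 0 (1 / ν₂)) (hδ₂ : δ₂ ∈ Set.Ioo 0 (2 / γ)) (hδ₃ : δ₃ ∈ Set.Ioo 0 1)
    (hκ₃ : κ₃ ∈ Set.Ioo 0 (2 * ν₁ * δ₁ / ν₂)) (hκ₂ : κ₂ ∈ Set.Ioo 0 (2 * δ₂))
    (hκ₁ : κ₁ ∈ Set.Ioo 0 (2 * δ₃ * (2 * ν₁ - κ₃ * ν₂ / δ₁)))
    -- ellipticity constant and radius of the ball
    (a : ℝ) (ha : a = ellA Ω ν₁ ν₂ γ κ₁ κ₂ κ₃ δ₁ δ₂ δ₃)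
    (r : ℝ) (hr : 0 < r) (hr₀ : ENNReal.ofReal r < r0 Ω a κ₃)
    -- assumed `ε`-regularity of the operator `𝒜`
    (ε : ℝ) (hε₂ : n = 2 → ε ∈ Set.Ioo 0 1) (hε₃ : n = 3 → ε ∈ Set.Ico (1 / 2) 1)
    (Chat : ℝ) (hChat : 0 < Chat)
    (hreg : ∀ (w : H10 Ω n) (φ : H1 Ω 2), ‖w‖ + ‖φ‖ ≤ r →
      ∀ x : HH Ω, SolvesFlow Ω ν γ κ₁ κ₂ κ₃ α g w φ x →
        fracNorm ε x.t ≤ ENNReal.ofReal (Chat * ‖α‖ * ‖g‖ * ‖φ.1.fst‖))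
    -- smallness of the data
    (hsmall : ENNReal.ofReal (r * CA a κ₂) * (1 + ENNReal.ofReal r * CB Ω ΓD k k₀) *
        ENNReal.ofReal (‖α‖ * ‖g‖)
      + CB Ω ΓD k k₀ * ENNReal.ofReal (halfNorm Ω φD) ≤ ENNReal.ofReal r)
    (hLip : LLip Ω ΓD a Lν κ₂ κ₃ ε k₀ r Chat (‖α‖ * ‖g‖) < 1) :
    (∃! p : HH Ω × H1 Ω 2,
      IsSolution Ω ν γ κ₁ κ₂ κ₃ α g k φD p.1 p.2 ∧ ‖p.1.vel‖ + ‖p.2‖ ≤ r) ∧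
    ∀ (x : HH Ω) (φ : H1 Ω 2),
      IsSolution Ω ν γ κ₁ κ₂ κ₃ α g k φD x φ → ‖x.vel‖ + ‖φ‖ ≤ r →
        ‖x‖ ≤ CA a κ₂ * r * ‖α‖ * ‖g‖ ∧
        ENNReal.ofReal ‖φ‖ ≤ CB Ω ΓD k k₀ * ENNReal.ofReal (r * ‖x.vel‖ + halfNorm Ω φD) := by
  obtain ⟨hκ₁0, -⟩ := hκ₁
  have hκ₂0 : 0 < κ₂ := hκ₂.1
  have hκ₃0 : 0 < κ₃ := hκ₃.1
  have ha0 : 0 < a := pos_of_lt_r0 hr₀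
  have hc := c1_ne_top_of_lt_r0 hr₀
  have hrc := mul_le_of_lt_r0 hr.le hr₀
  have hn4 := sobolevConst_ne_top_of_c1 hc
  have hle := sobolevConst_two_le (Ω := Ω) hn 4
  have h24 : sobolevConst Ω 2 4 ≠ ⊤ := (hle.trans_lt hn4.lt_top).ne
  -- L_ℬ is a summand of L_Lip < 1.
  have hLB : LB Ω ΓD k₀ r ≠ ⊤ := ((le_add_self.trans_lt hLip).trans ENNReal.one_lt_top).ne
  have hell : ellC Ω ΓD k₀ ≠ 0 := ellC_ne_zero_of_LB (by omega) hr hLB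
  have hvisc := fun φ : H1 Ω 2 => memLp_viscField (Ω := Ω) hν₁ hν hνLip φ
  have hkd := memLp_diffField hkinf
  have hε : 0 < ε := by
    rcases hn with h | h
    · exact (hε₂ h).1
    · linarith [(hε₃ h).1]
  have hεn : 2 * ε < n := by
    rcases hn with h | h
    · have := (hε₂ h).2
      rw [h]
      push_cast
      linarith
    · have := (hε₃ h).2
      rw [h]
      push_cast
      linarith
  have hd0 : 0 ≤ ‖α‖ * ‖g‖ := mul_nonneg (norm_nonneg _) (norm_nonneg _)
  have hCA : 0 ≤ CA a κ₂ := by unfold CA; positivity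
  have hAB : ∀ (φ : H1 Ω 2) (w : H10 Ω n), ‖w‖ ≤ r → ∀ x : HH Ω,
      a / 2 * ‖x‖ ^ 2 ≤ flowAB (viscOp ν φ (hvisc φ)) hn4 γ κ₁ κ₂ κ₃ w x x := by
    intro φ w hw
    refine flowAB_coercive hn4 hκ₃0.le ?_ ?_
    · intro x
      rw [ha]
      exact flowA_coercive hν₂ hγ hδ₁ hδ₂ hδ₃ hκ₁0 hκ₂0 hκ₃0 (ha ▸ ha0)
        (norm_viscOp_le hν₁ hν (hvisc φ)) (le_inner_viscOp hν (hvisc φ)) x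
    · refine le_trans ?_ hrc
      exact mul_le_mul_of_nonneg_right (mul_le_mul_of_nonneg_left hw ENNReal.toReal_nonneg)
        (Real.sqrt_nonneg _)
  have hxbd : ∀ (w : H10 Ω n) (φ : H1 Ω 2), ‖w‖ ≤ r → ‖φ‖ ≤ r → ∀ x : HH Ω,
      SolvesFlow Ω ν γ κ₁ κ₂ κ₃ α g w φ x → ‖x‖ ≤ CA a κ₂ * (‖α‖ * ‖g‖) * r := by
    intro w φ hw hφ x hx
    refine (norm_le_of_solvesFlow (hvisc φ) hn4 ha0 hκ₂0.le (hAB φ w hw) hx).trans ?_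
    exact mul_le_mul_of_nonneg_left ((norm_fst_le φ.1).trans hφ) (mul_nonneg hCA hd0)
  obtain ⟨hCBtop, -⟩ := CB_toReal (k := k) hell hc hkinf
  have hN0 := halfNorm_nonneg (Ω := Ω) φD
  have hCB0 : 0 ≤ (CB Ω ΓD k k₀).toReal := ENNReal.toReal_nonneg
  have hsm : r * CA a κ₂ * (1 + r * (CB Ω ΓD k k₀).toReal) * (‖α‖ * ‖g‖)
      + (CB Ω ΓD k k₀).toReal * halfNorm Ω φD ≤ r := by
    rw [← ENNReal.ofReal_toReal hCBtop, ← ENNReal.ofReal_mul hr.le, ← ENNReal.ofReal_one,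
      ← ENNReal.ofReal_add zero_le_one (by positivity), ← ENNReal.ofReal_mul (by positivity),
      ← ENNReal.ofReal_mul (by positivity), ← ENNReal.ofReal_mul (by positivity),
      ← ENNReal.ofReal_add (by positivity) (by positivity),
      ENNReal.ofReal_le_ofReal_iff hr.le] at hsmall
    exact hsmall
  have hχbd : ∀ (w : H10 Ω n) (φ χ : H1 Ω 2), ‖φ‖ ≤ r → HasTrace χ φD →
      (∀ ψ ∈ H1D Ω ΓD, formC Ω k χ ψ = formG Ω w φ ψ) →
      ‖χ‖ ≤ (CB Ω ΓD k k₀).toReal * (r * ‖w‖ + halfNorm Ω φD) := by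
    intro w φ χ hφ hχ hsol
    refine (norm_le_of_transport hk₀ hkinf hk hell hc h24 hn4 hle hφD hχ
      (w := w) (φ := φ) fun ψ hψ => ?_).trans ?_
    · rw [← formC_eq, ← formG_eq]
      exact hsol ψ hψ
    · refine mul_le_mul_of_nonneg_left (add_le_add ?_ le_rfl) hCB0
      rw [mul_comm]
      exact mul_le_mul_of_nonneg_right hφ (norm_nonneg _)
  -- Part of the smallness condition; it keeps the new velocity in the ball of radius r, as the
  -- transport estimate requires.
  have hdle : CA a κ₂ * (‖α‖ * ‖g‖) * r ≤ r := by
    have h1 : 0 ≤ r * CA a κ₂ * (r * (CB Ω ΓD k k₀).toReal) * (‖α‖ * ‖g‖) := by positivity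
    have h2 : 0 ≤ (CB Ω ΓD k k₀).toReal * halfNorm Ω φD := by positivity
    linarith
  -- One decoupled step: the flow is solved with the old pair, the transport with the new velocity
  -- and the old φ. The exponent 1 makes the product norm the sum defining W_r.
  let Rel : WithLp 1 (H10 Ω n × H1 Ω 2) → WithLp 1 (H10 Ω n × H1 Ω 2) → Prop := fun p q =>
    ∃ x : HH Ω, SolvesFlow Ω ν γ κ₁ κ₂ κ₃ α g p.fst p.snd x ∧ q.fst = x.vel ∧
      HasTrace q.snd φD ∧ ∀ ψ ∈ H1D Ω ΓD, formC Ω k q.snd ψ = formG Ω q.fst p.snd ψ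
  let S : Set (WithLp 1 (H10 Ω n × H1 Ω 2)) := {p | ‖p.fst‖ + ‖p.snd‖ ≤ r}
  have hSw : ∀ p ∈ S, ‖p.fst‖ ≤ r := fun p hp =>
    (le_add_of_nonneg_right (norm_nonneg p.snd)).trans hp
  have hSφ : ∀ p ∈ S, ‖p.snd‖ ≤ r := fun p hp =>
    (le_add_of_nonneg_left (norm_nonneg p.fst)).trans hp
  have hLL := (hLip.trans ENNReal.one_lt_top).ne
  have hlip : ∀ p ∈ S, ∀ p' ∈ S, ∀ q q', Rel p q → Rel p' q' →
      dist q q' ≤ (LLip Ω ΓD a Lν κ₂ κ₃ ε k₀ r Chat (‖α‖ * ‖g‖)).toReal * dist p p' := by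
    rintro p hp p' hp' q q' ⟨x, hx, hqx, hqt, hqs⟩ ⟨x', hx', hqx', hqt', hqs'⟩
    have hb' := hxbd p'.fst p'.snd (hSw p' hp') (hSφ p' hp') x' hx'
    have hv' : ‖x'.vel‖ ≤ r * CA a κ₂ * (‖α‖ * ‖g‖) :=
      x'.norm_vel_le.trans (hb'.trans (le_of_eq (by ring)))
    have hreg' : fracNorm ε x'.t ≤ ENNReal.ofReal (Chat * (‖α‖ * ‖g‖) * r) := by
      refine (hreg p'.fst p'.snd hp' x' hx').trans (ENNReal.ofReal_le_ofReal ?_)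
      rw [mul_assoc Chat]
      exact mul_le_mul_of_nonneg_left ((norm_fst_le p'.snd.1).trans (hSφ p' hp'))
        (mul_nonneg hChat.le hd0)
    have hU := ofReal_norm_sub_le_of_solvesFlow hLν.le hνLip (hvisc p.snd) (hvisc p'.snd) hc hn4
      ha0 hr.le hChat.le hκ₂0.le hκ₃0.le hε hεn (hAB p.snd p.fst (hSw p hp)) hx hx' hreg' hv'
    have hU' : ENNReal.ofReal ‖q.fst - q'.fst‖ ≤ ENNReal.ofReal ‖x - x'‖ := by
      rw [hqx, hqx']
      exact ENNReal.ofReal_le_ofReal (x - x').norm_vel_le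
    have hX := ofReal_norm_sub_le_of_transport hk₀ hkd hk hell hc h24 hn4 hle hr.le (hSφ p hp)
      (w := q.fst) (w' := q'.fst) (φ := p.snd) (φ' := p'.snd)
      (by rw [hqx']; exact x'.norm_vel_le.trans (hb'.trans hdle)) hqt hqt'
      (fun ψ hψ => by rw [← formC_eq, ← formG_eq]; exact hqs ψ hψ)
      (fun ψ hψ => by rw [← formC_eq, ← formG_eq]; exact hqs' ψ hψ)
    have hfin := contraction_arith (hU'.trans hU) hX
    have hfin' := add_le_toReal_mul_add (norm_nonneg (q.fst - q'.fst))
      (norm_nonneg (q.snd - q'.snd)) (norm_nonneg (p.fst - p'.fst))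
      (norm_nonneg (p.snd - p'.snd)) hLL hfin
    rw [dist_eq_norm, dist_eq_norm, WithLp.prod_norm_eq_of_L1, WithLp.prod_norm_eq_of_L1]
    exact hfin'
  have hK1 : (LLip Ω ΓD a Lν κ₂ κ₃ ε k₀ r Chat (‖α‖ * ‖g‖)).toReal < 1 := by
    have := (ENNReal.toReal_lt_toReal hLL ENNReal.one_ne_top).2 hLip
    rwa [ENNReal.toReal_one] at this
  have hex : ∀ p ∈ S, ∃ q ∈ S, Rel p q := by
    intro p hp
    obtain ⟨x, hx⟩ := exists_solvesFlow (hvisc p.snd) hn4 α g ha0 (hAB p.snd p.fst (hSw p hp))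
    obtain ⟨χ, hχ, hsol⟩ := exists_transport hk₀ hkd hk hell hφD (transG h24 hn4 x.vel p.snd)
    have hsol' : ∀ ψ ∈ H1D Ω ΓD, formC Ω k χ ψ = formG Ω x.vel p.snd ψ := fun ψ hψ => by
      rw [formC_eq hkd, formG_eq h24 hn4]
      exact hsol ψ hψ
    refine ⟨WithLp.toLp 1 (x.vel, χ), ?_, x, hx, rfl, hχ, hsol'⟩
    have h1 : ‖x.vel‖ ≤ CA a κ₂ * (‖α‖ * ‖g‖) * r :=
      x.norm_vel_le.trans (hxbd _ _ (hSw p hp) (hSφ p hp) x hx)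
    have h2 := hχbd x.vel p.snd χ (hSφ p hp) hχ hsol'
    change ‖x.vel‖ + ‖χ‖ ≤ r
    -- ‖u‖ + ‖χ‖ ≤ (1 + rC_ℬ)‖u‖ + C_ℬ‖φ_D‖, and the bound on ‖u‖ turns this into the smallness
    -- condition.
    have h3 := mul_le_mul_of_nonneg_left h1
      (by positivity : 0 ≤ 1 + r * (CB Ω ΓD k k₀).toReal)
    linarith
  have hScl : IsClosed S := by
    have h1 : Continuous fun p : WithLp 1 (H10 Ω n × H1 Ω 2) => p.fst :=
      (WithLp.fstL 1 ℝ _ _).continuous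
    have h2 : Continuous fun p : WithLp 1 (H10 Ω n × H1 Ω 2) => p.snd :=
      (WithLp.sndL 1 ℝ _ _).continuous
    exact isClosed_le (h1.norm.add h2.norm) continuous_const
  have hS0 : S.Nonempty := ⟨0, by
    change ‖(0 : H10 Ω n)‖ + ‖(0 : H1 Ω 2)‖ ≤ r
    rw [norm_zero, norm_zero, add_zero]
    exact hr.le⟩
  have hRel : ∀ (x : HH Ω) (φ : H1 Ω 2), IsSolution Ω ν γ κ₁ κ₂ κ₃ α g k φD x φ →
      Rel (WithLp.toLp 1 (x.vel, φ)) (WithLp.toLp 1 (x.vel, φ)) := fun x φ h =>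
    ⟨x, h.2.1, rfl, h.1, h.2.2⟩
  refine ⟨?_, ?_⟩
  · obtain ⟨p, hpS, x, hx, hpx, hpt, hps⟩ := exists_fixed_of_relation hScl hS0 Rel
      ENNReal.toReal_nonneg hK1 hex hlip
    refine ⟨(x, p.snd), ⟨⟨hpt, ?_, ?_⟩, ?_⟩, ?_⟩
    · rw [← hpx]
      exact hx
    · rw [← hpx]
      exact hps
    · rw [← hpx]
      exact hpS
    · rintro ⟨x', φ'⟩ ⟨hsol', hr'⟩
      have hp' : WithLp.toLp 1 (x'.vel, φ') ∈ S := hr'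
      -- A second solution in W_r is also a fixed point, so the contraction estimate identifies the
      -- pairs (u, φ); t and σ then agree by uniqueness for the flow problem.
      have hd := hlip p hpS _ hp' p _ ⟨x, hx, hpx, hpt, hps⟩ (hRel x' φ' hsol')
      have hpp : p = WithLp.toLp 1 (x'.vel, φ') := by
        refine dist_eq_zero.1 (le_antisymm ?_ dist_nonneg)
        by_contra hcon
        nlinarith [not_le.1 hcon]
      have hφ : p.snd = φ' := congrArg (fun z => z.snd) hpp
      have hw : p.fst = x'.vel := congrArg (fun z => z.fst) hpp
      have hxx : x' = x := by
        refine eq_of_solvesFlow (hvisc p.snd) hn4 ha0 hκ₂0.le hκ₃0.le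
          (hAB p.snd p.fst (hSw p hpS)) ?_ hx
        rw [hw, hφ]
        exact hsol'.2.1
      rw [hxx, hφ]
  · intro x φ hsol hxr
    have hw : ‖x.vel‖ ≤ r := (le_add_of_nonneg_right (norm_nonneg φ)).trans hxr
    have hφ : ‖φ‖ ≤ r := (le_add_of_nonneg_left (norm_nonneg x.vel)).trans hxr
    refine ⟨(hxbd x.vel φ hw hφ x hsol.2.1).trans (le_of_eq (by ring)), ?_⟩
    have h1 := hχbd x.vel φ φ hφ hsol.1 hsol.2.2
    refine (ENNReal.ofReal_le_ofReal h1).trans (le_of_eq ?_)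
    rw [ENNReal.ofReal_mul hCB0, ENNReal.ofReal_toReal hCBtop]
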